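/- Let $d\ge k+1$ and let $\Gamma$ be a proper $k$-degenerate distance graph in $\mathbb R^d$: a connected finite graph whose vertices $v_0=0,v_1,\dots,v_n$ are distinct points of $\mathbb R^d$, ordered so that for $1\le j\le n$ the set $V_j$ of those $v_i$ with $i<j$ that are adjacent to $v_j$ satisfies $1\le|V_j|\le k$ and $\{v_j\}\cup V_j$ is in general position (affinely independent). Let $$S_\Gamma=\{(x_0,\dots,x_n)\in(\mathbb R^d)^{n+1}: x_0=0,\ |x_i-x_j|=|v_i-v_j| \text{ whenever } v_i,v_j \text{ are adjacent}\}.$$ For $1\le j\le n$ and points $x_0=0,x_1,\dots,x_{j-1}$ put $X_j=\{x_i: v_i\in V_j\}$, let $$S_j=\{y\in\mathbb R^d: |y-x_i|=|v_j-v_i| \text{ for all } i \text{ with } v_i\in V_j\},$$ and let $\sigma_j$ be the normalized surface measure on $S_j$ (of dimension $d-|V_j|$). Fix functions $\eta_1,\dots,\eta_n\in C_c^\infty(\mathbb R^d)$ with $0\le\eta_j\le1$ for which there is $r_\Gamma>0$ such that for every $(x_0,\dots,x_n)\in S_\Gamma$ with $x_j\in\operatorname{supp}\eta_j$ for all $1\le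 j\le n$, and every $1\le j\le n$, the points $x_i$ with $v_i\in V_j$ are in general position and the radius of $S_j$, that is, the distance from $x_j$ to the affine span of $X_j$, is at least $r_\Gamma$. Put $d\mu_j=\eta_j\,d\sigma_j$ and, for functions $f_0,\dots,f_n$ on $[0,1]^d$, extended by zero to $\mathbb R^d$, $$T_\Gamma(f_0,\dots,f_n)(\lambda)=\int\!\int\cdots\int f_0(x)f_1(x-\lambda x_1)\cdots f_n(x-\lambda x_n)\,d\mu_n(x_n)\cdots d\mu_1(x_1)\,dx .$$ For $L>0$ let $\|f\|_{U^1(L)}=\|f*\varphi_L\|_{L^2(\mathbb R^d)}$, where $\varphi_L(x)=L^{-d}\mathbf 1_{[-1/2,1/2]^d}(x/L)$. Then there is a constant $C_\Gamma>0$, depending only on $\Gamma$ and the fixed cutoffs $\eta_j$, such that for all $0<\varepsilon,\lambda\le1$, all $0<L\le\varepsilon^6\lambda$, all $0\le m\le n$ and all measurable $f_0,\dots,f_m:[0,1]^d\to[-1,1]$, $$\left|T_\Gamma(f_0,f_1,\dots,f_m,1,\dots,1)(\lambda)\right|\le\|f_m\|_{U^1(L)}+C_\Gamma\,\varepsilon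 ,$$ where $1$ stands for the indicator function of $[0,1]^d$. -/

import Mathlib

open MeasureTheory
open scoped ContDiff Convolution

/-- Euclidean space `ℝ^d`. -/
abbrev Euc (d : ℕ) : Type := EuclideanSpace ℝ (Fin d)

/-- A distance graph in `ℝ^d` with vertices `v_0, …, v_n` listed in a fixed order and `v_0 = 0`:
a connected finite graph whose vertices are (distinct) points of `ℝ^d`. -/
structure DistanceGraph (d n : ℕ) where
  graph : SimpleGraph (Fin (n + 1))
  connected : graph.Connected
  vertex : Fin (n + 1) → Euc d
  vertex_injective : Function.Injective vertex
  vertex_zero : vertex 0 = 0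

namespace DistanceGraph

variable {d n : ℕ}

open Classical in
/-- The predecessors of the vertex with index `j + 1` (the vertices with indices `1, …, n` are
written `j.succ` with `j : Fin n`): the earlier vertices adjacent to it. -/
noncomputable def pred (Γ : DistanceGraph d n) (j : Fin n) : Finset (Fin (n + 1)) :=
  Finset.univ.filter (fun i => i < j.succ ∧ Γ.graph.Adj i j.succ)

/-- The vertices are listed in a `k`-degenerate order: each has at most `k` predecessors. (This
makes the graph `k`-degenerate: in any subgraph the last vertex has degree at most `k`.) -/
def IsDegenerate (Γ : DistanceGraph d n) (k : ℕ) : Prop :=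
  ∀ j : Fin n, (Γ.pred j).card ≤ k

/-- Properness: each vertex together with its predecessors is in general position. -/
def IsProper (Γ : DistanceGraph d n) : Prop :=
  ∀ j : Fin n, AffineIndependent ℝ
    (fun i : {i : Fin (n + 1) // i = j.succ ∨ i ∈ Γ.pred j} => Γ.vertex i)

/-- The configuration space `S_Γ` of isometric copies of `Γ` with `x_0 = 0`. -/
def configSpace (Γ : DistanceGraph d n) : Set (Fin (n + 1) → Euc d) :=
  {x | x 0 = 0 ∧ ∀ i j, Γ.graph.Adj i j → ‖x i - x j‖ ^ 2 = ‖Γ.vertex i - Γ.vertex j‖ ^ 2}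

/-- The sphere `S_j` of admissible positions of the `j.succ`-th point; it depends only on the
coordinates of `x` whose index is a predecessor of `j.succ`. -/
def sphere (Γ : DistanceGraph d n) (j : Fin n) (x : Fin (n + 1) → Euc d) : Set (Euc d) :=
  {y | ∀ i ∈ Γ.pred j, ‖y - x i‖ ^ 2 = ‖Γ.vertex j.succ - Γ.vertex i‖ ^ 2}

/-- The normalized surface measure `σ_j` on the sphere `S_j`, which has dimension `d - |V_j|`:
Hausdorff measure of that dimension restricted to `S_j` and divided by its total mass. -/
noncomputable def surfaceMeasure (Γ : DistanceGraph d n) (j : Fin n) (x : Fin (n + 1) → Euc d) :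
    Measure (Euc d) :=
  ProbabilityTheory.cond (Measure.hausdorffMeasure ((d : ℝ) - ((Γ.pred j).card : ℝ)))
    (Γ.sphere j x)

/-- Admissible cutoffs `η_1, …, η_n` (`η j` belongs to the vertex `j.succ`): smooth, compactly
supported, with values in `[0, 1]`, and such that for some `r > 0`, for every configuration in
`S_Γ` with `x_j ∈ supp η_j` for all `j`, each `S_j` is a sphere of dimension exactly `d - |V_j|`
(its centres `x_i` are in general position) and of radius at least `r`, the radius being
the distance from `x_j` to the affine span of these centres. -/
structure IsCutoff (Γ : DistanceGraph d n) (η : Fin n → Euc d → ℝ) : Prop where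
  smooth : ∀ j, ContDiff ℝ ∞ (η j)
  compact : ∀ j, HasCompactSupport (η j)
  range : ∀ j y, 0 ≤ η j y ∧ η j y ≤ 1
  radius : ∃ r : ℝ, 0 < r ∧ ∀ x ∈ Γ.configSpace, (∀ j : Fin n, x j.succ ∈ tsupport (η j)) →
    ∀ j : Fin n, AffineIndependent ℝ (fun i : {i : Fin (n + 1) // i ∈ Γ.pred j} => x i) ∧
      r ≤ Metric.infDist (x j.succ) (affineSpan ℝ (x '' {i | i ∈ Γ.pred j}) : Set (Euc d))

/-- The measure `dμ_j = η_j dσ_j`. -/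
noncomputable def localMeasure (Γ : DistanceGraph d n) (η : Fin n → Euc d → ℝ) (j : Fin n)
    (x : Fin (n + 1) → Euc d) : Measure (Euc d) :=
  (Γ.surfaceMeasure j x).withDensity (fun y => ENNReal.ofReal (η j y))

/-- The iterated integral of `F` over the points with indices in the given list: the first
listed point is the outermost variable of integration, and each measure `μ_j` depends on the
points chosen before. -/
noncomputable def iteratedIntegral (Γ : DistanceGraph d n) (η : Fin n → Euc d → ℝ)
    (F : (Fin (n + 1) → Euc d) → ℝ) : List (Fin n) → (Fin (n + 1) → Euc d) → ℝ
  | [], x => F x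
  | j :: js, x =>
      ∫ y, Γ.iteratedIntegral η F js (Function.update x j.succ y) ∂(Γ.localMeasure η j x)

/-- The localized counting function
`T_Γ(f_0,…,f_n)(λ) = ∫ ∫ ⋯ ∫ f_0(x) f_1(x - λ x_1) ⋯ f_n(x - λ x_n) dμ_n(x_n) ⋯ dμ_1(x_1) dx`,
where `x_0 = 0`; functions on the unit cube are extended by zero. -/
noncomputable def countingFunction (Γ : DistanceGraph d n) (η : Fin n → Euc d → ℝ)
    (f : Fin (n + 1) → Euc d → ℝ) (lam : ℝ) : ℝ :=
  ∫ x : Euc d, Γ.iteratedIntegral η (fun y => ∏ i, f i (x - lam • y i)) (List.finRange n) 0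

end DistanceGraph

/-- The unit cube `[0,1]^d`. -/
def unitCube (d : ℕ) : Set (Euc d) := {x | ∀ i, 0 ≤ x i ∧ x i ≤ 1}

/-- A (Lebesgue measurable) function `[0,1]^d → [-1,1]`, extended by zero to `ℝ^d`. -/
structure IsCubeFunction {d : ℕ} (f : Euc d → ℝ) : Prop where
  aemeasurable : AEMeasurable f volume
  mem_Icc : ∀ x ∈ unitCube d, f x ∈ Set.Icc (-1 : ℝ) 1
  eq_zero : ∀ x ∉ unitCube d, f x = 0

/-- `φ_L(x) = L^{-d} φ(x / L)` with `φ` the indicator function of `[-1/2, 1/2]^d`. -/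
noncomputable def cubeKernel (d : ℕ) (L : ℝ) (x : Euc d) : ℝ :=
  (L ^ d)⁻¹ * Set.indicator {y : Euc d | ∀ i, |y i| ≤ 1 / 2} (fun _ => (1 : ℝ)) (L⁻¹ • x)

/-- The `U¹(L)`-norm `‖f * φ_L‖_2`. -/
noncomputable def uOneNorm {d : ℕ} (L : ℝ) (f : Euc d → ℝ) : ℝ :=
  (eLpNorm (f ⋆[ContinuousLinearMap.mul ℝ ℝ, volume] cubeKernel d L) 2 volume).toReal

/-!
Write the counting function as an average over `u` of `∏ i, f i (u - lam x_i)` over random copies of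
the graph: the vertices are placed one after the other, each uniformly on the sphere prescribed by its
predecessors, with the weight `∏ η_j`. Only `f 0, …, f m` are arbitrary; averaging over the vertices
after `m`, which carry indicators of the cube, leaves a factor that is Lipschitz in the positions of
the first vertices and in `u`, in the mean over `u` (`exists_lintegral_tailAt_sub_le`). Split
`f m = k + q`, where `k = f m * φ_L`. The term with `k` is at most `‖k‖₂ = ‖f m‖_{U¹(L)}` by the
Cauchy-Schwarz inequality, as only `u` in the cube contribute.

In the term with `q`, let `m > 0`. The functions of the vertices before `m` do not depend on `x_m` and
are bounded by `1`. Cauchy-Schwarz in `u` and the positions of these vertices removes them, and bounds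
the term by the square root of a correlation of `q` with itself over the chords `w` joining two
independent points of the sphere of `x_m` (`lintegral_sphereAverage_sq`),
`∫ q(u) q(u + lam w) H(u, w) = ∫ q(u) (f(u + lam w) - ∫ f(u + lam w - h) dπ(h)) H(u, w)`,
with `π` uniform on the cube of side `L` and `H` a weight that is Lipschitz in the mean. For this
correlation to be small it suffices to integrate by parts along measure-preserving motions of the
sphere and its two points: common rotations of space, and rotations of the second point within the
sphere. Where the two directions `θ`, `θ'` make an angle of at least `s`, these motions move `w` in
all directions of space, so that the derivative of `f` in the direction `h` is a combination of
derivatives along them, with coefficients of size `s⁻¹` and derivatives of size `s⁻²`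
(`transversality_smul_eq`); integrating by parts gives `O(lam⁻¹ L s⁻²)`. As the sphere lies in a
space of dimension at least `2`, the nearly parallel pairs have probability `O(s)`. So the correlation
is `O(s + lam⁻¹ L s⁻²)` (`SphereFamily.abs_integral_mul_le`), which for `s = ε²` and `L ≤ ε⁶ lam` is
`O(ε²)`. No Fourier analysis is needed. For `m = 0` the term with `q` is `O(L)` by moving the averaging
over `h` from `f 0` to the Lipschitz factor.

The surface measures are handled by a parametrization: the normalized Hausdorff measure of a sphere is
the image of the uniform measure of the unit ball of `ℝ^d` under `g ↦ c + ρ P g / |P g|`, with `c` the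
centre, `ρ` the radius and `P` the orthogonal projection to the directions of the sphere
(`surfaceMeasure_eq_map`). Since `P` depends smoothly on the predecessors and `1 / |P g|` has a finite
mean, this gives the Lipschitz dependence on the predecessors.
-/

/-! ### One-parameter groups of rotations -/

section Rotation

open scoped InnerProductSpace

variable {E : Type*} [NormedAddCommGroup E] [InnerProductSpace ℝ E]

/-- The infinitesimal rotation `z ↦ ⟪a, z⟫ b - ⟪b, z⟫ a` in the plane spanned by `a` and `b`. -/
noncomputable def wedge (a b : E) : E →L[ℝ] E :=
  (innerSL ℝ a).smulRight b - (innerSL ℝ b).smulRight a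

@[simp] lemma wedge_apply (a b z : E) : wedge a b z = ⟪a, z⟫_ℝ • b - ⟪b, z⟫_ℝ • a := by
  simp [wedge]

lemma norm_wedge_apply_le (a b z : E) : ‖wedge a b z‖ ≤ 2 * ‖a‖ * ‖b‖ * ‖z‖ := by
  rw [wedge_apply]
  have h1 : ‖⟪a, z⟫_ℝ • b‖ ≤ ‖a‖ * ‖z‖ * ‖b‖ := by
    rw [norm_smul]; gcongr; exact norm_inner_le_norm a z
  have h2 : ‖⟪b, z⟫_ℝ • a‖ ≤ ‖b‖ * ‖z‖ * ‖a‖ := by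
    rw [norm_smul]; gcongr; exact norm_inner_le_norm b z
  calc _ ≤ _ := norm_sub_le _ _
    _ ≤ _ := by linarith

lemma continuous_wedge : Continuous fun p : E × E => wedge p.1 p.2 := by
  have h : Continuous fun p : E × E => (innerSL ℝ p.1).smulRight p.2 :=
    (ContinuousLinearMap.smulRightL ℝ E E).continuous₂.comp
      (((innerSL ℝ).continuous.comp continuous_fst).prodMk continuous_snd)
  exact h.sub (h.comp continuous_swap)

variable [CompleteSpace E]

lemma smul_wedge_mem_skewAdjoint (t : ℝ) (a b : E) : t • wedge a b ∈ skewAdjoint (E →L[ℝ] E) := by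
  rw [skewAdjoint.mem_iff, ContinuousLinearMap.star_eq_adjoint]
  symm
  rw [ContinuousLinearMap.eq_adjoint_iff]
  intro x y
  simp only [wedge_apply, neg_apply, smul_apply,
    inner_neg_left, inner_smul_left, inner_smul_right, inner_sub_left, inner_sub_right,
    RCLike.conj_to_real, real_inner_comm a x, real_inner_comm b x]
  ring

/-- The rotation by `exp (t (a ∧ b))`. -/
noncomputable def wedgeRot (t : ℝ) (a b : E) : E ≃ₗᵢ[ℝ] E :=
  letI : NormedAlgebra ℚ (E →L[ℝ] E) := NormedAlgebra.restrictScalars ℚ ℝ _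
  Unitary.linearIsometryEquiv
    ⟨NormedSpace.exp (t • wedge a b),
      NormedSpace.exp_mem_unitary_of_mem_skewAdjoint (smul_wedge_mem_skewAdjoint t a b)⟩

lemma wedgeRot_apply (t : ℝ) (a b z : E) :
    wedgeRot t a b z = NormedSpace.exp (t • wedge a b) z := rfl

@[simp] lemma wedgeRot_zero (a b z : E) : wedgeRot 0 a b z = z := by
  simp [wedgeRot_apply]

lemma wedgeRot_wedgeRot_neg (t : ℝ) (a b z : E) :
    wedgeRot t a b (wedgeRot (-t) a b z) = z := by
  let : NormedAlgebra ℚ (E →L[ℝ] E) := NormedAlgebra.restrictScalars ℚ ℝ _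
  have h : NormedSpace.exp (t • wedge a b) * NormedSpace.exp ((-t) • wedge a b) = 1 := by
    rw [← NormedSpace.exp_add_of_commute]
    · simp
    · exact ((Commute.refl _).smul_left _).smul_right _
  simpa [wedgeRot_apply] using congrArg (fun T : E →L[ℝ] E => T z) h

lemma continuous_wedgeRot :
    Continuous fun p : (ℝ × E × E) × E => wedgeRot p.1.1 p.1.2.1 p.1.2.2 p.2 := by
  let : NormedAlgebra ℚ (E →L[ℝ] E) := NormedAlgebra.restrictScalars ℚ ℝ _
  simp only [wedgeRot_apply]
  have h : Continuous fun p : ℝ × E × E => NormedSpace.exp (p.1 • wedge p.2.1 p.2.2) :=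
    NormedSpace.exp_continuous.comp (continuous_fst.smul (continuous_wedge.comp continuous_snd))
  exact (h.comp continuous_fst).clm_apply continuous_snd

lemma hasDerivAt_wedgeRot (t : ℝ) (a b z : E) :
    HasDerivAt (fun s => wedgeRot s a b z) (wedgeRot t a b (wedge a b z)) t := by
  simpa [wedgeRot_apply] using
    (hasDerivAt_exp_smul_const (𝕂 := ℝ) (wedge a b) t).clm_apply (hasDerivAt_const t z)

lemma hasDerivAt_wedgeRot_zero (a b z : E) :
    HasDerivAt (fun s => wedgeRot s a b z) (wedge a b z) 0 := by
  simpa using hasDerivAt_wedgeRot 0 a b z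

lemma norm_wedgeRot_sub_le (t : ℝ) (a b z : E) :
    ‖wedgeRot t a b z - z‖ ≤ 2 * ‖a‖ * ‖b‖ * ‖z‖ * |t| := by
  have h := convex_univ.norm_image_sub_le_of_norm_hasDerivWithin_le
    (f := fun s => wedgeRot s a b z) (f' := fun s => wedgeRot s a b (wedge a b z))
    (C := 2 * ‖a‖ * ‖b‖ * ‖z‖) (x := 0) (y := t)
    (fun s _ => (hasDerivAt_wedgeRot s a b z).hasDerivWithinAt)
    (fun s _ => by rw [LinearIsometryEquiv.norm_map]; exact norm_wedge_apply_le a b z)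
    (Set.mem_univ _) (Set.mem_univ _)
  simpa using h

lemma wedgeRot_commute {a b : E} {P : E →L[ℝ] E} (h : ∀ z, P (wedge a b z) = wedge a b (P z))
    (t : ℝ) (z : E) : P (wedgeRot t a b z) = wedgeRot t a b (P z) := by
  let : NormedAlgebra ℚ (E →L[ℝ] E) := NormedAlgebra.restrictScalars ℚ ℝ _
  have hc : Commute P (t • wedge a b) :=
    Commute.smul_right (ContinuousLinearMap.ext h : P * wedge a b = wedge a b * P) t
  exact congrArg (fun T : E →L[ℝ] E => T z) (Commute.exp_right hc).eq

end Rotation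

/-! ### Directions of vectors and two Lipschitz estimates -/

section Direction

open scoped InnerProductSpace

variable {E : Type*} [NormedAddCommGroup E] [InnerProductSpace ℝ E]

/-- The unit vector in the direction of `v` (and `0` if `v = 0`). -/
noncomputable def dir (v : E) : E := ‖v‖⁻¹ • v

lemma norm_dir {v : E} (hv : v ≠ 0) : ‖dir v‖ = 1 := by
  simp [dir, norm_smul, hv]

lemma norm_dir_le (v : E) : ‖dir v‖ ≤ 1 := by
  rcases eq_or_ne v 0 with rfl | h
  · simp [dir]
  · exact (norm_dir h).le

lemma norm_dir_sub_le {v : E} (hv : v ≠ 0) (w : E) : ‖dir v - dir w‖ ≤ 2 * ‖v‖⁻¹ * ‖v - w‖ := by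
  have h0 : 0 < ‖v‖ := norm_pos_iff.2 hv
  have h : ‖v‖ • (dir v - dir w) = (v - w) + (‖w‖ - ‖v‖) • dir w := by
    rcases eq_or_ne w 0 with rfl | hw
    · simp [dir, smul_smul, h0.ne']
    · have : ‖w‖ ≠ 0 := norm_ne_zero_iff.2 hw
      simp only [dir, smul_sub, smul_smul, sub_mul, sub_smul, mul_inv_cancel₀ h0.ne',
        mul_inv_cancel₀ this, one_smul]
      abel
  have h2 : ‖v‖ * ‖dir v - dir w‖ ≤ 2 * ‖v - w‖ := by
    calc ‖v‖ * ‖dir v - dir w‖ = ‖‖v‖ • (dir v - dir w)‖ := by rw [norm_smul, norm_norm]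
      _ ≤ ‖v - w‖ + ‖(‖w‖ - ‖v‖) • dir w‖ := by rw [h]; exact norm_add_le _ _
      _ ≤ ‖v - w‖ + ‖v - w‖ * 1 := by
        rw [norm_smul]
        gcongr
        · rw [norm_sub_rev v w]; exact abs_norm_sub_norm_le w v
        · exact norm_dir_le w
      _ = _ := by ring
  calc ‖dir v - dir w‖ = ‖v‖⁻¹ * (‖v‖ * ‖dir v - dir w‖) := by field_simp
    _ ≤ ‖v‖⁻¹ * (2 * ‖v - w‖) := by gcongr
    _ = _ := by ring

lemma dir_map (R : E ≃ₗᵢ[ℝ] E) (v : E) : dir (R v) = R (dir v) := by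
  simp [dir]

lemma measurable_dir [MeasurableSpace E] [BorelSpace E] [SecondCountableTopology E] :
    Measurable (dir : E → E) :=
  measurable_norm.inv.smul measurable_id

/-- The vector `v / (|v|² + s²)`, a regularization at scale `s` of the inversion `v / |v|²`. -/
noncomputable def regInv (s : ℝ) (v : E) : E := (‖v‖ ^ 2 + s ^ 2)⁻¹ • v

lemma norm_regInv_le {s : ℝ} (hs : 0 < s) (v : E) : ‖regInv s v‖ ≤ s⁻¹ := by
  rw [regInv, norm_smul, norm_inv, Real.norm_of_nonneg (by positivity), inv_mul_eq_div,
    div_le_iff₀ (by positivity), inv_mul_eq_div, le_div_iff₀ hs]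
  nlinarith [sq_nonneg (‖v‖ - s), norm_nonneg v]

lemma norm_regInv_sub_le {s : ℝ} (hs : 0 < s) (v w : E) :
    ‖regInv s v - regInv s w‖ ≤ 3 * (s⁻¹) ^ 2 * ‖v - w‖ := by
  set A := ‖v‖ ^ 2 + s ^ 2 with hA
  set B := ‖w‖ ^ 2 + s ^ 2 with hB
  have hA0 : 0 < A := by positivity
  have hB0 : 0 < B := by positivity
  have hAs : s ^ 2 ≤ A := by rw [hA]; nlinarith [sq_nonneg ‖v‖]
  have hBs : s ^ 2 ≤ B := by rw [hB]; nlinarith [sq_nonneg ‖w‖]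
  have e : regInv s v - regInv s w = A⁻¹ • (v - w) + ((B - A) / (A * B)) • w := by
    rw [regInv, regInv, ← hA, ← hB, smul_sub, sub_add, ← sub_smul]
    congr 2
    field_simp
    ring
  have hd : |B - A| ≤ ‖v - w‖ * (‖v‖ + ‖w‖) := by
    have : B - A = (‖w‖ - ‖v‖) * (‖v‖ + ‖w‖) := by rw [hA, hB]; ring
    rw [this, abs_mul, abs_of_nonneg (by positivity : 0 ≤ ‖v‖ + ‖w‖)]
    gcongr
    rw [norm_sub_rev v w]; exact abs_norm_sub_norm_le w v
  have hvw : (‖v‖ + ‖w‖) * ‖w‖ * s ^ 2 ≤ 2 * (A * B) := by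
    have h1 : ‖v‖ * ‖w‖ * s ^ 2 ≤ A * B := by
      rw [hA, hB]
      nlinarith [sq_nonneg (‖v‖ - ‖w‖), sq_nonneg (‖v‖ * ‖w‖), sq_nonneg (s ^ 2),
        mul_nonneg (sq_nonneg (‖v‖ - ‖w‖)) (sq_nonneg s), mul_nonneg (sq_nonneg ‖v‖) (sq_nonneg s),
        mul_nonneg (sq_nonneg ‖w‖) (sq_nonneg s)]
    have h2 : ‖w‖ * ‖w‖ * s ^ 2 ≤ A * B := by
      have : ‖w‖ * ‖w‖ ≤ B := by rw [hB]; nlinarith [sq_nonneg s]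
      nlinarith
    linarith
  have h2 : ‖((B - A) / (A * B)) • w‖ ≤ 2 * (s⁻¹) ^ 2 * ‖v - w‖ := by
    rw [norm_smul, norm_div, Real.norm_eq_abs, Real.norm_of_nonneg (by positivity : 0 ≤ A * B),
      div_mul_eq_mul_div, div_le_iff₀ (by positivity)]
    calc |B - A| * ‖w‖ ≤ ‖v - w‖ * (‖v‖ + ‖w‖) * ‖w‖ := by gcongr
      _ = ‖v - w‖ * (s⁻¹) ^ 2 * ((‖v‖ + ‖w‖) * ‖w‖ * s ^ 2) := by field_simp
      _ ≤ ‖v - w‖ * (s⁻¹) ^ 2 * (2 * (A * B)) := by gcongr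
      _ = _ := by ring
  have h1 : ‖A⁻¹ • (v - w)‖ ≤ (s⁻¹) ^ 2 * ‖v - w‖ := by
    rw [norm_smul, norm_inv, Real.norm_of_nonneg hA0.le, inv_pow]
    gcongr
  rw [e]
  calc _ ≤ _ := norm_add_le _ _
    _ ≤ _ := add_le_add h1 h2
    _ = _ := by ring

lemma regInv_map (R : E ≃ₗᵢ[ℝ] E) (s : ℝ) (v : E) : regInv s (R v) = R (regInv s v) := by
  simp [regInv]

end Direction

/-! ### Integration by parts along a measure-preserving flow -/

/-- Integration by parts: `φ` is a flow of measure-preserving maps, `ψ'` the derivative of `ψ`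
along it. Only a Lipschitz bound in `L¹` along the flow is required of the weight `A`. -/
lemma abs_integral_mul_le_of_flow {Ω : Type*} [MeasurableSpace Ω] {m : Measure Ω}
    {φ : ℝ → Ω → Ω} (hφ : ∀ t, MeasurePreserving (φ t) m m)
    (hinv : ∀ t z, φ t (φ (-t) z) = z)
    {ψ ψ' A : Ω → ℝ} {L C₁ C₂ : ℝ} (hL : 0 ≤ L) (hψm : Measurable ψ) (hψ : ∀ z, |ψ z| ≤ L)
    (hlip : ∀ t z, |ψ (φ t z) - ψ z| ≤ C₁ * |t|)
    (hder : ∀ z, HasDerivAt (fun t => ψ (φ t z)) (ψ' z) 0) (hφ0 : ∀ z, φ 0 z = z)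
    (hA : Integrable A m) (hAlip : ∀ t, ∫ z, |A (φ t z) - A z| ∂m ≤ C₂ * |t|) :
    |∫ z, ψ' z * A z ∂m| ≤ L * C₂ := by
  have hbdd : ∀ {B : Ω → ℝ}, Integrable B m → Integrable (fun z => ψ z * B z) m := fun hB =>
    hB.bdd_mul hψm.aestronglyMeasurable (Filter.Eventually.of_forall hψ)
  have key : ∀ t : ℝ, t ≠ 0 → |∫ z, (t⁻¹ * (ψ (φ t z) - ψ z)) * A z ∂m| ≤ L * C₂ := by
    intro t ht
    have hAt : Integrable (fun z => A (φ (-t) z)) m :=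
      (hφ (-t)).integrable_comp_of_integrable hA
    have hI : Integrable (fun z => ψ (φ t z) * A z) m :=
      hA.bdd_mul (hψm.comp (hφ t).measurable).aestronglyMeasurable
        (Filter.Eventually.of_forall fun z => hψ _)
    have e1 : ∫ z, ψ (φ t z) * A z ∂m = ∫ z, ψ z * A (φ (-t) z) ∂m := by
      have : (fun z => ψ (φ t z) * A z) = fun z => (fun z => ψ z * A (φ (-t) z)) (φ t z) := by
        funext z
        have := hinv (-t) z
        rw [neg_neg] at this
        simp only [this]
      rw [this, ← integral_map (f := fun z => ψ z * A (φ (-t) z)) (hφ t).measurable.aemeasurable,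
        (hφ t).map_eq]
      rw [(hφ t).map_eq]
      exact (hbdd hAt).aestronglyMeasurable
    have e2 : ∫ z, (t⁻¹ * (ψ (φ t z) - ψ z)) * A z ∂m
        = t⁻¹ * ∫ z, ψ z * (A (φ (-t) z) - A z) ∂m := by
      have : (fun z => (t⁻¹ * (ψ (φ t z) - ψ z)) * A z)
          = fun z => t⁻¹ * (ψ (φ t z) * A z - ψ z * A z) := by funext z; ring
      rw [this, integral_const_mul, integral_sub hI (hbdd hA), e1, ← integral_sub (hbdd hAt) (hbdd hA)]
      simp only [mul_sub]
    rw [e2, abs_mul, abs_inv, inv_mul_le_iff₀ (abs_pos.2 ht)]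
    calc |∫ z, ψ z * (A (φ (-t) z) - A z) ∂m| ≤ ∫ z, L * |A (φ (-t) z) - A z| ∂m := by
          rw [← Real.norm_eq_abs]
          refine norm_integral_le_of_norm_le ((hAt.sub hA).abs.const_mul L)
            (Filter.Eventually.of_forall fun z => ?_)
          rw [Real.norm_eq_abs, abs_mul]
          exact mul_le_mul_of_nonneg_right (hψ z) (abs_nonneg _)
      _ ≤ L * (C₂ * |-t|) := by rw [integral_const_mul]; gcongr; exact hAlip (-t)
      _ = _ := by rw [abs_neg]; ring
  have hlim : Filter.Tendsto (fun n : ℕ => ∫ z, ((((n : ℝ) + 1)⁻¹)⁻¹ *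
      (ψ (φ (((n : ℝ) + 1)⁻¹) z) - ψ z)) * A z ∂m) Filter.atTop (nhds (∫ z, ψ' z * A z ∂m)) := by
    have hseq : Filter.Tendsto (fun n : ℕ => ((n : ℝ) + 1)⁻¹) Filter.atTop (nhdsWithin 0 {0}ᶜ) := by
      refine tendsto_nhdsWithin_iff.2 ⟨?_, Filter.Eventually.of_forall fun n => ?_⟩
      · simpa [one_div] using tendsto_one_div_add_atTop_nhds_zero_nat (𝕜 := ℝ)
      · have : (0 : ℝ) < ((n : ℝ) + 1)⁻¹ := by positivity
        exact this.ne'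
    refine tendsto_integral_of_dominated_convergence (fun z => C₁ * |A z|) (fun n => ?_)
      (hA.abs.const_mul C₁) (fun n => Filter.Eventually.of_forall fun z => ?_)
      (Filter.Eventually.of_forall fun z => ?_)
    · exact ((((hψm.comp (hφ _).measurable).sub hψm).const_mul _).aestronglyMeasurable).mul
        hA.aestronglyMeasurable
    · have hp : (0 : ℝ) < ((n : ℝ) + 1)⁻¹ := by positivity
      rw [Real.norm_eq_abs, abs_mul, abs_mul]
      gcongr
      rw [abs_inv, inv_mul_le_iff₀ (abs_pos.2 hp.ne'), mul_comm]
      exact hlip _ _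
    · have h := (hasDerivAt_iff_tendsto_slope_zero.1 (hder z)).comp hseq
      simp only [zero_add, hφ0, smul_eq_mul] at h
      exact h.mul_const (A z)
  exact le_of_tendsto hlim.abs (Filter.Eventually.of_forall fun n => key _ (by positivity))

/-! ### The uniform measure on the unit ball -/

section BallMeasure

open scoped InnerProductSpace ENNReal

/-- The uniform probability measure on the unit ball of `ℝ^d`. -/
noncomputable def ballMeasure (d : ℕ) : Measure (Euc d) :=
  ProbabilityTheory.cond volume (Metric.closedBall (0 : Euc d) 1)

variable {d : ℕ}

lemma volume_closedBall_ne_zero : volume (Metric.closedBall (0 : Euc d) 1) ≠ 0 :=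
  (Metric.measure_closedBall_pos _ _ one_pos).ne'

lemma volume_closedBall_ne_top : volume (Metric.closedBall (0 : Euc d) 1) ≠ ⊤ :=
  (isCompact_closedBall _ _).measure_lt_top.ne

instance : IsProbabilityMeasure (ballMeasure d) :=
  ProbabilityTheory.cond_isProbabilityMeasure_of_finite volume_closedBall_ne_zero
    volume_closedBall_ne_top

lemma ae_norm_le_one : ∀ᵐ g ∂(ballMeasure d), ‖g‖ ≤ 1 := by
  have : ∀ᵐ g ∂(ballMeasure d), g ∈ Metric.closedBall (0 : Euc d) 1 :=
    ProbabilityTheory.ae_cond_mem Metric.isClosed_closedBall.measurableSet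
  filter_upwards [this] with g hg
  simpa using hg

lemma measurePreserving_ballMeasure (R : Euc d ≃ₗᵢ[ℝ] Euc d) :
    MeasurePreserving R (ballMeasure d) (ballMeasure d) := by
  have h := (R.measurePreserving).restrict_preimage
    (Metric.isClosed_closedBall (x := (0 : Euc d)) (ε := 1)).measurableSet
  have hp : R ⁻¹' Metric.closedBall (0 : Euc d) 1 = Metric.closedBall (0 : Euc d) 1 := by
    ext z; simp
  rw [hp] at h
  exact h.smul_measure _

lemma lintegral_prod_eval_eq_prod {d : ℕ} {k : Fin d → ℝ → ℝ≥0∞} (hk : ∀ i, Measurable (k i)) :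
    ∫⁻ z : Fin d → ℝ, ∏ i, k i (z i) = ∏ i, ∫⁻ t, k i t := by
  induction d with
  | zero => simp [volume_pi]
  | succ d ih =>
    rw [← (volume_preserving_piFinSuccAbove (fun _ : Fin (d + 1) => ℝ) 0).symm.lintegral_comp
      (f := fun z : Fin (d + 1) → ℝ => ∏ i, k i (z i))
      (Finset.measurable_prod _ fun i _ => (hk i).comp (measurable_pi_apply i))]
    simp only [Fin.prod_univ_succ, MeasurableEquiv.piFinSuccAbove_symm_apply, Fin.insertNthEquiv,
      Equiv.coe_fn_mk, Fin.insertNth_zero, Fin.cons_zero, Fin.cons_succ, cast_eq]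
    rw [Measure.volume_eq_prod, lintegral_prod_mul (f := k 0)
      (g := fun z : Fin d → ℝ => ∏ i, k i.succ (z i)) (hk 0).aemeasurable
      (Finset.measurable_prod _ fun i _ => (hk _).comp (measurable_pi_apply i)).aemeasurable,
      ih fun i => hk i.succ]

/-- An upper bound for integrals of products of functions of orthogonal coordinates over the
unit ball, by comparison with the circumscribed cube. -/
lemma lintegral_ballMeasure_prod_le (b : OrthonormalBasis (Fin d) ℝ (Euc d))
    {h : Fin d → ℝ → ℝ≥0∞} (hm : ∀ i, Measurable (h i)) :
    ∫⁻ g, ∏ i, h i ⟪b i, g⟫_ℝ ∂(ballMeasure d)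
      ≤ (volume (Metric.closedBall (0 : Euc d) 1))⁻¹ * ∏ i, ∫⁻ t in Set.Icc (-1 : ℝ) 1, h i t := by
  rw [ballMeasure, ProbabilityTheory.cond, lintegral_smul_measure, smul_eq_mul]
  gcongr
  set k : Fin d → ℝ → ℝ≥0∞ := fun i => (Set.Icc (-1 : ℝ) 1).indicator (h i) with hk
  have hkm : ∀ i, Measurable (k i) := fun i => (hm i).indicator measurableSet_Icc
  have e1 : ∫⁻ g, ∏ i, k i ⟪b i, g⟫_ℝ = ∫⁻ z : Fin d → ℝ, ∏ i, k i (z i) := by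
    have hmp := (EuclideanSpace.volume_preserving_symm_measurableEquiv_toLp (Fin d)).comp
      b.measurePreserving_repr
    rw [← hmp.lintegral_comp (f := fun z : Fin d → ℝ => ∏ i, k i (z i))
      (Finset.measurable_prod _ fun i _ => (hkm i).comp (measurable_pi_apply i))]
    refine lintegral_congr fun g => ?_
    simp [OrthonormalBasis.repr_apply_apply]
  have e2 : ∫⁻ z : Fin d → ℝ, ∏ i, k i (z i) = ∏ i, ∫⁻ t, k i t := by
    exact lintegral_prod_eval_eq_prod hkm
  calc ∫⁻ g in Metric.closedBall (0 : Euc d) 1, ∏ i, h i ⟪b i, g⟫_ℝ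
      = ∫⁻ g in Metric.closedBall (0 : Euc d) 1, ∏ i, k i ⟪b i, g⟫_ℝ := by
        refine setLIntegral_congr_fun Metric.isClosed_closedBall.measurableSet fun g hg => ?_
        refine Finset.prod_congr rfl fun i _ => ?_
        have : |⟪b i, g⟫_ℝ| ≤ 1 := by
          have := abs_real_inner_le_norm (b i) g
          rw [b.norm_eq_one i, one_mul] at this
          exact this.trans (by simpa using hg)
        simp only [hk]
        rw [Set.indicator_of_mem (Set.mem_Icc.2 (abs_le.1 this))]
    _ ≤ ∫⁻ g, ∏ i, k i ⟪b i, g⟫_ℝ := setLIntegral_le_lintegral _ _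
    _ = ∏ i, ∫⁻ t, k i t := by rw [e1, e2]
    _ = _ := by simp only [hk, lintegral_indicator measurableSet_Icc]

lemma exists_orthonormalBasis_of_pair {e e' : Euc d} (he : ‖e‖ = 1) (he' : ‖e'‖ = 1)
    (h : ⟪e, e'⟫_ℝ = 0) :
    ∃ (b : OrthonormalBasis (Fin d) ℝ (Euc d)) (i j : Fin d), i ≠ j ∧ b i = e ∧ b j = e' := by
  have ho : Orthonormal ℝ ![e, e'] := by
    refine ⟨fun i => by fin_cases i <;> simp [he, he'], fun i j hij => ?_⟩
    fin_cases i <;> fin_cases j <;> simp_all [real_inner_comm]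
  have hd : 2 ≤ d := by
    have := ho.linearIndependent.fintype_card_le_finrank
    simpa using this
  set i : Fin d := ⟨0, by omega⟩
  set j : Fin d := ⟨1, by omega⟩
  have hij : i ≠ j := by simp [i, j]
  set v : Fin d → Euc d := fun l => if l = i then e else e' with hv
  have hvi : v i = e := by simp [hv]
  have hvj : v j = e' := by simp [hv, hij.symm]
  have hos : Orthonormal ℝ (({i, j} : Set (Fin d)).domRestrict v) := by
    refine ⟨fun ⟨l, hl⟩ => ?_, fun ⟨l, hl⟩ ⟨l', hl'⟩ hne => ?_⟩
    · change ‖v l‖ = 1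
      rcases hl with h | h <;> simp [show l = _ from h, hvi, hvj, he, he']
    · change ⟪v l, v l'⟫_ℝ = 0
      have hne' : l ≠ l' := fun h => hne (Subtype.ext h)
      rcases hl with h1 | h1 <;> rcases hl' with h2 | h2 <;>
        rw [show l = _ from h1, show l' = _ from h2] at hne' ⊢
      · exact absurd rfl hne'
      · rwa [hvi, hvj]
      · rwa [hvi, hvj, real_inner_comm]
      · exact absurd rfl hne'
  obtain ⟨b, hb⟩ := hos.exists_orthonormalBasis_extension_of_card_eq (by simp)
  exact ⟨b, i, j, hij, (hb i (by simp)).trans hvi, (hb j (by simp)).trans hvj⟩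

lemma exists_orthonormalBasis_of_unit {e : Euc d} (he : ‖e‖ = 1) :
    ∃ (b : OrthonormalBasis (Fin d) ℝ (Euc d)) (i : Fin d), b i = e := by
  have hd : 0 < d := by
    rcases Nat.eq_zero_or_pos d with rfl | h
    · rw [Subsingleton.elim e 0, norm_zero] at he
      exact absurd he zero_ne_one
    · exact h
  have hos : Orthonormal ℝ (({⟨0, hd⟩} : Set (Fin d)).domRestrict fun _ => e) := by
    refine ⟨fun _ => he, fun ⟨l, hl⟩ ⟨l', hl'⟩ hne => ?_⟩
    exact absurd (Subtype.ext ((show l = _ from hl).trans (show l' = _ from hl').symm)) hne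
  obtain ⟨b, hb⟩ := hos.exists_orthonormalBasis_extension_of_card_eq (by simp)
  exact ⟨b, _, hb _ rfl⟩

/-- The constant comparing the uniform measure on the unit ball to Lebesgue measure on the
circumscribed cube. -/
noncomputable def ballConst (d : ℕ) : ℝ≥0∞ :=
  (volume (Metric.closedBall (0 : Euc d) 1))⁻¹ * 2 ^ d

lemma ballConst_ne_top : ballConst d ≠ ⊤ :=
  ENNReal.mul_ne_top (ENNReal.inv_ne_top.2 volume_closedBall_ne_zero) (by simp)

lemma lintegral_ballMeasure_coord_le {e : Euc d} (he : ‖e‖ = 1) {h : ℝ → ℝ≥0∞}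
    (hm : Measurable h) :
    ∫⁻ g, h ⟪e, g⟫_ℝ ∂(ballMeasure d) ≤ ballConst d * ∫⁻ t in Set.Icc (-1 : ℝ) 1, h t := by
  obtain ⟨b, i, hi⟩ := exists_orthonormalBasis_of_unit he
  have hk := lintegral_ballMeasure_prod_le b (h := fun l => if l = i then h else fun _ => 1)
    (fun l => by split_ifs; exacts [hm, measurable_const])
  have e1 : ∀ g : Euc d, ∏ l, (if l = i then h else fun _ => 1) ⟪b l, g⟫_ℝ = h ⟪e, g⟫_ℝ := by
    intro g
    rw [Finset.prod_eq_single i (fun l _ hl => by simp [hl]) (by simp)]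
    simp [hi]
  simp only [e1] at hk
  refine hk.trans ?_
  rw [ballConst, mul_assoc]
  gcongr
  have e2 : ∀ l, ∫⁻ t in Set.Icc (-1 : ℝ) 1, (if l = i then h else fun _ => 1) t
      ≤ 2 * (if l = i then ∫⁻ t in Set.Icc (-1 : ℝ) 1, h t else 1) := by
    intro l
    split_ifs
    · exact le_mul_of_one_le_left' (by norm_num)
    · simp; norm_num
  calc _ ≤ ∏ l, (2 * (if l = i then ∫⁻ t in Set.Icc (-1 : ℝ) 1, h t else 1)) :=
        Finset.prod_le_prod' fun l _ => e2 l
    _ = _ := by rw [Finset.prod_mul_distrib]; simp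

lemma lintegral_ballMeasure_coord_mul_le {e e' : Euc d} (he : ‖e‖ = 1) (he' : ‖e'‖ = 1)
    (hee : ⟪e, e'⟫_ℝ = 0) {h : ℝ → ℝ≥0∞} (hm : Measurable h) :
    ∫⁻ g, h ⟪e, g⟫_ℝ * h ⟪e', g⟫_ℝ ∂(ballMeasure d)
      ≤ ballConst d * (∫⁻ t in Set.Icc (-1 : ℝ) 1, h t) ^ 2 := by
  obtain ⟨b, i, j, hij, hi, hj⟩ := exists_orthonormalBasis_of_pair he he' hee
  have hk := lintegral_ballMeasure_prod_le b
    (h := fun l => if l = i ∨ l = j then h else fun _ => 1)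
    (fun l => by split_ifs; exacts [hm, measurable_const])
  have e1 : ∀ g : Euc d, ∏ l, (if l = i ∨ l = j then h else fun _ => 1) ⟪b l, g⟫_ℝ
      = h ⟪e, g⟫_ℝ * h ⟪e', g⟫_ℝ := by
    intro g
    rw [Finset.prod_eq_mul i j hij (fun l _ hl => by simp [hl.1, hl.2]) (by simp) (by simp)]
    simp [hi, hj]
  simp only [e1] at hk
  refine hk.trans ?_
  rw [ballConst, mul_assoc]
  gcongr
  set I := ∫⁻ t in Set.Icc (-1 : ℝ) 1, h t
  have e2 : ∀ l, ∫⁻ t in Set.Icc (-1 : ℝ) 1, (if l = i ∨ l = j then h else fun _ => 1) t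
      ≤ 2 * (if l = i ∨ l = j then I else 1) := by
    intro l
    split_ifs
    · exact le_mul_of_one_le_left' (by norm_num)
    · simp; norm_num
  calc _ ≤ ∏ l, (2 * (if l = i ∨ l = j then I else 1)) :=
        Finset.prod_le_prod' fun l _ => e2 l
    _ = _ := by
      rw [Finset.prod_mul_distrib, Finset.prod_eq_mul (f := fun l => if l = i ∨ l = j then I else 1)
        i j hij (fun l _ hl => by simp [hl.1, hl.2]) (by simp) (by simp)]
      simp [sq]

lemma lintegral_rpow_neg_half_lt_top :
    ∫⁻ t in Set.Icc (-1 : ℝ) 1, ‖t‖ₑ ^ (-(1 / 2) : ℝ) < ⊤ := by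
  have h1 : ∫⁻ t in Set.Ioc (0 : ℝ) 1, ‖t‖ₑ ^ (-(1 / 2) : ℝ) < ⊤ := by
    have hi : IntegrableOn (fun t : ℝ => t ^ (-(1 / 2) : ℝ)) (Set.Ioc 0 1) :=
      (intervalIntegrable_iff_integrableOn_Ioc_of_le zero_le_one).1
        (intervalIntegral.intervalIntegrable_rpow' (by norm_num))
    refine lt_of_eq_of_lt (setLIntegral_congr_fun measurableSet_Ioc fun t ht => ?_) hi.2
    change _ = ‖t ^ (-(1 / 2) : ℝ)‖ₑ
    rw [Real.enorm_of_nonneg ht.1.le, Real.enorm_of_nonneg (Real.rpow_nonneg ht.1.le _),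
      ENNReal.ofReal_rpow_of_pos ht.1]
  have h2 : ∫⁻ t in Set.Ico (-1 : ℝ) 0, ‖t‖ₑ ^ (-(1 / 2) : ℝ) < ⊤ := by
    have := (Measure.measurePreserving_neg (volume : Measure ℝ)).setLIntegral_comp_preimage
      (measurableSet_Ioc (a := (0 : ℝ)) (b := 1)) (f := fun t : ℝ => ‖t‖ₑ ^ (-(1 / 2) : ℝ))
      (measurable_enorm.pow_const _)
    simp only [Set.neg_preimage, Set.neg_Ioc, neg_zero, enorm_neg] at this
    rwa [this]
  calc _ ≤ ∫⁻ t in Set.Ico (-1 : ℝ) 0 ∪ ({0} ∪ Set.Ioc (0 : ℝ) 1), ‖t‖ₑ ^ (-(1 / 2) : ℝ) := by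
        refine lintegral_mono_set fun t ht => ?_
        rcases lt_trichotomy t 0 with h | h | h
        · exact Or.inl ⟨ht.1, h⟩
        · exact Or.inr (Or.inl h)
        · exact Or.inr (Or.inr ⟨h, ht.2⟩)
    _ ≤ _ := lintegral_union_le _ _ _
    _ ≤ _ := add_le_add_right (lintegral_union_le _ _ _) _
    _ < ⊤ := ENNReal.add_lt_top.2 ⟨h2, ENNReal.add_lt_top.2 ⟨by simp, h1⟩⟩

/-- The Cauchy-type kernel at scale `s` has mass `O(s)` for the law of one coordinate. -/
lemma lintegral_ballMeasure_cauchy_le {e : Euc d} (he : ‖e‖ = 1) {s : ℝ} (hs : 0 < s) :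
    ∫⁻ g, ENNReal.ofReal (s ^ 2 / (⟪e, g⟫_ℝ ^ 2 + s ^ 2)) ∂(ballMeasure d)
      ≤ ballConst d * ENNReal.ofReal (s * Real.pi) := by
  refine (lintegral_ballMeasure_coord_le he
    (h := fun t => ENNReal.ofReal (s ^ 2 / (t ^ 2 + s ^ 2))) (by fun_prop)).trans ?_
  gcongr
  refine (setLIntegral_le_lintegral _ _).trans (le_of_eq ?_)
  have e1 : ∀ t : ℝ, s ^ 2 / (t ^ 2 + s ^ 2) = (1 + (t / s) ^ 2)⁻¹ := by
    intro t; field_simp; ring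
  simp only [e1]
  rw [← ofReal_integral_eq_lintegral_ofReal
    (integrable_inv_one_add_sq.comp_div hs.ne') (Filter.Eventually.of_forall fun t => by positivity),
    Measure.integral_comp_div (fun t => (1 + t ^ 2)⁻¹) s, integral_univ_inv_one_add_sq,
    abs_of_pos hs, smul_eq_mul]

/-- The constant bounding the mean of `1 / |P g|` for projections `P` of rank at least two. -/
noncomputable def projConst (d : ℕ) : ℝ≥0∞ :=
  ballConst d * (∫⁻ t in Set.Icc (-1 : ℝ) 1, ‖t‖ₑ ^ (-(1 / 2) : ℝ)) ^ 2

lemma projConst_ne_top : projConst d ≠ ⊤ :=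
  ENNReal.mul_ne_top ballConst_ne_top (ENNReal.pow_ne_top lintegral_rpow_neg_half_lt_top.ne)

/-- The mean of `1 / |T g|` is finite as soon as `T g` determines two orthogonal coordinates of
`g`; this uses `a² + b² ≥ |a| |b|` to reduce to two one-dimensional integrals. -/
lemma lintegral_inv_norm_le {T : Euc d → Euc d} {e e' : Euc d} (he : ‖e‖ = 1) (he' : ‖e'‖ = 1)
    (hee : ⟪e, e'⟫_ℝ = 0) (hT : ∀ g, ⟪e, T g⟫_ℝ = ⟪e, g⟫_ℝ) (hT' : ∀ g, ⟪e', T g⟫_ℝ = ⟪e', g⟫_ℝ) :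
    ∫⁻ g, ‖T g‖ₑ⁻¹ ∂(ballMeasure d) ≤ projConst d := by
  refine le_trans (lintegral_mono fun g => ?_) (lintegral_ballMeasure_coord_mul_le he he' hee
    (h := fun t => ‖t‖ₑ ^ (-(1 / 2) : ℝ)) (measurable_enorm.pow_const _))
  have h1 : ‖⟪e, g⟫_ℝ‖ₑ ≤ ‖T g‖ₑ := by
    rw [← hT, ← ofReal_norm, ← ofReal_norm]
    refine ENNReal.ofReal_le_ofReal ?_
    simpa [he] using abs_real_inner_le_norm e (T g)
  have h2 : ‖⟪e', g⟫_ℝ‖ₑ ≤ ‖T g‖ₑ := by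
    rw [← hT', ← ofReal_norm, ← ofReal_norm]
    refine ENNReal.ofReal_le_ofReal ?_
    simpa [he'] using abs_real_inner_le_norm e' (T g)
  have h3 : ∀ x : ℝ≥0∞, x ≤ ‖T g‖ₑ → ‖T g‖ₑ ^ (-(1 / 2) : ℝ) ≤ x ^ (-(1 / 2) : ℝ) := fun x hx => by
    rw [ENNReal.rpow_neg, ENNReal.rpow_neg]
    exact ENNReal.inv_le_inv.2 (ENNReal.rpow_le_rpow hx (by norm_num))
  calc ‖T g‖ₑ⁻¹ = ‖T g‖ₑ ^ (-(1 / 2) : ℝ) * ‖T g‖ₑ ^ (-(1 / 2) : ℝ) := by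
        rw [ENNReal.rpow_neg, ← ENNReal.mul_inv (Or.inr (by simp)) (Or.inl (by simp)),
          ← ENNReal.rpow_add_of_nonneg _ _ (by norm_num) (by norm_num)]
        norm_num
    _ ≤ _ := mul_le_mul' (h3 _ h1) (h3 _ h2)

end BallMeasure

/-! ### Uniqueness of uniformly distributed measures -/

/-- Two probability measures on a compact set, each giving equal mass to all balls of equal radius
centred on the set, coincide: averages of a continuous function over small balls are close to the
function, and integrating them against the other measure exchanges the two measures. -/
lemma measure_eq_of_uniformly_distributed {E : Type*} [MetricSpace E] [SecondCountableTopology E]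
    [MeasurableSpace E] [BorelSpace E] {μ ν : Measure E} [IsProbabilityMeasure μ]
    [IsProbabilityMeasure ν] {S : Set E} (hS : IsCompact S) (hμS : ∀ᵐ x ∂μ, x ∈ S)
    (hνS : ∀ᵐ x ∂ν, x ∈ S)
    (hμ : ∀ r : ℝ, ∀ x ∈ S, ∀ y ∈ S, μ.real (Metric.ball x r) = μ.real (Metric.ball y r))
    (hν : ∀ r : ℝ, ∀ x ∈ S, ∀ y ∈ S, ν.real (Metric.ball x r) = ν.real (Metric.ball y r)) :
    μ = ν := by
  have hνS0 : ν S ≠ 0 := by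
    have : ν S = 1 := prob_compl_eq_zero_iff hS.measurableSet |>.1 hνS
    simp [this]
  obtain ⟨x₀, hx₀, hpos⟩ := exists_mem_forall_mem_nhdsWithin_pos_measure hνS0
  -- integrals of the truncated kernel `1_{dist x y < r} f y`
  have hker : ∀ (r : ℝ) (f : BoundedContinuousFunction E ℝ) (ξ ζ : Measure E)
      [IsProbabilityMeasure ξ] [IsProbabilityMeasure ζ],
      (∀ᵐ x ∂ξ, x ∈ S) → (∀ᵐ x ∂ζ, x ∈ S) →
      (∀ x ∈ S, ∀ y ∈ S, ξ.real (Metric.ball x r) = ξ.real (Metric.ball y r)) →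
      ∫ x, ∫ y in Metric.ball x r, f y ∂ζ ∂ξ = ξ.real (Metric.ball x₀ r) * ∫ y, f y ∂ζ := by
    intro r f ξ ζ _ _ _ hζ hξ
    have hm : MeasurableSet {p : E × E | dist p.2 p.1 < r} :=
      (isOpen_lt (continuous_snd.dist continuous_fst) continuous_const).measurableSet
    have hI : Integrable (Function.uncurry fun x y => (Metric.ball x r).indicator f y)
        (ξ.prod ζ) := by
      have h1 : Integrable ({p : E × E | dist p.2 p.1 < r}.indicator fun p => f p.2)
          (ξ.prod ζ) := by
        refine Integrable.indicator ?_ hm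
        exact (BoundedContinuousFunction.integrable ζ f).comp_snd ξ
      exact h1
    calc ∫ x, ∫ y in Metric.ball x r, f y ∂ζ ∂ξ
        = ∫ x, ∫ y, (Metric.ball x r).indicator f y ∂ζ ∂ξ := by
          simp only [integral_indicator Metric.isOpen_ball.measurableSet]
      _ = ∫ y, ∫ x, (Metric.ball x r).indicator f y ∂ξ ∂ζ := integral_integral_swap hI
      _ = ∫ y, ξ.real (Metric.ball x₀ r) * f y ∂ζ := by
          refine integral_congr_ae ?_
          filter_upwards [hζ] with y hy
          have : ∀ x, (Metric.ball x r).indicator f y = (Metric.ball y r).indicator (fun _ => f y) x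
              := by
            intro x
            simp only [Set.indicator, Metric.mem_ball, dist_comm]
          simp only [this]
          rw [integral_indicator Metric.isOpen_ball.measurableSet, setIntegral_const, smul_eq_mul,
            hξ y hy x₀ hx₀]
      _ = _ := integral_const_mul _ _
  refine ext_of_forall_integral_eq_of_IsFiniteMeasure fun f => ?_
  by_contra hne
  set δ := |∫ x, f x ∂μ - ∫ x, f x ∂ν| with hδ
  have hδ0 : 0 < δ := abs_pos.2 (sub_ne_zero.2 hne)
  have huc := hS.uniformContinuousOn_of_continuous f.continuous.continuousOn
  obtain ⟨r, hr, hfr⟩ := Metric.uniformContinuousOn_iff.1 huc (δ / 2) (by positivity)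
  have hb0 : 0 < ν.real (Metric.ball x₀ r) := by
    refine ENNReal.toReal_pos (hpos _ ?_).ne' (measure_ne_top _ _)
    exact mem_nhdsWithin_of_mem_nhds (Metric.ball_mem_nhds _ hr)
  set b := ν.real (Metric.ball x₀ r) with hb
  have hab : μ.real (Metric.ball x₀ r) = b := by
    have h1 := hker r (BoundedContinuousFunction.const E 1) μ ν hμS hνS (hμ r)
    have h2 : ∫ x, ∫ y in Metric.ball x r, (BoundedContinuousFunction.const E (1 : ℝ)) y ∂ν ∂μ
        = b := by
      have : ∀ᵐ x ∂μ, ∫ y in Metric.ball x r, (BoundedContinuousFunction.const E (1 : ℝ)) y ∂ν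
          = b := by
        filter_upwards [hμS] with x hx
        simp [hb, hν r x hx x₀ hx₀]
      rw [integral_congr_ae this]
      simp
    rw [h2] at h1
    simpa using h1.symm
  have h1 := hker r f μ ν hμS hνS (hμ r)
  rw [hab] at h1
  have h2 : |b * ∫ x, f x ∂μ - ∫ x, ∫ y in Metric.ball x r, f y ∂ν ∂μ| ≤ b * (δ / 2) := by
    have hint : Integrable (fun x => ∫ y in Metric.ball x r, f y ∂ν) μ := by
      have hm : MeasurableSet {p : E × E | dist p.2 p.1 < r} :=
        (isOpen_lt (continuous_snd.dist continuous_fst) continuous_const).measurableSet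
      have h1 : Integrable ({p : E × E | dist p.2 p.1 < r}.indicator fun p => f p.2)
          (μ.prod ν) :=
        Integrable.indicator ((BoundedContinuousFunction.integrable ν f).comp_snd μ) hm
      have h2 := h1.integral_prod_left
      refine h2.congr (Filter.Eventually.of_forall fun x => ?_)
      simp only
      rw [← integral_indicator Metric.isOpen_ball.measurableSet]
      rfl
    rw [← integral_const_mul, ← integral_sub ((BoundedContinuousFunction.integrable μ f).const_mul b)
      hint, ← Real.norm_eq_abs]
    have hle : ∀ᵐ x ∂μ, ‖b * f x - ∫ y in Metric.ball x r, f y ∂ν‖ ≤ b * (δ / 2) := by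
      filter_upwards [hμS] with x hx
      have e : b * f x = ∫ y in Metric.ball x r, f x ∂ν := by
        rw [setIntegral_const, hν r x hx x₀ hx₀, smul_eq_mul]
      rw [e, ← integral_sub (integrable_const _) (BoundedContinuousFunction.integrable _ f)]
      have := norm_setIntegral_le_of_norm_le_const_ae' (μ := ν) (s := Metric.ball x r)
        (f := fun y => f x - f y) (C := δ / 2) (measure_lt_top _ _) ?_
      · rw [hν r x hx x₀ hx₀] at this
        rw [mul_comm]; exact this
      · filter_upwards [hνS] with y hy hyx
        have := hfr y hy x hx hyx
        rw [← dist_eq_norm, dist_comm]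
        exact this.le
    have := norm_integral_le_of_norm_le_const hle
    simpa using this
  rw [h1, ← mul_sub, abs_mul, abs_of_pos hb0] at h2
  have := le_of_mul_le_mul_left h2 hb0
  rw [← hδ] at this
  linarith

/-! ### Cubes and their translates -/

section Box

open scoped ENNReal

/-- The closed cube with sides `[a, b]`. -/
def box (d : ℕ) (a b : ℝ) : Set (Euc d) := {x | ∀ i, a ≤ x i ∧ x i ≤ b}

lemma unitCube_eq_box (d : ℕ) : unitCube d = box d 0 1 := rfl

variable {d : ℕ} {a b : ℝ}

lemma isClosed_box : IsClosed (box d a b) := by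
  have : box d a b = ⋂ i, {x : Euc d | a ≤ x i ∧ x i ≤ b} := by
    ext x; simp [box]
  rw [this]
  refine isClosed_iInter fun i => ?_
  have hc : Continuous fun x : Euc d => x i := by fun_prop
  exact (isClosed_le continuous_const hc).inter (isClosed_le hc continuous_const)

lemma measurableSet_box : MeasurableSet (box d a b) := isClosed_box.measurableSet

lemma volume_coordBox (I : Fin d → Set ℝ) :
    volume {x : Euc d | ∀ i, x i ∈ I i} = ∏ i, volume (I i) := by
  have h := (EuclideanSpace.volume_preserving_symm_measurableEquiv_toLp (Fin d)).measure_preimage_equiv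
    (Set.univ.pi I)
  rw [volume_pi_pi] at h
  rw [← h]
  congr 1
  ext x
  simp [Set.mem_pi]

lemma volume_box : volume (box d a b) = ENNReal.ofReal (b - a) ^ d := by
  have := volume_coordBox (d := d) fun _ => Set.Icc a b
  simpa [Real.volume_Icc, box] using this

lemma abs_coord_le_norm (x : Euc d) (i : Fin d) : |x i| ≤ ‖x‖ := by
  simpa using PiLp.norm_apply_le x i

/-- The constant bounding the surface area of a cube. -/
noncomputable def boxConst (d : ℕ) (a b : ℝ) : ℝ≥0∞ := d * (2 * (1 + ENNReal.ofReal (b - a)) ^ d)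

lemma boxConst_ne_top : boxConst d a b ≠ ⊤ := by
  unfold boxConst
  exact ENNReal.mul_ne_top (by simp) (ENNReal.mul_ne_top (by simp) (by simp))

/-- A translation by `h` moves out of the cube only points at distance at most `‖h‖` of a face. -/
lemma volume_box_diff_le (h : Euc d) :
    volume {x | x ∈ box d a b ∧ x + h ∉ box d a b} ≤ boxConst d a b * ‖h‖ₑ := by
  have hsub : {x | x ∈ box d a b ∧ x + h ∉ box d a b} ⊆
      ⋃ i, ({x : Euc d | ∀ l, x l ∈ Function.update (fun _ => Set.Icc a b) i
        (Set.Icc a (a + ‖h‖)) l} ∪ {x : Euc d | ∀ l, x l ∈ Function.update (fun _ => Set.Icc a b) i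
        (Set.Icc (b - ‖h‖) b) l}) := by
    rintro x ⟨hx, hxh⟩
    simp only [box, Set.mem_ofPred_eq, not_forall] at hxh
    obtain ⟨i, hi⟩ := hxh
    have hhi := abs_le.1 (abs_coord_le_norm h i)
    have hxi := hx i
    rw [Set.mem_iUnion]
    refine ⟨i, ?_⟩
    rw [PiLp.add_apply] at hi
    by_cases hlow : a ≤ x i + h i
    · right
      intro l
      rcases eq_or_ne l i with rfl | hl
      · simp only [Function.update_self]
        have : ¬ (x l + h l ≤ b) := fun hc => hi ⟨hlow, hc⟩
        exact ⟨by linarith, hxi.2⟩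
      · simpa [hl] using hx l
    · left
      intro l
      rcases eq_or_ne l i with rfl | hl
      · simp only [Function.update_self]
        exact ⟨hxi.1, by linarith⟩
      · simpa [hl] using hx l
  have hvol : ∀ (i : Fin d) (c c' : ℝ), c' - c = ‖h‖ →
      volume {x : Euc d | ∀ l, x l ∈ Function.update (fun _ => Set.Icc a b) i (Set.Icc c c') l}
        ≤ (1 + ENNReal.ofReal (b - a)) ^ d * ‖h‖ₑ := by
    intro i c c' hc
    rw [volume_coordBox]
    have : ∀ l, volume (Function.update (fun _ => Set.Icc a b) i (Set.Icc c c') l)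
        ≤ (1 + ENNReal.ofReal (b - a)) * (if l = i then ‖h‖ₑ else 1) := by
      intro l
      rcases eq_or_ne l i with rfl | hl
      · simp only [Function.update_self, Real.volume_Icc, hc, if_true, ofReal_norm]
        exact le_mul_of_one_le_left' (by simp)
      · simp [hl, Real.volume_Icc]
    refine (Finset.prod_le_prod' fun l _ => this l).trans (le_of_eq ?_)
    rw [Finset.prod_mul_distrib]
    simp
  refine (measure_mono hsub).trans ((measure_iUnion_le _).trans ?_)
  rw [tsum_fintype]
  have hi : ∀ i : Fin d, volume ({x : Euc d | ∀ l, x l ∈ Function.update (fun _ => Set.Icc a b) i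
        (Set.Icc a (a + ‖h‖)) l} ∪ {x : Euc d | ∀ l, x l ∈ Function.update (fun _ => Set.Icc a b) i
        (Set.Icc (b - ‖h‖) b) l}) ≤ (2 * (1 + ENNReal.ofReal (b - a)) ^ d) * ‖h‖ₑ := by
    intro i
    refine (measure_union_le _ _).trans ?_
    refine (add_le_add (hvol i _ _ (by ring)) (hvol i _ _ (by ring))).trans (le_of_eq ?_)
    ring
  refine (Finset.sum_le_sum fun i _ => hi i).trans (le_of_eq ?_)
  simp [boxConst, mul_assoc]

/-- Indicator functions of cubes are Lipschitz in `L¹` under translations. -/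
lemma lintegral_box_translate_sub_le (h : Euc d) :
    ∫⁻ u, ‖(box d a b).indicator (fun _ => (1 : ℝ)) (u + h)
      - (box d a b).indicator (fun _ => (1 : ℝ)) u‖ₑ ≤ 2 * boxConst d a b * ‖h‖ₑ := by
  set A := {x | x ∈ box d a b ∧ x + h ∉ box d a b} with hA
  set A' := {x | x ∈ box d a b ∧ x + (-h) ∉ box d a b} with hA'
  have hm : ∀ k : Euc d, MeasurableSet {x | x ∈ box d a b ∧ x + k ∉ box d a b} := fun k =>
    measurableSet_box.inter ((measurable_add_const k) measurableSet_box.compl)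
  have hle : ∀ u, ‖(box d a b).indicator (fun _ => (1 : ℝ)) (u + h)
      - (box d a b).indicator (fun _ => (1 : ℝ)) u‖ₑ
      ≤ A.indicator (fun _ => (1 : ℝ≥0∞)) u + A'.indicator (fun _ => (1 : ℝ≥0∞)) (u + h) := by
    intro u
    by_cases h1 : u ∈ box d a b <;> by_cases h2 : u + h ∈ box d a b <;>
      simp [hA, hA', h1, h2]
  refine (lintegral_mono hle).trans ?_
  rw [lintegral_add_left (measurable_const.indicator (hm h)),
    lintegral_add_right_eq_self (fun u => A'.indicator (fun _ => (1 : ℝ≥0∞)) u),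
    lintegral_indicator_const (hm h), lintegral_indicator_const (hm (-h)), one_mul, one_mul]
  refine (add_le_add (volume_box_diff_le h) (volume_box_diff_le (-h))).trans (le_of_eq ?_)
  rw [enorm_neg]
  ring

end Box

/-! ### From local to uniform estimates on compact sets -/

/-- A local Lipschitz-type estimate near each point of a compact set holds uniformly at small
scales near that set. -/
lemma IsCompact.exists_uniform_lipschitz {X : Type*} [PseudoMetricSpace X] {K : Set X}
    (hK : IsCompact K) {p : X → X → Prop} {ρ : X → X → ENNReal}
    (h : ∀ x ∈ K, ∃ δ > 0, ∃ C : NNReal, ∀ y ∈ Metric.ball x δ, ∀ z ∈ Metric.ball x δ,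
      p y z ∧ ρ y z ≤ C * edist y z) :
    ∃ δ > 0, ∃ C : NNReal, ∀ y ∈ K, ∀ z, dist y z < δ → p y z ∧ ρ y z ≤ C * edist y z := by
  choose! δ hδ C hC using h
  obtain ⟨t, htK, ht⟩ := hK.elim_nhds_subcover (fun x => Metric.ball x (δ x / 2))
    fun x hx => Metric.ball_mem_nhds _ (half_pos (hδ x hx))
  rcases t.eq_empty_or_nonempty with rfl | hne
  · refine ⟨1, one_pos, 0, fun y hy => ?_⟩
    simpa using ht hy
  · refine ⟨t.inf' hne fun x => δ x / 2, ?_, t.sup C, fun y hy z hyz => ?_⟩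
    · rw [gt_iff_lt, Finset.lt_inf'_iff]
      exact fun x hx => half_pos (hδ x (htK x hx))
    · obtain ⟨x, hx, hyx⟩ : ∃ x ∈ t, y ∈ Metric.ball x (δ x / 2) := by
        simpa using ht hy
      have h1 : dist y z < δ x / 2 := hyz.trans_le (Finset.inf'_le _ hx)
      have hδx := hδ x (htK x hx)
      rw [Metric.mem_ball] at hyx
      have hz : z ∈ Metric.ball x (δ x) := by
        rw [Metric.mem_ball]
        calc dist z x ≤ dist z y + dist y x := dist_triangle _ _ _
          _ < δ x := by rw [dist_comm z y]; linarith
      have hy' : y ∈ Metric.ball x (δ x) := by rw [Metric.mem_ball]; linarith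
      obtain ⟨hp, hle⟩ := hC x (htK x hx) y hy' z hz
      refine ⟨hp, hle.trans ?_⟩
      gcongr
      exact Finset.le_sup hx

/-! ### Orthogonal projections in terms of Gram matrices -/

section Gram

open scoped InnerProductSpace

variable {ι : Type*} {E : Type*} [NormedAddCommGroup E] [InnerProductSpace ℝ E]

/-- The map `z ↦ (⟪aᵢ, z⟫)ᵢ`, adjoint to `synth a`. -/
noncomputable def innerMap (a : ι → E) : E →L[ℝ] (ι → ℝ) :=
  ContinuousLinearMap.pi fun i => innerSL ℝ (a i)

@[simp] lemma innerMap_apply (a : ι → E) (z : E) (i : ι) : innerMap a z i = ⟪a i, z⟫_ℝ := rfl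

lemma innerMap_map (R : E ≃ₗᵢ[ℝ] E) (a : ι → E) (z : E) :
    innerMap (fun i => R (a i)) (R z) = innerMap a z := by
  funext i; simp

variable [Fintype ι]

/-- The map `α ↦ ∑ αᵢ aᵢ`. -/
noncomputable def synth (a : ι → E) : (ι → ℝ) →L[ℝ] E :=
  ∑ i, (ContinuousLinearMap.proj (R := ℝ) (φ := fun _ : ι => ℝ) i).smulRight (a i)

/-- The Gram operator of a family of vectors. -/
noncomputable def gram (a : ι → E) : (ι → ℝ) →L[ℝ] (ι → ℝ) := (innerMap a).comp (synth a)

/-- For linearly independent `a`, the orthogonal projection to the complement of their span. -/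
noncomputable def normalProj (a : ι → E) : E →L[ℝ] E :=
  1 - (synth a).comp ((Ring.inverse (gram a)).comp (innerMap a))

/-- For linearly independent `a`, the vector `z` in their span with `⟪aᵢ, z⟫ = bᵢ`. -/
noncomputable def spanSol (a : ι → E) (b : ι → ℝ) : E := synth a (Ring.inverse (gram a) b)

@[simp] lemma synth_apply (a : ι → E) (α : ι → ℝ) : synth a α = ∑ i, α i • a i := by
  simp [synth]

lemma normalProj_apply (a : ι → E) (z : E) : normalProj a z = z - spanSol a (innerMap a z) := rfl

lemma inner_synth (a : ι → E) (α : ι → ℝ) (z : E) :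
    ⟪z, synth a α⟫_ℝ = ∑ i, α i * innerMap a z i := by
  simp [inner_sum, inner_smul_right, real_inner_comm]

lemma inner_spanSol {a : ι → E} {z : E} (hz : innerMap a z = 0) (b : ι → ℝ) :
    ⟪z, spanSol a b⟫_ℝ = 0 := by
  rw [spanSol, inner_synth]; simp only [hz, Pi.zero_apply, mul_zero, Finset.sum_const_zero]

lemma inner_normalProj {a : ι → E} {w : E} (hw : innerMap a w = 0) (z : E) :
    ⟪w, normalProj a z⟫_ℝ = ⟪w, z⟫_ℝ := by
  rw [normalProj_apply, inner_sub_right, inner_spanSol hw, sub_zero]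

lemma normalProj_of_innerMap {a : ι → E} {z : E} (hz : innerMap a z = 0) : normalProj a z = z := by
  rw [normalProj_apply, hz]; simp [spanSol]

lemma isUnit_gram {a : ι → E} (ha : LinearIndependent ℝ a) : IsUnit (gram a) := by
  have hinj : Function.Injective (gram a) := by
    rw [injective_iff_map_eq_zero]
    intro α hα
    have h0 : ⟪synth a α, synth a α⟫_ℝ = 0 := by
      rw [inner_synth]
      have : innerMap a (synth a α) = 0 := hα
      simp only [this, Pi.zero_apply, mul_zero, Finset.sum_const_zero]
    have h1 : ∑ i, α i • a i = 0 := by simpa using inner_self_eq_zero.1 h0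
    funext i
    exact Fintype.linearIndependent_iff.1 ha α h1 i
  have hb : Function.Bijective (gram a : (ι → ℝ) →ₗ[ℝ] (ι → ℝ)) :=
    ⟨hinj, LinearMap.surjective_of_injective hinj⟩
  let e := (LinearEquiv.ofBijective _ hb).toContinuousLinearEquiv
  refine ⟨⟨gram a, e.symm, ?_, ?_⟩, rfl⟩
  · ext1 α
    exact e.apply_symm_apply α
  · ext1 α
    exact e.symm_apply_apply α

lemma innerMap_spanSol {a : ι → E} (ha : LinearIndependent ℝ a) (b : ι → ℝ) :
    innerMap a (spanSol a b) = b :=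
  congrArg (fun T : (ι → ℝ) →L[ℝ] (ι → ℝ) => T b) (Ring.mul_inverse_cancel _ (isUnit_gram ha))

lemma innerMap_normalProj {a : ι → E} (ha : LinearIndependent ℝ a) (z : E) :
    innerMap a (normalProj a z) = 0 := by
  rw [normalProj_apply, map_sub, innerMap_spanSol ha, sub_self]

lemma normalProj_normalProj {a : ι → E} (ha : LinearIndependent ℝ a) (z : E) :
    normalProj a (normalProj a z) = normalProj a z :=
  normalProj_of_innerMap (innerMap_normalProj ha z)

lemma inner_normalProj_left {a : ι → E} (ha : LinearIndependent ℝ a) (w z : E) :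
    ⟪normalProj a w, z⟫_ℝ = ⟪w, normalProj a z⟫_ℝ := by
  rw [← inner_normalProj (innerMap_normalProj ha w) z, real_inner_comm, 
    inner_normalProj (innerMap_normalProj ha z) w, real_inner_comm]

section Equivariance

variable (R : E ≃ₗᵢ[ℝ] E) (a : ι → E)

lemma synth_map (α : ι → ℝ) : synth (fun i => R (a i)) α = R (synth a α) := by simp

lemma gram_map : gram (fun i => R (a i)) = gram a := by
  ext1 α
  change innerMap _ (synth _ α) = innerMap _ (synth _ α)
  rw [synth_map, innerMap_map]

lemma spanSol_map (b : ι → ℝ) : spanSol (fun i => R (a i)) b = R (spanSol a b) := by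
  rw [spanSol, gram_map, synth_map]; rfl

lemma normalProj_map (z : E) : normalProj (fun i => R (a i)) (R z) = R (normalProj a z) := by
  rw [normalProj_apply, innerMap_map, spanSol_map, ← map_sub]; rfl

end Equivariance

lemma contDiff_synth : ContDiff ℝ ∞ (synth : (ι → E) → (ι → ℝ) →L[ℝ] E) := by
  rw [contDiff_clm_apply_iff]
  intro α
  simp only [synth_apply]
  fun_prop

variable [FiniteDimensional ℝ E]

lemma contDiff_innerMap : ContDiff ℝ ∞ (innerMap : (ι → E) → E →L[ℝ] (ι → ℝ)) := by
  rw [contDiff_clm_apply_iff]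
  intro z
  rw [contDiff_pi]
  intro i
  simp only [innerMap_apply]
  exact (contDiff_apply ℝ E i).inner ℝ contDiff_const

lemma contDiffAt_gramInv {a : ι → E} (ha : LinearIndependent ℝ a) :
    ContDiffAt ℝ ∞ (fun a : ι → E => Ring.inverse (gram a)) a := by
  obtain ⟨u, hu⟩ := isUnit_gram ha
  have h1 : ContDiffAt ℝ ∞ (gram : (ι → E) → _) a :=
    (contDiff_innerMap.clm_comp contDiff_synth).contDiffAt
  have h2 := contDiffAt_ringInverse ℝ u (n := ∞)
  rw [hu] at h2
  exact h2.comp a h1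

lemma contDiffAt_normalProj {a : ι → E} (ha : LinearIndependent ℝ a) :
    ContDiffAt ℝ ∞ (normalProj : (ι → E) → E →L[ℝ] E) a :=
  contDiffAt_const.sub ((contDiff_synth (ι := ι) (E := E)).contDiffAt.clm_comp
    ((contDiffAt_gramInv ha).clm_comp contDiff_innerMap.contDiffAt))

lemma contDiffAt_spanSol {a : ι → E} (ha : LinearIndependent ℝ a) (b : ι → ℝ) :
    ContDiffAt ℝ ∞ (fun p : (ι → E) × (ι → ℝ) => spanSol p.1 p.2) (a, b) := by
  have hf : ContDiffAt ℝ ∞ (Prod.fst : (ι → E) × (ι → ℝ) → _) (a, b) := contDiffAt_fst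
  have hg : ContDiffAt ℝ ∞ (fun p : (ι → E) × (ι → ℝ) => Ring.inverse (gram p.1)) (a, b) :=
    ContDiffAt.comp (g := fun a : ι → E => Ring.inverse (gram a)) (a, b) (contDiffAt_gramInv ha) hf
  exact ((contDiff_synth (ι := ι) (E := E)).contDiffAt.comp (a, b) hf).clm_apply
    (hg.clm_apply contDiffAt_snd)

/-- A unit vector orthogonal to all `aᵢ` and to one more vector. -/
lemma exists_unit_innerMap_eq_zero (a : ι → E) (v : E)
    (hd : Fintype.card ι + 2 ≤ Module.finrank ℝ E) :
    ∃ e : E, ‖e‖ = 1 ∧ innerMap a e = 0 ∧ ⟪e, v⟫_ℝ = 0 := by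
  set f : Option ι → E := fun o => o.elim v a with hf
  set K := Submodule.span ℝ (Set.range f) with hK
  have h1 : Module.finrank ℝ K ≤ Fintype.card ι + 1 := by
    have := finrank_range_le_card (R := ℝ) f
    rwa [Fintype.card_option] at this
  have h2 := K.finrank_add_finrank_orthogonal
  have h3 : Kᗮ ≠ ⊥ := by
    intro h
    rw [h, finrank_bot] at h2
    omega
  obtain ⟨w, hwK, hw0⟩ := Submodule.exists_mem_ne_zero_of_ne_bot h3
  have hin : ∀ o, ⟪f o, w⟫_ℝ = 0 := fun o =>
    (Submodule.mem_orthogonal K w).1 hwK _ (Submodule.subset_span ⟨o, rfl⟩)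
  refine ⟨dir w, norm_dir hw0, ?_, ?_⟩
  · funext i
    have := hin (some i)
    simp only [hf, Option.elim] at this
    simp [dir, inner_smul_right, this]
  · have := hin none
    simp only [hf, Option.elim] at this
    simp [dir, inner_smul_left, real_inner_comm, this]

end Gram

/-! ### Hausdorff measure of spheres -/

section Sphere

open scoped InnerProductSpace

variable {E : Type*} [NormedAddCommGroup E] [InnerProductSpace ℝ E] [MeasurableSpace E]
  [BorelSpace E]

/-- The sphere with centre `c` and radius `ρ` in the affine subspace `c + K`. -/
def subSphere (K : Submodule ℝ E) (c : E) (ρ : ℝ) : Set E := {y | y - c ∈ K ∧ ‖y - c‖ = ρ}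

variable {K : Submodule ℝ E} {m : ℕ} (b : OrthonormalBasis (Fin (m + 1)) ℝ K) (c : E) {ρ : ℝ}

include b in
/-- The sphere projects onto a ball of dimension `m`. -/
lemma hausdorffMeasure_subSphere_pos (hρ : 0 < ρ) :
    0 < Measure.hausdorffMeasure (m : ℝ) (subSphere K c ρ) := by
  set p : E → (Fin m → ℝ) := fun y i => ⟪(b i.succ : E), y - c⟫_ℝ with hp
  have hlip : LipschitzWith 1 p := by
    refine LipschitzWith.of_dist_le_mul fun y z => ?_
    rw [NNReal.coe_one, one_mul]
    refine (dist_pi_le_iff dist_nonneg).2 fun i => ?_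
    rw [Real.dist_eq, hp, ← inner_sub_right, sub_sub_sub_cancel_right, dist_eq_norm]
    refine (abs_real_inner_le_norm _ _).trans ?_
    have : ‖(b i.succ : E)‖ = 1 := b.norm_eq_one _
    rw [this, one_mul]
  set U : Set (Fin m → ℝ) := {t | ∑ i, t i ^ 2 < ρ ^ 2} with hU
  have hUo : IsOpen U := isOpen_lt (by fun_prop) continuous_const
  have hUp : 0 < volume U := hUo.measure_pos _ ⟨0, by simp [hU, hρ]⟩
  have hsub : U ⊆ p '' subSphere K c ρ := by
    intro t ht
    set v : Fin (m + 1) → ℝ := Fin.cons (Real.sqrt (ρ ^ 2 - ∑ i, t i ^ 2)) t with hv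
    set k : K := ∑ l, v l • b l with hk
    have hrep : b.repr k = WithLp.toLp 2 v := by
      rw [hk, ← b.repr.apply_symm_apply (WithLp.toLp 2 v)]
      exact congrArg b.repr (b.sum_repr_symm (WithLp.toLp 2 v))
    refine ⟨c + k, ⟨by simp, ?_⟩, ?_⟩
    · rw [add_sub_cancel_left, ← Submodule.coe_norm, ← b.repr.norm_map, hrep,
        EuclideanSpace.norm_eq, Real.sqrt_eq_iff_mul_self_eq (by positivity) hρ.le]
      have h0 : 0 ≤ ρ ^ 2 - ∑ i, t i ^ 2 := sub_nonneg.2 (le_of_lt ht)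
      simp [Fin.sum_univ_succ, hv, Real.sq_sqrt h0]
      ring
    · funext i
      simp only [hp, add_sub_cancel_left]
      have : ⟪(b i.succ : E), (k : E)⟫_ℝ = b.repr k i.succ := by
        rw [b.repr_apply_apply]; rfl
      rw [this, hrep]
      simp [hv]
  have h := hlip.hausdorffMeasure_image_le (d := (m : ℝ)) (by positivity) (subSphere K c ρ)
  have hv : Measure.hausdorffMeasure (m : ℝ) = (volume : Measure (Fin m → ℝ)) := by
    rw [← hausdorffMeasure_pi_real, Fintype.card_fin]
  rw [hv] at h
  simp only [ENNReal.coe_one, ENNReal.one_rpow, one_mul] at h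
  exact hUp.trans_le ((measure_mono hsub).trans h)

include b in
/-- The sphere is a finite union of Lipschitz images of cubes of dimension `m`. -/
lemma hausdorffMeasure_subSphere_lt_top (hρ : 0 < ρ) :
    Measure.hausdorffMeasure (m : ℝ) (subSphere K c ρ) < ⊤ := by
  -- radial projection of the faces of a cube, one for each coordinate and sign
  set V : (Fin (m + 1) → ℝ) → E := fun w => ((∑ l, w l • b l : K) : E) with hV
  have hVrep : ∀ w, b.repr (∑ l, w l • b l) = WithLp.toLp 2 w := fun w => by
    rw [← b.repr.apply_symm_apply (WithLp.toLp 2 w)]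
    exact congrArg b.repr (b.sum_repr_symm (WithLp.toLp 2 w))
  have hVin : ∀ w l, ⟪(b l : E), V w⟫_ℝ = w l := by
    intro w l
    have : ⟪(b l : E), V w⟫_ℝ = b.repr (∑ l, w l • b l) l := by
      rw [b.repr_apply_apply]; rfl
    rw [this, hVrep]
  have hVlip : ∀ w w', ‖V w - V w'‖ ≤ (m + 1) * dist w w' := by
    intro w w'
    have : V w - V w' = ∑ l, (w l - w' l) • (b l : E) := by
      simp [hV, sub_smul, Finset.sum_sub_distrib]
    rw [this]
    refine (norm_sum_le _ _).trans ?_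
    have : ∀ l, ‖(w l - w' l) • (b l : E)‖ ≤ dist w w' := by
      intro l
      have h1 : ‖(b l : E)‖ = 1 := b.norm_eq_one _
      rw [norm_smul, h1, mul_one, ← dist_eq_norm]
      exact dist_le_pi_dist w w' l
    refine (Finset.sum_le_sum fun l _ => this l).trans ?_
    simp
  set Φ : Fin (m + 1) → ℝ → (Fin m → ℝ) → E := fun i σ t =>
    c + ρ • dir (V (i.insertNth σ t)) with hΦ
  have hdist : ∀ (i : Fin (m + 1)) (σ : ℝ) (t t' : Fin m → ℝ),
      dist (i.insertNth σ t : Fin (m + 1) → ℝ) (i.insertNth σ t') ≤ dist t t' := by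
    intro i σ t t'
    refine (dist_pi_le_iff dist_nonneg).2 fun l => ?_
    refine Fin.succAboveCases i ?_ (fun k => ?_) l
    · simp
    · simpa using dist_le_pi_dist t t' k
  have hlip : ∀ i σ, |σ| = 1 → LipschitzWith (Real.toNNReal (ρ * (2 * (m + 1)))) (Φ i σ) := by
    intro i σ hσ
    refine LipschitzWith.of_dist_le_mul fun t t' => ?_
    rw [Real.coe_toNNReal _ (by positivity), hΦ, dist_add_left, dist_eq_norm, ← smul_sub, norm_smul,
      Real.norm_of_nonneg hρ.le, mul_assoc]
    have h1 : 1 ≤ ‖V (i.insertNth σ t)‖ := by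
      have := abs_real_inner_le_norm (b i : E) (V (i.insertNth σ t))
      have hb1 : ‖(b i : E)‖ = 1 := b.norm_eq_one _
      rw [hVin, hb1, Fin.insertNth_apply_same, hσ, one_mul] at this
      exact this
    have h0 : V (i.insertNth σ t) ≠ 0 := fun h => by rw [h, norm_zero] at h1; linarith
    refine mul_le_mul_of_nonneg_left ((norm_dir_sub_le h0 _).trans ?_) hρ.le
    calc 2 * ‖V (i.insertNth σ t)‖⁻¹ * ‖V (i.insertNth σ t) - V (i.insertNth σ t')‖
        ≤ 2 * 1 * ((m + 1) * dist t t') := by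
          gcongr
          · exact inv_le_one_of_one_le₀ h1
          · exact (hVlip _ _).trans (by gcongr; exact hdist i σ t t')
      _ = _ := by ring
  have hsub : subSphere K c ρ ⊆ ⋃ (i : Fin (m + 1)) , (Φ i 1 '' Set.Icc (-1) 1 ∪
      Φ i (-1) '' Set.Icc (-1) 1) := by
    rintro y ⟨hyK, hy⟩
    set k : K := ⟨y - c, hyK⟩
    set u : Fin (m + 1) → ℝ := fun l => b.repr k l with hu
    obtain ⟨i, -, hi⟩ := Finset.exists_max_image Finset.univ (fun l => |u l|)
      ⟨0, Finset.mem_univ _⟩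
    have hyV : ∀ s : ℝ, V (fun l => s * u l) = s • (y - c) := by
      intro s
      have : ∑ l, u l • b l = k := by
        simpa using b.sum_repr k
      have h2 : (∑ l, (s * u l) • b l : K) = s • k := by
        rw [← this, Finset.smul_sum]; simp [mul_smul]
      rw [hV]
      exact congrArg Subtype.val h2
    have hui : 0 < |u i| := by
      by_contra h
      have hz : ∀ l, u l = 0 := fun l =>
        abs_eq_zero.1 (le_antisymm ((hi l (Finset.mem_univ _)).trans (not_lt.1 h)) (abs_nonneg _))
      have := hyV 1
      rw [one_smul] at this
      rw [← this] at hy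
      simp [hV, hz] at hy
      exact hρ.ne hy
    have hvec : ∀ σ : ℝ, |u i|⁻¹ * u i = σ →
        y = Φ i σ (i.removeNth fun l => |u i|⁻¹ * u l) := by
      intro σ hσ
      have : (i.insertNth σ (i.removeNth fun l => |u i|⁻¹ * u l) : Fin (m + 1) → ℝ)
          = fun l => |u i|⁻¹ * u l := by
        rw [← hσ]; exact Fin.insertNth_self_removeNth i _
      rw [hΦ]
      simp only
      rw [this, hyV, dir, norm_smul, hy, smul_smul, smul_smul, norm_inv, norm_abs_eq_norm,
        Real.norm_eq_abs]
      have : ρ * ((|u i|⁻¹ * ρ)⁻¹ * |u i|⁻¹) = 1 := by field_simp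
      rw [← mul_assoc] at this
      rw [this, one_smul, add_sub_cancel]
    have hmem : (i.removeNth fun l => |u i|⁻¹ * u l) ∈ Set.Icc (-1 : Fin m → ℝ) 1 := by
      have : ∀ l, |(|u i|⁻¹ * u l)| ≤ 1 := by
        intro l
        rw [abs_mul, abs_inv, abs_abs, inv_mul_le_iff₀ hui, mul_one]
        exact hi l (Finset.mem_univ _)
      exact ⟨fun k => (abs_le.1 (this _)).1, fun k => (abs_le.1 (this _)).2⟩
    rw [Set.mem_iUnion]
    refine ⟨i, ?_⟩
    rcases abs_choice (u i) with h | h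
    · exact Or.inl ⟨_, hmem, (hvec 1 (by rw [h] at hui ⊢; field_simp)).symm⟩
    · refine Or.inr ⟨_, hmem, (hvec (-1) ?_).symm⟩
      rw [h] at hui ⊢
      have : u i ≠ 0 := by linarith
      field_simp
  have hfin : ∀ i σ, |σ| = 1 →
      Measure.hausdorffMeasure (m : ℝ) (Φ i σ '' Set.Icc (-1) 1) < ⊤ := by
    intro i σ hσ
    refine ((hlip i σ hσ).hausdorffMeasure_image_le (d := (m : ℝ)) (by positivity) _).trans_lt ?_
    have hv : Measure.hausdorffMeasure (m : ℝ) = (volume : Measure (Fin m → ℝ)) := by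
      rw [← hausdorffMeasure_pi_real, Fintype.card_fin]
    rw [hv]
    exact ENNReal.mul_lt_top (ENNReal.rpow_lt_top_of_nonneg (by positivity) ENNReal.coe_ne_top)
      isCompact_Icc.measure_lt_top
  refine (measure_mono hsub).trans_lt ((measure_iUnion_le _).trans_lt ?_)
  rw [tsum_fintype]
  refine ENNReal.sum_lt_top.2 fun i _ => (measure_union_le _ _).trans_lt ?_
  exact ENNReal.add_lt_top.2 ⟨hfin i 1 (by simp), hfin i (-1) (by simp)⟩

end Sphere

/-! ### Parametrization of spheres by the unit ball -/

section Place

open scoped InnerProductSpace ENNReal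

variable {d : ℕ} {ι : Type*} [Fintype ι] {a : ι → Euc d}

/-- Two orthonormal vectors orthogonal to all `aᵢ` when there are at most `d - 2` of these. -/
lemma exists_pair_innerMap_eq_zero (a : ι → Euc d) (hd : Fintype.card ι + 2 ≤ d) :
    ∃ e e' : Euc d, ‖e‖ = 1 ∧ ‖e'‖ = 1 ∧ ⟪e, e'⟫_ℝ = 0 ∧ innerMap a e = 0 ∧ innerMap a e' = 0 := by
  have hd' : Fintype.card ι + 2 ≤ Module.finrank ℝ (Euc d) := by simpa using hd
  obtain ⟨e, he, hea, -⟩ := exists_unit_innerMap_eq_zero a 0 hd'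
  obtain ⟨e', he', hea', h⟩ := exists_unit_innerMap_eq_zero a e hd'
  exact ⟨e, e', he, he', by rwa [real_inner_comm], hea, hea'⟩

lemma lintegral_inv_norm_normalProj_le (a : ι → Euc d) (hd : Fintype.card ι + 2 ≤ d) :
    ∫⁻ g, ‖normalProj a g‖ₑ⁻¹ ∂(ballMeasure d) ≤ projConst d := by
  obtain ⟨e, e', he, he', h, hea, hea'⟩ := exists_pair_innerMap_eq_zero a hd
  exact lintegral_inv_norm_le he he' h (inner_normalProj hea) (inner_normalProj hea')

lemma ae_normalProj_ne_zero (a : ι → Euc d) (hd : Fintype.card ι + 2 ≤ d) :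
    ∀ᵐ g ∂(ballMeasure d), normalProj a g ≠ 0 := by
  have h := ae_lt_top' (f := fun g => ‖normalProj a g‖ₑ⁻¹) (μ := ballMeasure d)
    (by fun_prop) ((lintegral_inv_norm_normalProj_le a hd).trans_lt projConst_ne_top.lt_top).ne
  filter_upwards [h] with g hg h0
  simp [h0] at hg

/-- The kernel of `innerMap a`: the common orthogonal complement of the `aᵢ`. -/
noncomputable def normalSpace (a : ι → Euc d) : Submodule ℝ (Euc d) :=
  LinearMap.ker (innerMap a : Euc d →ₗ[ℝ] (ι → ℝ))

omit [Fintype ι] in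
lemma mem_normalSpace {z : Euc d} : z ∈ normalSpace a ↔ innerMap a z = 0 := Iff.rfl

lemma finrank_normalSpace (ha : LinearIndependent ℝ a) :
    Module.finrank ℝ (normalSpace a) + Fintype.card ι = d := by
  have h1 := LinearMap.finrank_range_add_finrank_ker (innerMap a : Euc d →ₗ[ℝ] (ι → ℝ))
  have h2 : LinearMap.range (innerMap a : Euc d →ₗ[ℝ] (ι → ℝ)) = ⊤ :=
    LinearMap.range_eq_top.2 fun b => ⟨spanSol a b, innerMap_spanSol ha b⟩
  rw [h2, finrank_top] at h1
  simp only [Module.finrank_fintype_fun_eq_card, finrank_euclideanSpace_fin] at h1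
  rw [normalSpace, add_comm]
  exact h1

/-- The point of the sphere with centre `c`, radius `ρ` and directions orthogonal to `a` that lies
in the direction of the projection of `g`. -/
noncomputable def spherePoint (a : ι → Euc d) (c : Euc d) (ρ : ℝ) (g : Euc d) : Euc d :=
  c + ρ • dir (normalProj a g)

lemma measurable_spherePoint (c : Euc d) (ρ : ℝ) : Measurable (spherePoint a c ρ) :=
  ((measurable_dir.comp (normalProj a).continuous.measurable).const_smul ρ).const_add c

lemma spherePoint_mem (ha : LinearIndependent ℝ a) {c : Euc d} {ρ : ℝ} (hρ : 0 < ρ) {g : Euc d}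
    (hg : normalProj a g ≠ 0) : spherePoint a c ρ g ∈ subSphere (normalSpace a) c ρ := by
  constructor
  · rw [mem_normalSpace, spherePoint, add_sub_cancel_left, map_smul, dir, map_smul,
      innerMap_normalProj ha, smul_zero, smul_zero]
  · rw [spherePoint, add_sub_cancel_left, norm_smul, norm_dir hg, Real.norm_of_nonneg hρ.le,
      mul_one]

lemma isCompact_subSphere {K : Submodule ℝ (Euc d)} {c : Euc d} {ρ : ℝ} :
    IsCompact (subSphere K c ρ) := by
  have h1 : IsClosed {y : Euc d | y - c ∈ K} :=
    (Submodule.closed_of_finiteDimensional K).preimage (continuous_id.sub continuous_const)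
  have h2 : subSphere K c ρ = {y : Euc d | y - c ∈ K} ∩ Metric.sphere c ρ := by
    ext y; simp [subSphere]
  rw [h2]
  exact (isCompact_sphere c ρ).inter_left h1

/-- The normalized Hausdorff measure on a sphere is the image of the uniform measure on the unit
ball under `spherePoint`: both are uniformly distributed, since reflections fixing the `aᵢ` act
transitively on the sphere. -/
lemma cond_hausdorffMeasure_subSphere (ha : LinearIndependent ℝ a) (c : Euc d) {ρ : ℝ}
    (hρ : 0 < ρ) {m : ℕ} (hm : Fintype.card ι + (m + 1) = d) (hm1 : 1 ≤ m) :
    ProbabilityTheory.cond (Measure.hausdorffMeasure (m : ℝ)) (subSphere (normalSpace a) c ρ)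
      = (ballMeasure d).map (spherePoint a c ρ) := by
  set S := subSphere (normalSpace a) c ρ with hS
  have hfin : Module.finrank ℝ (normalSpace a) = m + 1 := by
    have := finrank_normalSpace ha; omega
  set b := (stdOrthonormalBasis ℝ (normalSpace a)).reindex (finCongr hfin)
  have hpos := hausdorffMeasure_subSphere_pos b c hρ
  have htop := hausdorffMeasure_subSphere_lt_top b c hρ
  have hSm : MeasurableSet S := isCompact_subSphere.measurableSet
  have : IsProbabilityMeasure (ProbabilityTheory.cond (Measure.hausdorffMeasure (m : ℝ)) S) :=
    ProbabilityTheory.cond_isProbabilityMeasure_of_finite hpos.ne' htop.ne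
  have hpm : Measurable (spherePoint a c ρ) := measurable_spherePoint c ρ
  have : IsProbabilityMeasure ((ballMeasure d).map (spherePoint a c ρ)) :=
    Measure.isProbabilityMeasure_map hpm.aemeasurable
  -- the reflection exchanging two points of the sphere
  have hrefl : ∀ x ∈ S, ∀ y ∈ S, ∃ R : Euc d ≃ₗᵢ[ℝ] Euc d,
      (∀ i, R (a i) = a i) ∧ R (x - c) = y - c := by
    intro x hx y hy
    refine ⟨Submodule.reflection (ℝ ∙ ((x - c) - (y - c)))ᗮ, fun i => ?_,
      Submodule.reflection_sub (by rw [hx.2, hy.2])⟩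
    rw [Submodule.reflection_eq_self_iff, Submodule.mem_orthogonal_singleton_iff_inner_left,
      inner_sub_right]
    have h1 := congrFun (mem_normalSpace.1 hx.1) i
    have h2 := congrFun (mem_normalSpace.1 hy.1) i
    rw [innerMap_apply] at h1 h2
    rw [h1, h2]; simp
  have hinv : ∀ R : Euc d ≃ₗᵢ[ℝ] Euc d, (∀ i, R (a i) = a i) → (fun i => R (a i)) = a :=
    fun R h => funext h
  refine measure_eq_of_uniformly_distributed (S := S) isCompact_subSphere
    (ProbabilityTheory.ae_cond_mem hSm) ?_ ?_ ?_
  · refine (ae_map_iff (p := fun z => z ∈ S) hpm.aemeasurable hSm).2 ?_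
    filter_upwards [ae_normalProj_ne_zero a (by omega)] with g hg
    exact spherePoint_mem ha hρ hg
  · intro r x hx y hy
    obtain ⟨R, hRa, hR⟩ := hrefl x hx y hy
    set e : Euc d ≃ᵢ Euc d := (IsometryEquiv.subRight c).trans
      (R.toIsometryEquiv.trans (IsometryEquiv.addRight c)) with he
    have hez : ∀ z, e z - c = R (z - c) := by
      intro z
      simp [he]
    have hey : e x = y := by
      have := hez x
      rwa [hR, sub_left_inj] at this
    have hpre : e ⁻¹' (S ∩ Metric.ball y r) = S ∩ Metric.ball x r := by
      ext z
      simp only [Set.mem_preimage, Set.mem_inter_iff, hS, subSphere, Set.mem_ofPred_eq, hez,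
        mem_normalSpace, LinearIsometryEquiv.norm_map, Metric.mem_ball]
      rw [← hey, e.dist_eq]
      nth_rewrite 1 [← hinv R hRa]
      rw [innerMap_map]
    rw [Measure.real, Measure.real, ProbabilityTheory.cond_apply hSm,
      ProbabilityTheory.cond_apply hSm, ← hpre, IsometryEquiv.hausdorffMeasure_preimage]
  · intro r x hx y hy
    obtain ⟨R, hRa, hR⟩ := hrefl y hy x hx
    have hpl : ∀ g, spherePoint a c ρ (R g) - c = R (spherePoint a c ρ g - c) := by
      intro g
      simp only [spherePoint, add_sub_cancel_left]
      nth_rewrite 1 [← hinv R hRa]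
      rw [normalProj_map, dir_map, map_smul]
    rw [Measure.real, Measure.real, Measure.map_apply hpm Metric.isOpen_ball.measurableSet,
      Measure.map_apply hpm Metric.isOpen_ball.measurableSet,
      ← (measurePreserving_ballMeasure R).measure_preimage
        (hpm Metric.isOpen_ball.measurableSet).nullMeasurableSet (s := spherePoint a c ρ ⁻¹' _)]
    congr 2
    ext g
    simp only [Set.mem_preimage, Metric.mem_ball]
    have : dist (spherePoint a c ρ (R g)) x = dist (spherePoint a c ρ g) y := by
      rw [dist_eq_norm, dist_eq_norm, ← sub_sub_sub_cancel_right _ x c, hpl, ← hR, ← map_sub,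
        LinearIsometryEquiv.norm_map, sub_sub_sub_cancel_right]
    rw [this]

end Place

/-! ### Placing one vertex of the distance graph -/

namespace DistanceGraph

open scoped InnerProductSpace ENNReal

variable {d n : ℕ} (Γ : DistanceGraph d n)

open Classical in
/-- A distinguished predecessor of the vertex `j.succ` (if there is any). -/
noncomputable def base (j : Fin n) : Fin (n + 1) :=
  if h : (Γ.pred j).Nonempty then (Γ.pred j).min' h else 0

lemma base_mem {j : Fin n} (h : (Γ.pred j).Nonempty) : Γ.base j ∈ Γ.pred j := by
  rw [base, dif_pos h]; exact Finset.min'_mem _ _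

lemma mem_pred {j : Fin n} {i : Fin (n + 1)} :
    i ∈ Γ.pred j ↔ i < j.succ ∧ Γ.graph.Adj i j.succ := by
  simp [pred]

/-- The predecessors of `j.succ` other than the distinguished one. -/
abbrev Others (j : Fin n) : Type := {i : Fin (n + 1) // i ∈ (Γ.pred j).erase (Γ.base j)}

lemma card_others {j : Fin n} (h : (Γ.pred j).Nonempty) :
    Fintype.card (Γ.Others j) + 1 = (Γ.pred j).card := by
  rw [Fintype.card_coe, Finset.card_erase_add_one (Γ.base_mem h)]

/-- The vectors from the distinguished predecessor to the other ones. -/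
noncomputable def diffs (j : Fin n) (x : Fin (n + 1) → Euc d) : Γ.Others j → Euc d :=
  fun i => x i - x (Γ.base j)

/-- The prescribed distance of `v_{j.succ}` to `v_i`. -/
noncomputable def len (j : Fin n) (i : Fin (n + 1)) : ℝ := ‖Γ.vertex j.succ - Γ.vertex i‖

/-- Inner products with `Γ.diffs j x` of a vector from the distinguished predecessor to a point
of the sphere `Γ.sphere j x`. -/
noncomputable def rhs (j : Fin n) (x : Fin (n + 1) → Euc d) : Γ.Others j → ℝ :=
  fun i => (‖x i - x (Γ.base j)‖ ^ 2 + Γ.len j (Γ.base j) ^ 2 - Γ.len j i ^ 2) / 2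

/-- The centre of `Γ.sphere j x`, relative to the distinguished predecessor. -/
noncomputable def relCenter (j : Fin n) (x : Fin (n + 1) → Euc d) : Euc d :=
  spanSol (Γ.diffs j x) (Γ.rhs j x)

/-- The centre of `Γ.sphere j x`. -/
noncomputable def center (j : Fin n) (x : Fin (n + 1) → Euc d) : Euc d :=
  x (Γ.base j) + Γ.relCenter j x

/-- The squared radius of `Γ.sphere j x`. -/
noncomputable def radSq (j : Fin n) (x : Fin (n + 1) → Euc d) : ℝ :=
  Γ.len j (Γ.base j) ^ 2 - ‖Γ.relCenter j x‖ ^ 2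

/-- The configurations for which the predecessors of `j.succ` are in general position and the
squared radius of `Γ.sphere j x` exceeds `r`. -/
def regular (r : ℝ) (j : Fin n) : Set (Fin (n + 1) → Euc d) :=
  {x | LinearIndependent ℝ (Γ.diffs j x) ∧ r < Γ.radSq j x}

open Classical in
/-- The position of the vertex `j.succ` determined by a point `g` of the unit ball: for `g` uniformly
distributed and `x` regular it is uniformly distributed on `Γ.sphere j x`. -/
noncomputable def place (r : ℝ) (j : Fin n) (x : Fin (n + 1) → Euc d) (g : Euc d) : Euc d :=
  if x ∈ Γ.regular r j then
    spherePoint (Γ.diffs j x) (Γ.center j x) (Real.sqrt (Γ.radSq j x)) g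
  else 0

variable {Γ} {r : ℝ} {j : Fin n} {x : Fin (n + 1) → Euc d}

lemma place_of_mem (hx : x ∈ Γ.regular r j) (g : Euc d) : Γ.place r j x g =
    spherePoint (Γ.diffs j x) (Γ.center j x) (Real.sqrt (Γ.radSq j x)) g := if_pos hx

/-- Subtracting the equation of the distinguished predecessor from the others turns the equations of the
sphere into linear ones and a single quadratic one. -/
lemma mem_sphere_iff (hp : (Γ.pred j).Nonempty) (hx : LinearIndependent ℝ (Γ.diffs j x))
    (y : Euc d) : y ∈ Γ.sphere j x ↔
      y - Γ.center j x ∈ normalSpace (Γ.diffs j x) ∧ ‖y - Γ.center j x‖ ^ 2 = Γ.radSq j x := by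
  set z := y - x (Γ.base j) with hz
  have hyc : y - Γ.center j x = z - Γ.relCenter j x := by rw [center, hz]; abel
  have h1 : y - Γ.center j x ∈ normalSpace (Γ.diffs j x) ↔ innerMap (Γ.diffs j x) z = Γ.rhs j x := by
    rw [mem_normalSpace, hyc, map_sub, relCenter, innerMap_spanSol hx, sub_eq_zero]
  have h2 : innerMap (Γ.diffs j x) z = Γ.rhs j x →
      ‖y - Γ.center j x‖ ^ 2 = ‖z‖ ^ 2 - ‖Γ.relCenter j x‖ ^ 2 := by
    intro h
    have hc : innerMap (Γ.diffs j x) (y - Γ.center j x) = 0 := mem_normalSpace.1 (h1.2 h)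
    have ho : ⟪y - Γ.center j x, Γ.relCenter j x⟫_ℝ = 0 := inner_spanSol hc _
    have : z = (y - Γ.center j x) + Γ.relCenter j x := by rw [hyc]; abel
    rw [this, norm_add_sq_real, ho]
    ring
  have h3 : y ∈ Γ.sphere j x ↔
      innerMap (Γ.diffs j x) z = Γ.rhs j x ∧ ‖z‖ ^ 2 = Γ.len j (Γ.base j) ^ 2 := by
    have hterm : ∀ i, ‖y - x i‖ ^ 2
        = ‖z‖ ^ 2 - 2 * ⟪x i - x (Γ.base j), z⟫_ℝ + ‖x i - x (Γ.base j)‖ ^ 2 := by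
      intro i
      have : y - x i = z - (x i - x (Γ.base j)) := by rw [hz]; abel
      rw [this, norm_sub_sq_real, real_inner_comm]
    constructor
    · intro hy
      have hb : ‖z‖ ^ 2 = Γ.len j (Γ.base j) ^ 2 := hy _ (Γ.base_mem hp)
      refine ⟨funext fun i => ?_, hb⟩
      have hi := hy i (Finset.mem_of_mem_erase i.2)
      rw [hterm, hb] at hi
      simp only [innerMap_apply, diffs, rhs, len] at hi ⊢
      linarith
    · rintro ⟨hin, hb⟩ i hi
      by_cases hib : i = Γ.base j
      · rw [hib]; exact hb
      · have := congrFun hin ⟨i, Finset.mem_erase.2 ⟨hib, hi⟩⟩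
        rw [hterm, hb]
        simp only [innerMap_apply, diffs, rhs, len] at this ⊢
        linarith
  rw [h3, h1]
  constructor
  · rintro ⟨h, hb⟩
    exact ⟨h, by rw [h2 h, hb, radSq]⟩
  · rintro ⟨h, hb⟩
    rw [h2 h, radSq] at hb
    exact ⟨h, by linarith⟩

lemma sphere_eq_subSphere (hr : 0 ≤ r) (hp : (Γ.pred j).Nonempty) (hx : x ∈ Γ.regular r j) :
    Γ.sphere j x
      = subSphere (normalSpace (Γ.diffs j x)) (Γ.center j x) (Real.sqrt (Γ.radSq j x)) := by
  have h0 : 0 ≤ Γ.radSq j x := hr.trans hx.2.le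
  ext y
  rw [mem_sphere_iff hp hx.1]
  refine and_congr Iff.rfl ?_
  rw [eq_comm, Real.sqrt_eq_iff_mul_self_eq h0 (norm_nonneg _) |>.symm.trans eq_comm |>.symm, sq,
    eq_comm]

/-- The normalized surface measure is the distribution of the random position of the vertex. -/
lemma surfaceMeasure_eq_map (hr : 0 ≤ r) (hp : (Γ.pred j).Nonempty) (hd : (Γ.pred j).card + 1 ≤ d)
    (hx : x ∈ Γ.regular r j) :
    Γ.surfaceMeasure j x = (ballMeasure d).map (Γ.place r j x) := by
  have hc := Γ.card_others hp
  have hcast : (d : ℝ) - ((Γ.pred j).card : ℝ) = ((d - (Γ.pred j).card : ℕ) : ℝ) := by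
    rw [Nat.cast_sub (by omega)]
  rw [surfaceMeasure, sphere_eq_subSphere hr hp hx, hcast,
    cond_hausdorffMeasure_subSphere hx.1 _ (Real.sqrt_pos.2 (hr.trans_lt hx.2)) (by omega)
      (by omega)]
  congr 1
  funext g
  rw [place_of_mem hx]

lemma ae_normalProj_diffs_ne_zero (hp : (Γ.pred j).Nonempty) (hd : (Γ.pred j).card + 1 ≤ d) :
    ∀ᵐ g ∂(ballMeasure d), normalProj (Γ.diffs j x) g ≠ 0 :=
  ae_normalProj_ne_zero _ (by have := Γ.card_others hp; omega)

lemma ae_place_mem_sphere (hr : 0 ≤ r) (hp : (Γ.pred j).Nonempty) (hd : (Γ.pred j).card + 1 ≤ d)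
    (hx : x ∈ Γ.regular r j) : ∀ᵐ g ∂(ballMeasure d), Γ.place r j x g ∈ Γ.sphere j x := by
  filter_upwards [ae_normalProj_diffs_ne_zero hp hd] with g hg
  rw [sphere_eq_subSphere hr hp hx, place_of_mem hx]
  exact spherePoint_mem hx.1 (Real.sqrt_pos.2 (hr.trans_lt hx.2)) hg

/-! ### Invariance and locality of the placement -/

section Equivariance

variable (R : Euc d ≃ₗᵢ[ℝ] Euc d)

lemma diffs_map : Γ.diffs j (fun i => R (x i)) = fun i => R (Γ.diffs j x i) := by
  funext i; simp [diffs]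

lemma rhs_map : Γ.rhs j (fun i => R (x i)) = Γ.rhs j x := by
  funext i; simp [rhs, ← map_sub]

lemma relCenter_map : Γ.relCenter j (fun i => R (x i)) = R (Γ.relCenter j x) := by
  rw [relCenter, diffs_map, rhs_map, spanSol_map, relCenter]

lemma center_map : Γ.center j (fun i => R (x i)) = R (Γ.center j x) := by
  rw [center, relCenter_map, center, map_add]

lemma radSq_map : Γ.radSq j (fun i => R (x i)) = Γ.radSq j x := by
  rw [radSq, relCenter_map, LinearIsometryEquiv.norm_map, radSq]

lemma map_mem_regular : (fun i => R (x i)) ∈ Γ.regular r j ↔ x ∈ Γ.regular r j := by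
  have : LinearIndependent ℝ (fun i => R (Γ.diffs j x i)) ↔ LinearIndependent ℝ (Γ.diffs j x) :=
    R.toLinearEquiv.toLinearMap.linearIndependent_iff (LinearMap.ker_eq_bot.2 R.injective)
  simp only [regular, Set.mem_ofPred_eq, diffs_map, radSq_map, this]

lemma place_map (g : Euc d) : Γ.place r j (fun i => R (x i)) (R g) = R (Γ.place r j x g) := by
  by_cases hx : x ∈ Γ.regular r j
  · rw [place_of_mem hx, place_of_mem ((map_mem_regular R).2 hx)]
    simp only [spherePoint, radSq_map, center_map, diffs_map, normalProj_map, dir_map, map_add,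
      map_smul]
  · rw [place, place, if_neg hx, if_neg (fun h => hx ((map_mem_regular R).1 h)), map_zero]

end Equivariance

section Congr

variable {x' : Fin (n + 1) → Euc d}

lemma diffs_congr (hp : (Γ.pred j).Nonempty) (h : ∀ i ∈ Γ.pred j, x i = x' i) :
    Γ.diffs j x = Γ.diffs j x' := by
  funext i
  simp only [diffs, h _ (Finset.mem_of_mem_erase i.2), h _ (Γ.base_mem hp)]

lemma relCenter_congr (hp : (Γ.pred j).Nonempty) (h : ∀ i ∈ Γ.pred j, x i = x' i) :
    Γ.relCenter j x = Γ.relCenter j x' := by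
  have : Γ.rhs j x = Γ.rhs j x' := by
    funext i
    simp only [rhs, h _ (Finset.mem_of_mem_erase i.2), h _ (Γ.base_mem hp)]
  rw [relCenter, relCenter, diffs_congr hp h, this]

lemma mem_regular_congr (hp : (Γ.pred j).Nonempty) (h : ∀ i ∈ Γ.pred j, x i = x' i) :
    x ∈ Γ.regular r j ↔ x' ∈ Γ.regular r j := by
  simp only [regular, Set.mem_ofPred_eq, diffs_congr hp h, radSq, relCenter_congr hp h]

end Congr

/-- Configurations in the support of the cutoffs are regular. -/
lemma mem_regular_of_config {s : ℝ} (hs : 0 < s) (hr : r < s ^ 2) (hp : (Γ.pred j).Nonempty)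
    (hx : x ∈ Γ.configSpace)
    (hai : AffineIndependent ℝ (fun i : {i : Fin (n + 1) // i ∈ Γ.pred j} => x i))
    (hs' : s ≤ Metric.infDist (x j.succ)
      (affineSpan ℝ (x '' {i | i ∈ Γ.pred j}) : Set (Euc d))) :
    x ∈ Γ.regular r j := by
  have hli : LinearIndependent ℝ (Γ.diffs j x) := by
    have h := (affineIndependent_iff_linearIndependent_vsub ℝ _
      (⟨Γ.base j, Γ.base_mem hp⟩ : {i : Fin (n + 1) // i ∈ Γ.pred j})).1 hai
    let f : Γ.Others j → {y : {i : Fin (n + 1) // i ∈ Γ.pred j} //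
        y ≠ ⟨Γ.base j, Γ.base_mem hp⟩} := fun i =>
      ⟨⟨i.1, Finset.mem_of_mem_erase i.2⟩, fun hi =>
        Finset.ne_of_mem_erase i.2 (congrArg Subtype.val hi)⟩
    have hf : Function.Injective f := fun i i' hii => by
      have := congrArg (fun z => z.1.1) hii
      exact Subtype.ext this
    exact h.comp f hf
  refine ⟨hli, hr.trans_le ?_⟩
  have hmem : x j.succ ∈ Γ.sphere j x := by
    intro i hi
    rw [hx.2 j.succ i (Γ.mem_pred.1 hi).2.symm]
  have hrad := ((mem_sphere_iff hp hli _).1 hmem).2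
  have hc : Γ.center j x ∈ affineSpan ℝ (x '' {i | i ∈ Γ.pred j}) := by
    have hsub : ∀ i ∈ Γ.pred j, x i ∈ affineSpan ℝ (x '' {i | i ∈ Γ.pred j}) := fun i hi =>
      subset_affineSpan ℝ _ ⟨i, hi, rfl⟩
    have hdir : Γ.relCenter j x ∈ (affineSpan ℝ (x '' {i | i ∈ Γ.pred j})).direction := by
      rw [relCenter, spanSol, synth_apply]
      refine Submodule.sum_mem _ fun i _ => Submodule.smul_mem _ _ ?_
      exact AffineSubspace.vsub_mem_direction (hsub _ (Finset.mem_of_mem_erase i.2))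
        (hsub _ (Γ.base_mem hp))
    have := AffineSubspace.vadd_mem_of_mem_direction hdir (hsub _ (Γ.base_mem hp))
    rw [vadd_eq_add, add_comm (Γ.relCenter j x)] at this
    exact this
  have hle : s ≤ ‖x j.succ - Γ.center j x‖ := by
    rw [← dist_eq_norm]
    exact hs'.trans (Metric.infDist_le_dist_of_mem hc)
  rw [← hrad]
  gcongr

/-! ### Smooth dependence of the placement on the predecessors -/

lemma contDiff_diffs : ContDiff ℝ ∞ (Γ.diffs j) := by
  unfold diffs; fun_prop

lemma contDiff_rhs : ContDiff ℝ ∞ (Γ.rhs j) := by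
  unfold rhs
  rw [contDiff_pi]
  intro i
  have : ContDiff ℝ ∞ fun x : Fin (n + 1) → Euc d => ‖x i - x (Γ.base j)‖ ^ 2 :=
    ContDiff.norm_sq ℝ (by fun_prop)
  exact ((this.add contDiff_const).sub contDiff_const).div_const 2

lemma contDiffAt_relCenter (hx : LinearIndependent ℝ (Γ.diffs j x)) :
    ContDiffAt ℝ ∞ (Γ.relCenter j) x := by
  have h1 := contDiffAt_spanSol hx (Γ.rhs j x)
  have h2 : ContDiffAt ℝ ∞ (fun x => (Γ.diffs j x, Γ.rhs j x)) x :=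
    (contDiff_diffs.prodMk contDiff_rhs).contDiffAt
  exact ContDiffAt.comp x h1 h2

lemma contDiffAt_center (hx : LinearIndependent ℝ (Γ.diffs j x)) :
    ContDiffAt ℝ ∞ (Γ.center j) x :=
  (contDiff_apply ℝ (Euc d) (Γ.base j)).contDiffAt.add (contDiffAt_relCenter hx)

lemma contDiffAt_radSq (hx : LinearIndependent ℝ (Γ.diffs j x)) :
    ContDiffAt ℝ ∞ (Γ.radSq j) x :=
  contDiffAt_const.sub ((contDiffAt_relCenter hx).norm_sq ℝ)

lemma contDiffAt_sqrt_radSq (hr : 0 ≤ r) (hx : x ∈ Γ.regular r j) :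
    ContDiffAt ℝ ∞ (fun x => Real.sqrt (Γ.radSq j x)) x :=
  (contDiffAt_radSq hx.1).sqrt (hr.trans_lt hx.2).ne'

lemma contDiffAt_normalProj_diffs (hx : LinearIndependent ℝ (Γ.diffs j x)) :
    ContDiffAt ℝ ∞ (fun x => normalProj (Γ.diffs j x)) x :=
  ContDiffAt.comp (g := normalProj) x (contDiffAt_normalProj hx) contDiff_diffs.contDiffAt

lemma isOpen_regular : IsOpen (Γ.regular r j) := by
  rw [isOpen_iff_mem_nhds]
  intro x hx
  have h1 : {x | LinearIndependent ℝ (Γ.diffs j x)} ∈ nhds x :=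
    (isOpen_setOfPred_linearIndependent.preimage (contDiff_diffs (Γ := Γ) (j := j)).continuous).mem_nhds
      hx.1
  have h2 : ∀ᶠ y in nhds x, r < Γ.radSq j y :=
    (contDiffAt_radSq hx.1).continuousAt.eventually_const_lt hx.2
  filter_upwards [h1, h2] with y hy1 hy2 using ⟨hy1, hy2⟩

open Classical in
lemma measurable_place (hr : 0 ≤ r) :
    Measurable fun p : (Fin (n + 1) → Euc d) × Euc d => Γ.place r j p.1 p.2 := by
  have hN : MeasurableSet (Γ.regular r j) := isOpen_regular.measurableSet
  have hN' : MeasurableSet (Γ.regular r j ×ˢ (Set.univ : Set (Euc d))) := hN.prod MeasurableSet.univ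
  have h1 : Measurable ((Γ.regular r j).piecewise (Γ.center j) 0) :=
    ContinuousOn.measurable_piecewise (fun x hx =>
      (contDiffAt_center hx.1).continuousAt.continuousWithinAt) continuousOn_const hN
  have h2 : Measurable ((Γ.regular r j).piecewise (fun x => Real.sqrt (Γ.radSq j x)) 0) :=
    ContinuousOn.measurable_piecewise (fun x hx =>
      (contDiffAt_sqrt_radSq hr hx).continuousAt.continuousWithinAt) continuousOn_const hN
  have h3 : Measurable ((Γ.regular r j ×ˢ (Set.univ : Set (Euc d))).piecewise
      (fun p => normalProj (Γ.diffs j p.1) p.2) 0) := by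
    refine ContinuousOn.measurable_piecewise (fun p hp => ?_) continuousOn_const hN'
    have hc : ContinuousAt (fun x => normalProj (Γ.diffs j x)) p.1 :=
      (contDiffAt_normalProj_diffs hp.1.1).continuousAt
    exact ((hc.comp continuousAt_fst).clm_apply continuousAt_snd).continuousWithinAt
  have h4 := (h1.comp measurable_fst).add
    ((h2.comp measurable_fst).smul (measurable_dir.comp h3))
  convert! h4 using 1
  funext ⟨x, g⟩
  by_cases hx : x ∈ Γ.regular r j
  · simp [place_of_mem hx, spherePoint, hx]
  · simp [place, hx]

/-- On average over the unit ball, the placement depends in a Lipschitz way on the predecessors,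
locally uniformly at regular configurations. -/
lemma exists_lintegral_place_sub_le (hr : 0 ≤ r) (hp : (Γ.pred j).Nonempty)
    (hd : (Γ.pred j).card + 1 ≤ d) (hx : x ∈ Γ.regular r j) :
    ∃ δ > 0, ∃ C : NNReal, ∀ y ∈ Metric.ball x δ, ∀ z ∈ Metric.ball x δ,
      (y ∈ Γ.regular r j ∧ z ∈ Γ.regular r j) ∧
      ∫⁻ g, ‖Γ.place r j y g - Γ.place r j z g‖ₑ ∂(ballMeasure d) ≤ C * edist y z := by
  obtain ⟨K₁, t₁, ht₁, hK₁⟩ := ((contDiffAt_center hx.1).of_le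
    (m := 1) (by simp)).exists_lipschitzOnWith
  obtain ⟨K₂, t₂, ht₂, hK₂⟩ := ((contDiffAt_sqrt_radSq hr hx).of_le
    (m := 1) (by simp)).exists_lipschitzOnWith
  obtain ⟨K₃, t₃, ht₃, hK₃⟩ := ((contDiffAt_normalProj_diffs hx.1).of_le
    (m := 1) (by simp)).exists_lipschitzOnWith
  have hN := isOpen_regular.mem_nhds hx
  obtain ⟨δ, hδ, hball⟩ := Metric.mem_nhds_iff.1
    (Filter.inter_mem (Filter.inter_mem ht₁ ht₂) (Filter.inter_mem ht₃ hN))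
  set ℓ := ‖Γ.len j (Γ.base j)‖₊ with hℓ
  refine ⟨δ, hδ, K₁ + K₂ + ℓ * 2 * K₃ * (projConst d).toNNReal, fun y hy z hz => ?_⟩
  obtain ⟨⟨hy1, hy2⟩, hy3, hyN⟩ := hball hy
  obtain ⟨⟨hz1, hz2⟩, hz3, hzN⟩ := hball hz
  refine ⟨⟨hyN, hzN⟩, ?_⟩
  have hpt : ∀ᵐ g ∂(ballMeasure d), ‖Γ.place r j y g - Γ.place r j z g‖ₑ ≤
      (K₁ + K₂ + ℓ * 2 * K₃ * ‖normalProj (Γ.diffs j y) g‖ₑ⁻¹) * edist y z := by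
    filter_upwards [ae_norm_le_one, ae_normalProj_diffs_ne_zero (x := y) hp hd] with g hg1 hg0
    rw [place_of_mem hyN, place_of_mem hzN]
    set p := normalProj (Γ.diffs j y) g with hpdef
    set q := normalProj (Γ.diffs j z) g with hqdef
    set ρ := Real.sqrt (Γ.radSq j y)
    set ρ' := Real.sqrt (Γ.radSq j z)
    have e : spherePoint (Γ.diffs j y) (Γ.center j y) ρ g
        - spherePoint (Γ.diffs j z) (Γ.center j z) ρ' g
        = (Γ.center j y - Γ.center j z) + (ρ - ρ') • dir p + ρ' • (dir p - dir q) := by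
      simp only [spherePoint, ← hpdef, ← hqdef]
      module
    have h1 : ‖Γ.center j y - Γ.center j z‖ₑ ≤ K₁ * edist y z := by
      rw [← edist_eq_enorm_sub]; exact hK₁ hy1 hz1
    have h2 : ‖(ρ - ρ') • dir p‖ₑ ≤ K₂ * edist y z := by
      calc ‖(ρ - ρ') • dir p‖ₑ = ‖ρ - ρ'‖ₑ * ‖dir p‖ₑ := enorm_smul _ _
        _ ≤ ‖ρ - ρ'‖ₑ * 1 := by
          gcongr
          rw [← ofReal_norm, norm_dir hg0, ENNReal.ofReal_one]
        _ ≤ _ := by rw [mul_one, ← edist_eq_enorm_sub]; exact hK₂ hy2 hz2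
    have h3 : ‖ρ' • (dir p - dir q)‖ₑ ≤ ℓ * 2 * K₃ * ‖p‖ₑ⁻¹ * edist y z := by
      have hρ'ℓ : ‖ρ'‖ₑ ≤ ℓ := by
        rw [hℓ, ← enorm_eq_nnnorm, ← ofReal_norm, ← ofReal_norm]
        refine ENNReal.ofReal_le_ofReal ?_
        rw [Real.norm_of_nonneg (Real.sqrt_nonneg _)]
        refine Real.sqrt_le_iff.2 ⟨norm_nonneg _, ?_⟩
        rw [Real.norm_eq_abs, sq_abs, radSq]
        linarith [sq_nonneg ‖Γ.relCenter j z‖]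
      have hdir : ‖dir p - dir q‖ₑ ≤ 2 * ‖p‖ₑ⁻¹ * ‖p - q‖ₑ := by
        rw [← ofReal_norm, ← ofReal_norm p, ← ofReal_norm (p - q),
          ← ENNReal.ofReal_inv_of_pos (norm_pos_iff.2 hg0),
          show (2 : ℝ≥0∞) * _ = ENNReal.ofReal 2 * _ by rw [ENNReal.ofReal_ofNat],
          ← ENNReal.ofReal_mul (by norm_num), ← ENNReal.ofReal_mul (by positivity)]
        exact ENNReal.ofReal_le_ofReal (norm_dir_sub_le hg0 q)
      have hpq : ‖p - q‖ₑ ≤ K₃ * edist y z := by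
        have hop : ‖p - q‖ₑ
            ≤ ‖normalProj (Γ.diffs j y) - normalProj (Γ.diffs j z)‖ₑ := by
          rw [← ofReal_norm, ← ofReal_norm]
          refine ENNReal.ofReal_le_ofReal ?_
          exact ((normalProj (Γ.diffs j y) - normalProj (Γ.diffs j z)).le_opNorm g).trans
            (mul_le_of_le_one_right (norm_nonneg _) hg1)
        refine hop.trans ?_
        rw [← edist_eq_enorm_sub]
        exact hK₃ hy3 hz3
      calc ‖ρ' • (dir p - dir q)‖ₑ = ‖ρ'‖ₑ * ‖dir p - dir q‖ₑ := enorm_smul _ _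
        _ ≤ ℓ * (2 * ‖p‖ₑ⁻¹ * (K₃ * edist y z)) := by
          gcongr
          exact hdir.trans (by gcongr)
        _ = _ := by ring
    rw [e]
    calc _ ≤ _ := enorm_add_le _ _
      _ ≤ _ := add_le_add_left (enorm_add_le _ _) _
      _ ≤ K₁ * edist y z + K₂ * edist y z + ℓ * 2 * K₃ * ‖p‖ₑ⁻¹ * edist y z := by gcongr
      _ = _ := by ring
  refine (lintegral_mono_ae hpt).trans ?_
  have hcont : Measurable fun g : Euc d => ‖normalProj (Γ.diffs j y) g‖ₑ⁻¹ := by fun_prop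
  rw [lintegral_mul_const _ (by fun_prop), lintegral_add_left measurable_const, lintegral_const,
    lintegral_const_mul _ hcont]
  have hproj := lintegral_inv_norm_normalProj_le (Γ.diffs j y)
    (by have := Γ.card_others hp; omega)
  push_cast
  rw [ENNReal.coe_toNNReal projConst_ne_top, measure_univ, mul_one]
  gcongr

end DistanceGraph

/-! ### Partial configurations -/

namespace DistanceGraph

open scoped InnerProductSpace ENNReal

variable {d n : ℕ} (Γ : DistanceGraph d n)

/-- Configurations of the vertices with index at most `j`, the others being placed at the origin. -/
def partialConfig (j : ℕ) : Set (Fin (n + 1) → Euc d) :=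
  {x | x 0 = 0 ∧ (∀ i : Fin (n + 1), j < i → x i = 0) ∧
    ∀ i i' : Fin (n + 1), (i : ℕ) ≤ j → (i' : ℕ) ≤ j → Γ.graph.Adj i i' →
      ‖x i - x i'‖ ^ 2 = ‖Γ.vertex i - Γ.vertex i'‖ ^ 2}

/-- The configurations in the support of the cutoffs. -/
def supportConfig (η : Fin n → Euc d → ℝ) : Set (Fin (n + 1) → Euc d) :=
  {x | x ∈ Γ.configSpace ∧ ∀ l : Fin n, x l.succ ∈ tsupport (η l)}

/-- The partial configurations that extend to a configuration in the support of the cutoffs. -/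
def extendable (η : Fin n → Euc d → ℝ) (j : ℕ) : Set (Fin (n + 1) → Euc d) :=
  {x | x ∈ Γ.partialConfig j ∧ ∃ x' ∈ Γ.supportConfig η, ∀ i : Fin (n + 1), (i : ℕ) ≤ j → x' i = x i}

/-- The configuration `x` with the vertex `j.succ` placed according to `g`. -/
noncomputable def extend (r : ℝ) (j : Fin n) (x : Fin (n + 1) → Euc d) (g : Euc d) :
    Fin (n + 1) → Euc d :=
  Function.update x j.succ (Γ.place r j x g)

/-- The standing assumptions: every vertex but the first has a predecessor and at most `d - 1` of
them, and configurations in the support of the cutoffs are regular with squared radii above `r`. -/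
structure Admissible (η : Fin n → Euc d → ℝ) (r : ℝ) : Prop where
  pos : 0 < r
  nonempty : ∀ j, (Γ.pred j).Nonempty
  card_lt : ∀ j, (Γ.pred j).card + 1 ≤ d
  cutoff : Γ.IsCutoff η
  regular : ∀ x ∈ Γ.supportConfig η, ∀ j, x ∈ Γ.regular r j

lemma exists_admissible {k : ℕ} (hd : k + 1 ≤ d) (hdeg : Γ.IsDegenerate k)
    (hpred : ∀ j : Fin n, (Γ.pred j).Nonempty) {η : Fin n → Euc d → ℝ} (hη : Γ.IsCutoff η) :
    ∃ r, Γ.Admissible η r := by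
  obtain ⟨s, hs, h⟩ := hη.radius
  refine ⟨s ^ 2 / 2, by positivity, hpred, fun j => ?_, hη, fun x hx j => ?_⟩
  · have := hdeg j; omega
  · obtain ⟨h1, h2⟩ := h x hx.1 hx.2 j
    exact mem_regular_of_config hs (half_lt_self (by positivity)) (hpred j) hx.1 h1 h2

variable {Γ} {η : Fin n → Euc d → ℝ} {r : ℝ} {x : Fin (n + 1) → Euc d}

lemma zero_mem_partialConfig : (0 : Fin (n + 1) → Euc d) ∈ Γ.partialConfig 0 := by
  refine ⟨rfl, fun _ _ => rfl, fun i i' hi hi' h => ?_⟩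
  have : i = i' := Fin.ext (by omega)
  exact absurd this h.ne

lemma update_mem_partialConfig {j : Fin n} (hx : x ∈ Γ.partialConfig j) {y : Euc d}
    (hy : y ∈ Γ.sphere j x) : Function.update x j.succ y ∈ Γ.partialConfig (j + 1) := by
  have hlt : ∀ i : Fin (n + 1), i ≠ j.succ → (i : ℕ) ≤ j + 1 → (i : ℕ) ≤ j := by
    intro i hne hle
    have : (i : ℕ) ≠ j + 1 := fun h => hne (Fin.ext (by simpa using h))
    omega
  have hs : ∀ i : Fin (n + 1), i ≠ j.succ → (i : ℕ) ≤ j + 1 → Γ.graph.Adj i j.succ →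
      ‖y - x i‖ ^ 2 = ‖Γ.vertex j.succ - Γ.vertex i‖ ^ 2 := by
    intro i hne hle hadj
    refine hy i (Γ.mem_pred.2 ⟨?_, hadj⟩)
    rw [Fin.lt_def, Fin.val_succ]
    have := hlt i hne hle
    omega
  refine ⟨?_, fun i hi => ?_, fun i i' hi hi' hadj => ?_⟩
  · rw [Function.update_of_ne (Fin.succ_ne_zero j).symm]; exact hx.1
  · have : i ≠ j.succ := by rintro rfl; simp at hi
    rw [Function.update_of_ne this]
    exact hx.2.1 i (by omega)
  · by_cases h : i = j.succ <;> by_cases h' : i' = j.succ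
    · exact absurd (h.trans h'.symm) hadj.ne
    · subst h
      rw [Function.update_self, Function.update_of_ne h']
      exact hs i' h' hi' hadj.symm
    · subst h'
      rw [Function.update_self, Function.update_of_ne h, norm_sub_rev, norm_sub_rev (Γ.vertex i)]
      exact hs i h hi hadj
    · rw [Function.update_of_ne h, Function.update_of_ne h']
      exact hx.2.2 i i' (hlt i h hi) (hlt i' h' hi') hadj

lemma ae_extend_mem (h : Γ.Admissible η r) {j : Fin n} (hx : x ∈ Γ.partialConfig j)
    (hxr : x ∈ Γ.regular r j) :
    ∀ᵐ g ∂(ballMeasure d), Γ.extend r j x g ∈ Γ.partialConfig (j + 1) := by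
  filter_upwards [ae_place_mem_sphere h.pos.le (h.nonempty j) (h.card_lt j) hxr] with g hg
  exact update_mem_partialConfig hx hg

lemma mem_extendable_of_update {j : Fin n} (hx : x ∈ Γ.partialConfig j) {y : Euc d}
    (hy : Function.update x j.succ y ∈ Γ.extendable η (j + 1)) : x ∈ Γ.extendable η j := by
  obtain ⟨-, x', hx', h⟩ := hy
  refine ⟨hx, x', hx', fun i hi => ?_⟩
  have hne : i ≠ j.succ := by rintro rfl; simp at hi
  rw [h i (by omega), Function.update_of_ne hne]

lemma mem_regular_of_extendable (h : Γ.Admissible η r) {j : Fin n} (hx : x ∈ Γ.extendable η j) :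
    x ∈ Γ.regular r j := by
  obtain ⟨-, x', hx', hxx'⟩ := hx
  refine (mem_regular_congr (h.nonempty j) fun i hi => ?_).1 (h.regular x' hx' j)
  have := (Γ.mem_pred.1 hi).1
  rw [Fin.lt_def, Fin.val_succ] at this
  exact hxx' i (by omega)

lemma configSpace_eq : Γ.configSpace = Γ.partialConfig n := by
  ext x
  constructor
  · rintro ⟨h0, h⟩
    exact ⟨h0, fun i hi => absurd i.2 (by omega), fun i i' _ _ hadj => h i i' hadj⟩
  · rintro ⟨h0, -, h⟩
    exact ⟨h0, fun i i' hadj => h i i' (by omega) (by omega) hadj⟩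

lemma isClosed_partialConfig (j : ℕ) : IsClosed (Γ.partialConfig j) := by
  have e : Γ.partialConfig j = {x | x 0 = 0} ∩ ((⋂ i : Fin (n + 1), {x | j < (i : ℕ) → x i = 0}) ∩
      ⋂ i : Fin (n + 1), ⋂ i' : Fin (n + 1), {x | (i : ℕ) ≤ j → (i' : ℕ) ≤ j → Γ.graph.Adj i i' →
        ‖x i - x i'‖ ^ 2 = ‖Γ.vertex i - Γ.vertex i'‖ ^ 2}) := by
    ext x; simp [partialConfig]
  rw [e]
  refine (isClosed_eq (continuous_apply 0) continuous_const).inter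
    ((isClosed_iInter fun i => ?_).inter (isClosed_iInter fun i => isClosed_iInter fun i' => ?_))
  · by_cases hi : j < (i : ℕ)
    · simpa [hi] using isClosed_eq (continuous_apply i) (continuous_const (y := (0 : Euc d)))
    · simp [hi]
  · by_cases h1 : (i : ℕ) ≤ j ∧ (i' : ℕ) ≤ j ∧ Γ.graph.Adj i i'
    · simp only [h1.1, h1.2.1, h1.2.2, forall_true_left]
      exact isClosed_eq (by fun_prop) continuous_const
    · have : {x : Fin (n + 1) → Euc d | (i : ℕ) ≤ j → (i' : ℕ) ≤ j → Γ.graph.Adj i i' →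
        ‖x i - x i'‖ ^ 2 = ‖Γ.vertex i - Γ.vertex i'‖ ^ 2} = Set.univ := by
        ext x; simp only [Set.mem_ofPred_eq, Set.mem_univ, iff_true]
        exact fun a b c => absurd ⟨a, b, c⟩ h1
      rw [this]
      exact isClosed_univ

/-- Partial configurations are bounded, each vertex having a predecessor at a fixed distance. -/
lemma exists_norm_le (hpred : ∀ j : Fin n, (Γ.pred j).Nonempty) :
    ∃ B, 0 ≤ B ∧ ∀ j, ∀ x ∈ Γ.partialConfig j, ‖x‖ ≤ B := by
  set A := ∑ i : Fin (n + 1), ∑ i' : Fin (n + 1), ‖Γ.vertex i - Γ.vertex i'‖ with hA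
  have hA0 : 0 ≤ A := by positivity
  have hle : ∀ i i', ‖Γ.vertex i - Γ.vertex i'‖ ≤ A := fun i i' =>
    (Finset.single_le_sum (f := fun i' => ‖Γ.vertex i - Γ.vertex i'‖)
      (fun _ _ => norm_nonneg _) (Finset.mem_univ i')).trans
    (Finset.single_le_sum (f := fun i => ∑ i', ‖Γ.vertex i - Γ.vertex i'‖)
      (fun _ _ => Finset.sum_nonneg fun _ _ => norm_nonneg _) (Finset.mem_univ i))
  refine ⟨n * A, by positivity, fun j x hx => ?_⟩
  have key : ∀ (k : ℕ) (i : Fin (n + 1)), (i : ℕ) = k → ‖x i‖ ≤ k * A := by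
    intro k
    induction k using Nat.strong_induction_on with
    | _ k ih =>
      intro i hi
      by_cases hj : j < (i : ℕ)
      · rw [hx.2.1 i hj, norm_zero]; positivity
      · rcases Fin.eq_zero_or_eq_succ i with h0 | ⟨l, hl⟩
        · rw [h0, hx.1, norm_zero]; positivity
        · obtain ⟨i', hi'⟩ := hpred l
          obtain ⟨hlt, hadj⟩ := Γ.mem_pred.1 hi'
          rw [← hl] at hlt hadj
          have hlt' : (i' : ℕ) < i := hlt
          have h1 := hx.2.2 i' i (by omega) (by omega) hadj
          have h2 : ‖x i' - x i‖ = ‖Γ.vertex i' - Γ.vertex i‖ := by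
            rwa [sq_eq_sq₀ (norm_nonneg _) (norm_nonneg _)] at h1
          have h3 := ih i' (by omega) i' rfl
          have h4 : ‖x i‖ ≤ ‖x i'‖ + ‖x i' - x i‖ := by
            have := norm_sub_le (x i') (x i' - x i)
            rwa [sub_sub_cancel] at this
          have h5 : ((i' : ℕ) : ℝ) + 1 ≤ k := by
            have : (i' : ℕ) + 1 ≤ k := by omega
            exact_mod_cast this
          rw [h2] at h4
          nlinarith [hle i' i]
  refine (pi_norm_le_iff_of_nonneg (by positivity)).2 fun i => (key i i rfl).trans ?_
  gcongr
  omega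

lemma isCompact_supportConfig (h : Γ.Admissible η r) : IsCompact (Γ.supportConfig η) := by
  obtain ⟨B, -, hB⟩ := exists_norm_le h.nonempty
  have hcl : IsClosed (Γ.supportConfig η) := by
    have e : Γ.supportConfig η = Γ.partialConfig n ∩
        ⋂ l : Fin n, (fun x : Fin (n + 1) → Euc d => x l.succ) ⁻¹' tsupport (η l) := by
      ext x; simp [supportConfig, configSpace_eq]
    rw [e]
    exact (isClosed_partialConfig n).inter
      (isClosed_iInter fun l => (isClosed_tsupport _).preimage (continuous_apply _))
  refine Metric.isCompact_of_isClosed_isBounded hcl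
    (Metric.isBounded_closedBall (x := (0 : Fin (n + 1) → Euc d)) (r := B) |>.subset fun x hx => ?_)
  rw [mem_closedBall_zero_iff]
  exact hB n x (configSpace_eq ▸ hx.1)

lemma isCompact_extendable (h : Γ.Admissible η r) (j : ℕ) : IsCompact (Γ.extendable η j) := by
  set tr : (Fin (n + 1) → Euc d) → Fin (n + 1) → Euc d :=
    fun x i => if (i : ℕ) ≤ j then x i else 0 with htr
  have hc : Continuous tr := by
    refine continuous_pi fun i => ?_
    by_cases hi : (i : ℕ) ≤ j
    · simpa [htr, hi] using continuous_apply i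
    · simpa [htr, hi] using continuous_const
  have e : Γ.extendable η j = tr '' Γ.supportConfig η := by
    ext x
    constructor
    · rintro ⟨hx, x', hx', hxx'⟩
      refine ⟨x', hx', funext fun i => ?_⟩
      by_cases hi : (i : ℕ) ≤ j
      · simp [htr, hi, hxx' i hi]
      · simp [htr, hi, hx.2.1 i (by omega)]
    · rintro ⟨x', hx', rfl⟩
      refine ⟨⟨?_, fun i hi => ?_, fun i i' hi hi' hadj => ?_⟩, x', hx', fun i hi => ?_⟩
      · simp [htr, hx'.1.1]
      · simp [htr, not_le.2 hi]
      · simpa [htr, hi, hi'] using hx'.1.2 i i' hadj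
      · simp [htr, hi]
  rw [e]
  exact (isCompact_supportConfig h).image hc

/-! ### Averages over the last vertices -/

/-- The product of the cutoffs of the first `j` placed vertices. -/
noncomputable def weight (η : Fin n → Euc d → ℝ) (j : ℕ) (x : Fin (n + 1) → Euc d) : ℝ :=
  ∏ l : Fin n, if (l : ℕ) < j then η l (x l.succ) else 1

lemma weight_update (j : Fin n) (y : Euc d) :
    weight η (j + 1) (Function.update x j.succ y) = weight η j x * η j y := by
  rw [weight, weight, ← Finset.mul_prod_erase _ _ (Finset.mem_univ j),
    ← Finset.mul_prod_erase (s := Finset.univ) (f := fun l : Fin n => if (l : ℕ) < j then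
      η l (x l.succ) else 1) (a := j) (Finset.mem_univ j)]
  simp only [lt_add_iff_pos_right, zero_lt_one, if_true, Function.update_self, lt_irrefl, if_false,
    one_mul]
  rw [mul_comm]
  congr 1
  refine Finset.prod_congr rfl fun l hl => ?_
  have hlj : l ≠ j := Finset.ne_of_mem_erase hl
  have hlj' : (l : ℕ) ≠ j := fun h => hlj (Fin.ext h)
  have hs : l.succ ≠ j.succ := fun h => hlj (Fin.succ_injective _ h)
  rw [Function.update_of_ne hs]
  have : ((l : ℕ) < j + 1) ↔ (l : ℕ) < j := by omega
  simp only [this]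

lemma weight_mem (hη : Γ.IsCutoff η) (j : ℕ) (x : Fin (n + 1) → Euc d) :
    0 ≤ weight η j x ∧ weight η j x ≤ 1 := by
  have h : ∀ l : Fin n, 0 ≤ (if (l : ℕ) < j then η l (x l.succ) else 1) ∧
      (if (l : ℕ) < j then η l (x l.succ) else 1) ≤ 1 := by
    intro l; split_ifs
    · exact hη.range l _
    · exact ⟨zero_le_one, le_rfl⟩
  exact ⟨Finset.prod_nonneg fun l _ => (h l).1, Finset.prod_le_one (fun l _ => (h l).1)
    fun l _ => (h l).2⟩

lemma mem_tsupport_of_weight_ne_zero {j : ℕ} (h : weight η j x ≠ 0) (l : Fin n) (hl : (l : ℕ) < j) :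
    x l.succ ∈ tsupport (η l) := by
  refine subset_tsupport _ fun h0 => h ?_
  exact Finset.prod_eq_zero (Finset.mem_univ l) (by rw [if_pos hl, h0])

lemma mem_extendable_of_weight_ne_zero (hx : x ∈ Γ.partialConfig n) (h : weight η n x ≠ 0) :
    x ∈ Γ.extendable η n :=
  ⟨hx, x, ⟨configSpace_eq ▸ hx, fun l => mem_tsupport_of_weight_ne_zero h l l.2⟩, fun _ _ => rfl⟩

variable (Γ r η) in
/-- The average of `F`, weighted by all cutoffs, over the positions of the listed vertices; it
vanishes when one of the vertices would have to be placed at an irregular configuration. -/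
noncomputable def tail (F : (Fin (n + 1) → Euc d) → ℝ) : List (Fin n) → (Fin (n + 1) → Euc d) → ℝ
  | [], x => weight η n x * F x
  | j :: js, x => (Γ.regular r j).indicator
      (fun x => ∫ g, tail F js (Γ.extend r j x g) ∂(ballMeasure d)) x

variable (Γ r η) in
/-- `tail` for the vertices with index larger than `j`. -/
noncomputable def tailAt (F : (Fin (n + 1) → Euc d) → ℝ) (j : ℕ) : (Fin (n + 1) → Euc d) → ℝ :=
  Γ.tail η r F ((List.finRange n).drop j)

lemma drop_finRange (j : Fin n) :
    (List.finRange n).drop j = j :: (List.finRange n).drop (j + 1) := by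
  rw [List.drop_eq_getElem_cons (by simp)]
  simp

lemma tailAt_last (F : (Fin (n + 1) → Euc d) → ℝ) (x : Fin (n + 1) → Euc d) :
    Γ.tailAt η r F n x = weight η n x * F x := by
  rw [tailAt, List.drop_eq_nil_of_le (by simp), tail]

lemma tailAt_eq (F : (Fin (n + 1) → Euc d) → ℝ) (j : Fin n) (x : Fin (n + 1) → Euc d) :
    Γ.tailAt η r F j x = (Γ.regular r j).indicator
      (fun x => ∫ g, Γ.tailAt η r F (j + 1) (Γ.extend r j x g) ∂(ballMeasure d)) x := by
  rw [tailAt, drop_finRange, tail]; rfl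

lemma tailAt_of_mem (F : (Fin (n + 1) → Euc d) → ℝ) {j : Fin n} (hx : x ∈ Γ.regular r j) :
    Γ.tailAt η r F j x
      = ∫ g, Γ.tailAt η r F (j + 1) (Γ.extend r j x g) ∂(ballMeasure d) := by
  rw [tailAt_eq, Set.indicator_of_mem hx]

lemma tailAt_of_notMem (F : (Fin (n + 1) → Euc d) → ℝ) {j : Fin n} (hx : x ∉ Γ.regular r j) :
    Γ.tailAt η r F j x = 0 := by
  rw [tailAt_eq, Set.indicator_of_notMem hx]

lemma backward_induction {P : ℕ → Prop} (hn : P n) (hs : ∀ j : Fin n, P (j + 1) → P j) :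
    ∀ j ≤ n, P j := fun _ hj =>
  Nat.decreasingInduction (motive := fun j _ => P j) (fun k hk h => hs ⟨k, hk⟩ h) hn hj

/-- The averages live on the compact set of extendable configurations. -/
lemma tailAt_eq_zero (h : Γ.Admissible η r) (F : (Fin (n + 1) → Euc d) → ℝ) {j : ℕ} (hj : j ≤ n)
    (hx : x ∈ Γ.partialConfig j) (hxe : x ∉ Γ.extendable η j) : Γ.tailAt η r F j x = 0 := by
  revert x
  refine backward_induction (P := fun j => ∀ {x}, x ∈ Γ.partialConfig j → x ∉ Γ.extendable η j →
    Γ.tailAt η r F j x = 0) ?_ ?_ j hj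
  · intro x hx hxe
    rw [tailAt_last]
    by_contra h0
    exact hxe (mem_extendable_of_weight_ne_zero hx (left_ne_zero_of_mul h0))
  · intro j ih x hx hxe
    by_cases hxr : x ∈ Γ.regular r j
    · rw [tailAt_of_mem F hxr]
      refine integral_eq_zero_of_ae ?_
      filter_upwards [ae_extend_mem h hx hxr] with g hg
      exact ih hg fun he => hxe (mem_extendable_of_update hx he)
    · exact tailAt_of_notMem F hxr

/-- A function of the vertices with index at most `j` factors out of `tailAt`. -/
lemma tailAt_mul {a F : (Fin (n + 1) → Euc d) → ℝ} {m : ℕ}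
    (ha : ∀ (l : Fin n), m ≤ l → ∀ x y, a (Function.update x l.succ y) = a x) {j : ℕ} (hm : m ≤ j)
    (hj : j ≤ n) (x : Fin (n + 1) → Euc d) :
    Γ.tailAt η r (fun x => a x * F x) j x = a x * Γ.tailAt η r F j x := by
  revert hm x
  refine backward_induction (P := fun j => m ≤ j → ∀ x,
    Γ.tailAt η r (fun x => a x * F x) j x = a x * Γ.tailAt η r F j x) ?_ ?_ j hj
  · intro _ x
    rw [tailAt_last, tailAt_last]; ring
  · intro j ih hm x
    by_cases hxr : x ∈ Γ.regular r j
    · rw [tailAt_of_mem _ hxr, tailAt_of_mem _ hxr, ← integral_const_mul]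
      refine integral_congr_ae (Filter.Eventually.of_forall fun g => ?_)
      simp only
      rw [ih (by omega), extend, ha j hm]
    · rw [tailAt_of_notMem _ hxr, tailAt_of_notMem _ hxr, mul_zero]

lemma continuous_cutoff (hη : Γ.IsCutoff η) (l : Fin n) : Continuous (η l) :=
  (hη.smooth l).continuous

lemma continuous_weight (hη : Γ.IsCutoff η) (j : ℕ) : Continuous (weight η j) := by
  refine continuous_finsetProd _ fun l _ => ?_
  split_ifs
  · exact (continuous_cutoff hη l).comp (continuous_apply _)
  · exact continuous_const

lemma measurable_extend (hr : 0 ≤ r) (j : Fin n) :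
    Measurable fun p : (Fin (n + 1) → Euc d) × Euc d => Γ.extend r j p.1 p.2 := by
  refine measurable_pi_lambda _ fun i => ?_
  by_cases hi : i = j.succ
  · subst hi
    simpa [extend] using measurable_place hr
  · simp only [extend, Function.update_of_ne hi]
    exact (measurable_pi_apply i).comp measurable_fst

lemma measurable_tailAt (h : Γ.Admissible η r) {α : Type*} [MeasurableSpace α]
    {F : α → (Fin (n + 1) → Euc d) → ℝ} (hF : Measurable (Function.uncurry F)) {j : ℕ} (hj : j ≤ n) :
    Measurable fun p : α × (Fin (n + 1) → Euc d) => Γ.tailAt η r (F p.1) j p.2 := by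
  refine backward_induction (P := fun j =>
    Measurable fun p : α × (Fin (n + 1) → Euc d) => Γ.tailAt η r (F p.1) j p.2) ?_ ?_ j hj
  · simp only [tailAt_last]
    exact ((continuous_weight h.cutoff n).measurable.comp measurable_snd).mul hF
  · intro j ih
    have h1 : Measurable fun p : (α × (Fin (n + 1) → Euc d)) × Euc d =>
        Γ.tailAt η r (F p.1.1) (j + 1) (Γ.extend r j p.1.2 p.2) :=
      ih.comp ((measurable_fst.comp measurable_fst).prodMk
        ((measurable_extend h.pos.le j).comp
          ((measurable_snd.comp measurable_fst).prodMk measurable_snd)))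
    have h2 : Measurable fun p : α × (Fin (n + 1) → Euc d) =>
        ∫ g, Γ.tailAt η r (F p.1) (j + 1) (Γ.extend r j p.2 g) ∂(ballMeasure d) :=
      (h1.stronglyMeasurable.integral_prod_right (ν := ballMeasure d)).measurable
    have h3 := h2.indicator (measurable_snd isOpen_regular.measurableSet :
      MeasurableSet (Prod.snd ⁻¹' Γ.regular r j : Set (α × (Fin (n + 1) → Euc d))))
    convert! h3 using 1
    funext p
    rw [tailAt_eq]
    rfl

lemma measurable_tailAt' (h : Γ.Admissible η r) {F : (Fin (n + 1) → Euc d) → ℝ} (hF : Measurable F)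
    {j : ℕ} (hj : j ≤ n) : Measurable (Γ.tailAt η r F j) :=
  (measurable_tailAt h (α := Unit) (F := fun _ => F) (hF.comp measurable_snd) hj).comp
    (measurable_const (a := ()) |>.prodMk measurable_id)

lemma abs_tailAt_le (h : Γ.Admissible η r) {F : (Fin (n + 1) → Euc d) → ℝ} (hF : ∀ x, |F x| ≤ 1)
    {j : ℕ} (hj : j ≤ n) (x : Fin (n + 1) → Euc d) : |Γ.tailAt η r F j x| ≤ 1 := by
  revert x
  refine backward_induction (P := fun j => ∀ x, |Γ.tailAt η r F j x| ≤ 1) ?_ ?_ j hj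
  · intro x
    have := weight_mem h.cutoff n x
    rw [tailAt_last, abs_mul, abs_of_nonneg this.1]
    exact mul_le_one₀ this.2 (abs_nonneg _) (hF x)
  · intro j ih x
    by_cases hxr : x ∈ Γ.regular r j
    · rw [tailAt_of_mem _ hxr, ← Real.norm_eq_abs]
      have := norm_integral_le_of_norm_le_const (μ := ballMeasure d)
        (f := fun g => Γ.tailAt η r F (j + 1) (Γ.extend r j x g)) (C := 1)
        (Filter.Eventually.of_forall fun g => ih _)
      simpa using this
    · rw [tailAt_of_notMem _ hxr, abs_zero]; exact zero_le_one

lemma tailAt_nonneg (h : Γ.Admissible η r) {F : (Fin (n + 1) → Euc d) → ℝ} (hF : ∀ x, 0 ≤ F x)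
    {j : ℕ} (hj : j ≤ n) (x : Fin (n + 1) → Euc d) : 0 ≤ Γ.tailAt η r F j x := by
  revert x
  refine backward_induction (P := fun j => ∀ x, 0 ≤ Γ.tailAt η r F j x) ?_ ?_ j hj
  · intro x
    rw [tailAt_last]
    exact mul_nonneg (weight_mem h.cutoff n x).1 (hF x)
  · intro j ih x
    rw [tailAt_eq]
    exact Set.indicator_nonneg (fun x _ => integral_nonneg fun g => ih _) x

/-! ### Comparison with the iterated integral -/

lemma iteratedIntegral_drop (hη : Γ.IsCutoff η) (F : (Fin (n + 1) → Euc d) → ℝ) (j : Fin n) :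
    Γ.iteratedIntegral η F ((List.finRange n).drop j) x
      = ∫ y, η j y * Γ.iteratedIntegral η F ((List.finRange n).drop (j + 1))
          (Function.update x j.succ y) ∂(Γ.surfaceMeasure j x) := by
  rw [drop_finRange, iteratedIntegral, localMeasure, integral_withDensity_eq_integral_toReal_smul
    ((continuous_cutoff hη j).measurable.ennreal_ofReal)
    (Filter.Eventually.of_forall fun _ => ENNReal.ofReal_lt_top)]
  simp only [ENNReal.toReal_ofReal (hη.range j _).1, smul_eq_mul]

lemma weight_mul_iteratedIntegral_eq (hη : Γ.IsCutoff η) (F : (Fin (n + 1) → Euc d) → ℝ)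
    (j : Fin n) :
    weight η j x * Γ.iteratedIntegral η F ((List.finRange n).drop j) x
      = ∫ y, weight η (j + 1) (Function.update x j.succ y) *
          Γ.iteratedIntegral η F ((List.finRange n).drop (j + 1))
          (Function.update x j.succ y) ∂(Γ.surfaceMeasure j x) := by
  rw [iteratedIntegral_drop hη, ← integral_const_mul]
  refine integral_congr_ae (Filter.Eventually.of_forall fun y => ?_)
  simp only [weight_update, mul_assoc]

lemma ae_update_mem {j : Fin n} (hx : x ∈ Γ.partialConfig j) :
    ∀ᵐ y ∂(Γ.surfaceMeasure j x), Function.update x j.succ y ∈ Γ.partialConfig (j + 1) := by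
  have hcl : IsClosed (Γ.sphere j x) := by
    have : Γ.sphere j x = ⋂ i ∈ Γ.pred j,
        {y | ‖y - x i‖ ^ 2 = ‖Γ.vertex j.succ - Γ.vertex i‖ ^ 2} := by
      ext y; simp [sphere]
    rw [this]
    exact isClosed_biInter fun i _ => isClosed_eq (by fun_prop) continuous_const
  filter_upwards [ProbabilityTheory.ae_cond_mem (μ :=
    Measure.hausdorffMeasure ((d : ℝ) - ((Γ.pred j).card : ℝ))) hcl.measurableSet] with y hy
  exact update_mem_partialConfig hx hy

/-- The weight and the iterated integral together vanish at configurations that cannot be extended into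
the support of the cutoffs. In particular the surface measures at irregular configurations, about which
nothing is known, do not matter. -/
lemma weight_mul_iteratedIntegral_eq_zero (hη : Γ.IsCutoff η) (F : (Fin (n + 1) → Euc d) → ℝ)
    {j : ℕ} (hj : j ≤ n) (hx : x ∈ Γ.partialConfig j) (hxe : x ∉ Γ.extendable η j) :
    weight η j x * Γ.iteratedIntegral η F ((List.finRange n).drop j) x = 0 := by
  revert x
  refine backward_induction (P := fun j => ∀ {x}, x ∈ Γ.partialConfig j → x ∉ Γ.extendable η j →
    weight η j x * Γ.iteratedIntegral η F ((List.finRange n).drop j) x = 0) ?_ ?_ j hj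
  · intro x hx hxe
    by_contra h0
    exact hxe (mem_extendable_of_weight_ne_zero hx (left_ne_zero_of_mul h0))
  · intro j ih x hx hxe
    rw [weight_mul_iteratedIntegral_eq hη]
    refine integral_eq_zero_of_ae ?_
    filter_upwards [ae_update_mem hx] with y hy
    exact ih hy fun he => hxe (mem_extendable_of_update hx he)

lemma measurable_place' (hr : 0 ≤ r) {j : Fin n} : Measurable (Γ.place r j x) := by
  have h1 : Measurable fun g : Euc d => (x, g) := measurable_prodMk_left
  have h2 : Measurable ((fun p : (Fin (n + 1) → Euc d) × Euc d => Γ.place r j p.1 p.2) ∘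
      fun g : Euc d => (x, g)) := (measurable_place hr).comp h1
  have h3 : ((fun p : (Fin (n + 1) → Euc d) × Euc d => Γ.place r j p.1 p.2) ∘
      fun g : Euc d => (x, g)) = Γ.place r j x := rfl
  rwa [h3] at h2

lemma measurable_tailAt_update (h : Γ.Admissible η r) {G : (Fin (n + 1) → Euc d) → ℝ}
    (hG : Measurable G) {j : Fin n} :
    Measurable fun y => Γ.tailAt η r G (j + 1) (Function.update x j.succ y) := by
  have h1 : Measurable fun y : Euc d => Function.update x j.succ y := measurable_update x
  have h2 : Measurable (Γ.tailAt η r G (j + 1)) := measurable_tailAt' h hG j.2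
  exact h2.comp h1

/-- Where `tailAt` of a nonnegative bounded function vanishes, so it does at almost all extensions. -/
lemma ae_tailAt_update_eq_zero (h : Γ.Admissible η r) {G : (Fin (n + 1) → Euc d) → ℝ}
    (hG : Measurable G) (hG0 : ∀ x, 0 ≤ G x) (hG1 : ∀ x, |G x| ≤ 1) {j : Fin n}
    (hxr : x ∈ Γ.regular r j) (hx0 : Γ.tailAt η r G j x = 0) :
    ∀ᵐ y ∂(Γ.surfaceMeasure j x), Γ.tailAt η r G (j + 1) (Function.update x j.succ y) = 0 := by
  have hpl : Measurable (Γ.place r j x) := measurable_place' h.pos.le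
  have hm : Measurable fun y => Γ.tailAt η r G (j + 1) (Function.update x j.succ y) :=
    measurable_tailAt_update h hG
  rw [surfaceMeasure_eq_map h.pos.le (h.nonempty j) (h.card_lt j) hxr,
    ae_map_iff hpl.aemeasurable (measurableSet_eq_fun hm measurable_const)]
  have hint : Integrable (fun g => Γ.tailAt η r G (j + 1) (Γ.extend r j x g)) (ballMeasure d) :=
    Integrable.of_bound (C := 1) (hm.comp hpl).aestronglyMeasurable
      (Filter.Eventually.of_forall fun g => abs_tailAt_le h hG1 j.2 _)
  rw [tailAt_of_mem _ hxr] at hx0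
  have h0 := (integral_eq_zero_iff_of_nonneg (fun g => tailAt_nonneg h hG0 j.2 _) hint).1 hx0
  filter_upwards [h0] with g hg using hg

/-- The iterated integral of `F`, with the weight of the vertices already placed, agrees with the
average `tailAt` of a measurable `F'` at configurations whose extensions almost surely avoid a
measurable set outside of which `F = F'`. -/
lemma weight_mul_iteratedIntegral (h : Γ.Admissible η r) {F F' : (Fin (n + 1) → Euc d) → ℝ}
    (hF' : Measurable F') {N : Set (Fin (n + 1) → Euc d)} (hN : MeasurableSet N)
    (hFF' : ∀ x ∉ N, F x = F' x) {j : ℕ} (hj : j ≤ n) (hx : x ∈ Γ.partialConfig j)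
    (hx0 : Γ.tailAt η r (N.indicator fun _ => 1) j x = 0) :
    weight η j x * Γ.iteratedIntegral η F ((List.finRange n).drop j) x = Γ.tailAt η r F' j x := by
  have hNm : Measurable (N.indicator fun _ => (1 : ℝ)) := measurable_const.indicator hN
  have hN0 : ∀ x, 0 ≤ N.indicator (fun _ => (1 : ℝ)) x := fun x =>
    Set.indicator_nonneg (fun _ _ => zero_le_one) x
  have hN1 : ∀ x, |N.indicator (fun _ => (1 : ℝ)) x| ≤ 1 := fun x => by
    rw [abs_of_nonneg (hN0 x)]
    exact Set.indicator_le_self' (fun _ _ => zero_le_one) x |>.trans le_rfl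
  revert x
  refine backward_induction (P := fun j => ∀ {x}, x ∈ Γ.partialConfig j →
    Γ.tailAt η r (N.indicator fun _ => 1) j x = 0 →
    weight η j x * Γ.iteratedIntegral η F ((List.finRange n).drop j) x = Γ.tailAt η r F' j x)
    ?_ ?_ j hj
  · intro x hx hx0
    rw [tailAt_last] at hx0 ⊢
    rw [List.drop_eq_nil_of_le (by simp), iteratedIntegral]
    by_cases hxN : x ∈ N
    · rw [Set.indicator_of_mem hxN, mul_one] at hx0
      rw [hx0, zero_mul, zero_mul]
    · rw [hFF' x hxN]
  · intro j ih x hx hx0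
    by_cases hxr : x ∈ Γ.regular r j
    · have hpl : Measurable (Γ.place r j x) := measurable_place' h.pos.le
      have hm : Measurable fun y => Γ.tailAt η r F' (j + 1) (Function.update x j.succ y) :=
        measurable_tailAt_update h hF'
      have h0 := ae_tailAt_update_eq_zero h hNm hN0 hN1 hxr hx0
      rw [weight_mul_iteratedIntegral_eq h.cutoff, tailAt_of_mem _ hxr]
      trans ∫ y, Γ.tailAt η r F' (j + 1) (Function.update x j.succ y) ∂(Γ.surfaceMeasure j x)
      · refine integral_congr_ae ?_
        filter_upwards [h0, ae_update_mem hx] with y hy hy'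
        exact ih hy' hy
      · rw [surfaceMeasure_eq_map h.pos.le (h.nonempty j) (h.card_lt j) hxr,
          integral_map hpl.aemeasurable hm.aestronglyMeasurable]
        rfl
    · rw [tailAt_of_notMem _ hxr]
      exact weight_mul_iteratedIntegral_eq_zero h.cutoff F j.2.le hx
        fun he => hxr (mem_regular_of_extendable h he)

end DistanceGraph

/-! ### The distribution of the first vertices -/

namespace DistanceGraph

open scoped InnerProductSpace ENNReal

variable {d n : ℕ} (Γ : DistanceGraph d n)

/-- The distribution of the configuration obtained by placing the first `j` vertices one after the
other at random, stopping when an irregular configuration is met. -/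
noncomputable def law (r : ℝ) : ℕ → Measure (Fin (n + 1) → Euc d)
  | 0 => Measure.dirac 0
  | j + 1 => if h : j < n then
      (((law r j).restrict (Γ.regular r ⟨j, h⟩)).prod (ballMeasure d)).map
        fun p => Γ.extend r ⟨j, h⟩ p.1 p.2
    else law r j

variable {Γ} {η : Fin n → Euc d → ℝ} {r : ℝ} {x : Fin (n + 1) → Euc d}

lemma law_succ (j : Fin n) : Γ.law r (j + 1) =
    (((Γ.law r j).restrict (Γ.regular r j)).prod (ballMeasure d)).map
      fun p => Γ.extend r j p.1 p.2 := by
  rw [law, dif_pos j.2]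

instance isFiniteMeasure_law (j : ℕ) : IsFiniteMeasure (Γ.law r j) := by
  induction j with
  | zero => rw [law]; infer_instance
  | succ j ih =>
    rw [law]
    split_ifs <;> infer_instance

lemma forward_induction {P : ℕ → Prop} (h0 : P 0) (hs : ∀ j : Fin n, P j → P (j + 1)) :
    ∀ j ≤ n, P j := by
  intro j
  induction j with
  | zero => exact fun _ => h0
  | succ j ih => exact fun hj => hs ⟨j, hj⟩ (ih (by omega))

lemma law_univ_le (hr : 0 ≤ r) {j : ℕ} (hj : j ≤ n) : Γ.law r j Set.univ ≤ 1 := by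
  refine forward_induction (P := fun j => Γ.law r j Set.univ ≤ 1) ?_ ?_ j hj
  · rw [law]; simp
  · intro j ih
    rw [law_succ, Measure.map_apply (measurable_extend hr j) MeasurableSet.univ, Set.preimage_univ,
      ← Set.univ_prod_univ, Measure.prod_prod, measure_univ (μ := ballMeasure d), mul_one]
    exact (Measure.restrict_apply_le _ _).trans ih

lemma ae_law_mem_partialConfig (h : Γ.Admissible η r) {j : ℕ} (hj : j ≤ n) :
    ∀ᵐ x ∂(Γ.law r j), x ∈ Γ.partialConfig j := by
  refine forward_induction (P := fun j => ∀ᵐ x ∂(Γ.law r j), x ∈ Γ.partialConfig j) ?_ ?_ j hj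
  · rw [law]
    exact (ae_dirac_iff (p := fun x => x ∈ Γ.partialConfig 0)
      (isClosed_partialConfig 0).measurableSet).2 zero_mem_partialConfig
  · intro j ih
    have hm := measurable_extend (Γ := Γ) h.pos.le j
    have hms : MeasurableSet {x | x ∈ Γ.partialConfig (j + 1)} :=
      (isClosed_partialConfig _).measurableSet
    rw [law_succ, ae_map_iff hm.aemeasurable hms]
    refine (Measure.ae_prod_iff_ae_ae (p := fun p => Γ.extend r j p.1 p.2 ∈
      Γ.partialConfig (j + 1)) (hm hms)).2 ?_
    filter_upwards [ae_restrict_of_ae ih, ae_restrict_mem isOpen_regular.measurableSet]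
      with x hx hxr
    exact ae_extend_mem h hx hxr

lemma extend_map (R : Euc d ≃ₗᵢ[ℝ] Euc d) (j : Fin n) (g : Euc d) :
    Γ.extend r j (fun i => R (x i)) (R g) = fun i => R (Γ.extend r j x g i) := by
  funext i
  by_cases hi : i = j.succ
  · subst hi; simp [extend, place_map]
  · simp [extend, Function.update_of_ne hi]

lemma measurable_map_config (R : Euc d ≃ₗᵢ[ℝ] Euc d) :
    Measurable fun (x : Fin (n + 1) → Euc d) i => R (x i) :=
  measurable_pi_lambda _ fun i => R.continuous.measurable.comp (measurable_pi_apply i)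

lemma measurePreserving_restrict_regular (R : Euc d ≃ₗᵢ[ℝ] Euc d) {j : Fin n}
    (h : MeasurePreserving (fun (x : Fin (n + 1) → Euc d) i => R (x i)) (Γ.law r j) (Γ.law r j)) :
    MeasurePreserving (fun (x : Fin (n + 1) → Euc d) i => R (x i))
      ((Γ.law r j).restrict (Γ.regular r j)) ((Γ.law r j).restrict (Γ.regular r j)) := by
  have := h.restrict_preimage (isOpen_regular (Γ := Γ) (r := r) (j := j)).measurableSet
  have e : (fun (x : Fin (n + 1) → Euc d) i => R (x i)) ⁻¹' Γ.regular r j = Γ.regular r j := by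
    ext x; exact map_mem_regular R
  rwa [e] at this

/-- The distribution is invariant under rotations. -/
lemma measurePreserving_law (hr : 0 ≤ r) (R : Euc d ≃ₗᵢ[ℝ] Euc d) {j : ℕ} (hj : j ≤ n) :
    MeasurePreserving (fun (x : Fin (n + 1) → Euc d) i => R (x i)) (Γ.law r j) (Γ.law r j) := by
  refine forward_induction (P := fun j => MeasurePreserving
    (fun (x : Fin (n + 1) → Euc d) i => R (x i)) (Γ.law r j) (Γ.law r j)) ?_ ?_ j hj
  · refine ⟨measurable_map_config R, ?_⟩
    rw [law, Measure.map_dirac' (measurable_map_config R)]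
    congr 1
    funext i; simp
  · intro j ih
    have hp := (measurePreserving_restrict_regular R ih).prod (measurePreserving_ballMeasure R)
    have hm := measurable_extend (Γ := Γ) hr j
    refine ⟨measurable_map_config R, ?_⟩
    rw [law_succ, Measure.map_map (measurable_map_config R) hm]
    nth_rewrite 2 [← hp.map_eq]
    rw [Measure.map_map hm hp.measurable]
    congr 1
    funext p
    exact (extend_map R j p.2).symm

/-- Averaging over all vertices at once is the same as averaging over the first `j` and then over the
others. -/
lemma integral_tailAt_law (h : Γ.Admissible η r) {F : (Fin (n + 1) → Euc d) → ℝ}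
    (hF : Measurable F) (hF1 : ∀ x, |F x| ≤ 1) {j : ℕ} (hj : j ≤ n) :
    ∫ x, Γ.tailAt η r F j x ∂(Γ.law r j) = Γ.tailAt η r F 0 0 := by
  refine forward_induction (P := fun j =>
    ∫ x, Γ.tailAt η r F j x ∂(Γ.law r j) = Γ.tailAt η r F 0 0) ?_ ?_ j hj
  · rw [law, integral_dirac' _ _ (measurable_tailAt' h hF (Nat.zero_le n)).stronglyMeasurable]
  · intro j ih
    have hm := measurable_extend (Γ := Γ) h.pos.le j
    have hT := measurable_tailAt' h hF j.2
    rw [← ih, law_succ, integral_map hm.aemeasurable hT.aestronglyMeasurable, integral_prod]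
    · rw [← integral_indicator isOpen_regular.measurableSet]
      refine integral_congr_ae (Filter.Eventually.of_forall fun x => ?_)
      simp only
      rw [tailAt_eq]
    · exact Integrable.of_bound (C := 1) (hT.comp hm).aestronglyMeasurable
        (Filter.Eventually.of_forall fun x => abs_tailAt_le h hF1 j.2 _)

end DistanceGraph

/-! ### Regularity of the averages -/

open scoped ENNReal in
lemma enorm_prod_sub_prod_le {ι : Type*} (s : Finset ι) (a b : ι → ℝ) (ha : ∀ i ∈ s, |a i| ≤ 1)
    (hb : ∀ i ∈ s, |b i| ≤ 1) : ‖∏ i ∈ s, a i - ∏ i ∈ s, b i‖ₑ ≤ ∑ i ∈ s, ‖a i - b i‖ₑ := by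
  classical
  have key : ∀ s : Finset ι, (∀ i ∈ s, |a i| ≤ 1) → (∀ i ∈ s, |b i| ≤ 1) →
      |∏ i ∈ s, a i - ∏ i ∈ s, b i| ≤ ∑ i ∈ s, |a i - b i| := by
    intro s
    induction s using Finset.induction_on with
    | empty => simp
    | insert i s hi ih =>
      intro ha hb
      rw [Finset.prod_insert hi, Finset.prod_insert hi, Finset.sum_insert hi]
      have h1 := ih (fun i hi => ha i (Finset.mem_insert_of_mem hi))
        (fun i hi => hb i (Finset.mem_insert_of_mem hi))
      have h2 : |∏ i ∈ s, a i| ≤ 1 := by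
        rw [Finset.abs_prod]
        exact Finset.prod_le_one (fun _ _ => abs_nonneg _)
          fun i hi => ha i (Finset.mem_insert_of_mem hi)
      have e : a i * ∏ i ∈ s, a i - b i * ∏ i ∈ s, b i
          = (a i - b i) * ∏ i ∈ s, a i + b i * (∏ i ∈ s, a i - ∏ i ∈ s, b i) := by ring
      rw [e]
      refine (abs_add_le _ _).trans ?_
      rw [abs_mul, abs_mul]
      have h3 := hb i (Finset.mem_insert_self _ _)
      nlinarith [abs_nonneg (a i - b i), abs_nonneg (∏ i ∈ s, a i - ∏ i ∈ s, b i)]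
  have := key s ha hb
  simp only [← ofReal_norm, Real.norm_eq_abs]
  rw [← ENNReal.ofReal_sum_of_nonneg fun _ _ => abs_nonneg _]
  exact ENNReal.ofReal_le_ofReal this

namespace DistanceGraph

open scoped InnerProductSpace ENNReal

variable {d n : ℕ} {Γ : DistanceGraph d n} {η : Fin n → Euc d → ℝ} {r : ℝ}

lemma exists_enorm_weight_sub_le (hη : Γ.IsCutoff η) (j : ℕ) :
    ∃ C : NNReal, ∀ x z : Fin (n + 1) → Euc d, ‖weight η j x - weight η j z‖ₑ ≤ C * edist x z := by
  have hl : ∀ l : Fin n, ∃ C : NNReal, LipschitzWith C (η l) := fun l =>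
    (hη.smooth l).lipschitzWith_of_hasCompactSupport (hη.compact l) (by simp)
  choose K hK using hl
  refine ⟨∑ l, K l, fun x z => ?_⟩
  have h1 : ∀ (x : Fin (n + 1) → Euc d) (l : Fin n),
      |if (l : ℕ) < j then η l (x l.succ) else 1| ≤ 1 := by
    intro x l; split_ifs
    · rw [abs_of_nonneg (hη.range l _).1]; exact (hη.range l _).2
    · simp
  refine (enorm_prod_sub_prod_le _ _ _ (fun l _ => h1 x l) (fun l _ => h1 z l)).trans ?_
  push_cast
  rw [Finset.sum_mul]
  refine Finset.sum_le_sum fun l _ => ?_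
  split_ifs
  · rw [← edist_eq_enorm_sub]
    exact (hK l _ _).trans (by gcongr; exact edist_le_pi_edist x z _)
  · simp

/-- A bound for the mean over a parameter passes to the averages, by Tonelli's theorem. -/
lemma lintegral_enorm_tailAt_le (h : Γ.Admissible η r) {α : Type*} [MeasurableSpace α]
    {ν : Measure α} [SFinite ν] {F : α → (Fin (n + 1) → Euc d) → ℝ}
    (hF : Measurable (Function.uncurry F)) {C : ℝ≥0∞} (hC : ∀ x, ∫⁻ u, ‖F u x‖ₑ ∂ν ≤ C)
    {j : ℕ} (hj : j ≤ n) (x : Fin (n + 1) → Euc d) : ∫⁻ u, ‖Γ.tailAt η r (F u) j x‖ₑ ∂ν ≤ C := by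
  revert x
  refine backward_induction (P := fun j => ∀ x, ∫⁻ u, ‖Γ.tailAt η r (F u) j x‖ₑ ∂ν ≤ C) ?_ ?_ j hj
  · intro x
    refine (lintegral_mono fun u => ?_).trans (hC x)
    rw [tailAt_last, enorm_mul]
    refine mul_le_of_le_one_left' ?_
    rw [Real.enorm_of_nonneg (weight_mem h.cutoff n x).1]
    exact ENNReal.ofReal_le_one.2 (weight_mem h.cutoff n x).2
  · intro j ih x
    by_cases hxr : x ∈ Γ.regular r j
    · have hm : Measurable fun p : α × Euc d =>
          Γ.tailAt η r (F p.1) (j + 1) (Γ.extend r j x p.2) :=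
        (measurable_tailAt h hF j.2).comp (measurable_fst.prodMk
          ((measurable_extend h.pos.le j).comp (measurable_const.prodMk measurable_snd)))
      calc ∫⁻ u, ‖Γ.tailAt η r (F u) j x‖ₑ ∂ν
          ≤ ∫⁻ u, ∫⁻ g, ‖Γ.tailAt η r (F u) (j + 1) (Γ.extend r j x g)‖ₑ ∂(ballMeasure d) ∂ν := by
            refine lintegral_mono fun u => ?_
            rw [tailAt_of_mem _ hxr]
            exact enorm_integral_le_lintegral_enorm _
        _ = ∫⁻ g, ∫⁻ u, ‖Γ.tailAt η r (F u) (j + 1) (Γ.extend r j x g)‖ₑ ∂ν ∂(ballMeasure d) :=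
            lintegral_lintegral_swap hm.enorm.aemeasurable
        _ ≤ ∫⁻ g, C ∂(ballMeasure d) := lintegral_mono fun g => ih _
        _ = C := by simp
    · simp [tailAt_of_notMem _ hxr]

lemma edist_extend_le (j : Fin n) (x z : Fin (n + 1) → Euc d) (g g' : Euc d) :
    edist (Γ.extend r j x g) (Γ.extend r j z g')
      ≤ edist x z + ‖Γ.place r j x g - Γ.place r j z g'‖ₑ := by
  rw [edist_pi_le_iff]
  intro i
  by_cases hi : i = j.succ
  · subst hi
    simp only [extend, Function.update_self]
    rw [edist_eq_enorm_sub]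
    exact le_add_self
  · simp only [extend, Function.update_of_ne hi]
    exact (edist_le_pi_edist x z i).trans le_self_add

/-- Translates of the averages `tailAt` depend in a Lipschitz way on the configuration, in the mean
over the translations. -/
lemma exists_lintegral_tailAt_sub_le (h : Γ.Admissible η r) (C₀ C₁ : NNReal) {j : ℕ} (hj : j ≤ n) :
    ∃ C : NNReal, ∀ F : Euc d → (Fin (n + 1) → Euc d) → ℝ, Measurable (Function.uncurry F) →
      (∀ u x, |F u x| ≤ 1) → (∀ x, ∫⁻ u, ‖F u x‖ₑ ≤ C₀) →
      (∀ v x z, ∫⁻ u, ‖F (u + v) x - F u z‖ₑ ≤ C₁ * (‖v‖ₑ + edist x z)) →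
      ∀ v, ∀ x ∈ Γ.partialConfig j, ∀ z ∈ Γ.partialConfig j,
        ∫⁻ u, ‖Γ.tailAt η r (F (u + v)) j x - Γ.tailAt η r (F u) j z‖ₑ
          ≤ C * (‖v‖ₑ + edist x z) := by
  have hshift : ∀ (G : Euc d → ℝ≥0∞) (v : Euc d), ∫⁻ u, G (u + v) = ∫⁻ u, G u := fun G v =>
    lintegral_add_right_eq_self G v
  refine backward_induction (P := fun j => ∃ C : NNReal, ∀ F : Euc d → (Fin (n + 1) → Euc d) → ℝ,
    Measurable (Function.uncurry F) →
      (∀ u x, |F u x| ≤ 1) → (∀ x, ∫⁻ u, ‖F u x‖ₑ ≤ C₀) →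
      (∀ v x z, ∫⁻ u, ‖F (u + v) x - F u z‖ₑ ≤ C₁ * (‖v‖ₑ + edist x z)) →
      ∀ v, ∀ x ∈ Γ.partialConfig j, ∀ z ∈ Γ.partialConfig j,
        ∫⁻ u, ‖Γ.tailAt η r (F (u + v)) j x - Γ.tailAt η r (F u) j z‖ₑ
          ≤ C * (‖v‖ₑ + edist x z)) ?_ ?_ j hj
  · obtain ⟨K, hK⟩ := exists_enorm_weight_sub_le h.cutoff n
    refine ⟨K * C₀ + C₁, fun F hF hF1 hF0 hFL v x _ z _ => ?_⟩
    have hFx : ∀ x, Measurable fun u => F u x := fun x => hF.of_uncurry_right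
    calc ∫⁻ u, ‖Γ.tailAt η r (F (u + v)) n x - Γ.tailAt η r (F u) n z‖ₑ
        ≤ ∫⁻ u, (K * edist x z * ‖F (u + v) x‖ₑ + ‖F (u + v) x - F u z‖ₑ) := by
          refine lintegral_mono fun u => ?_
          rw [tailAt_last, tailAt_last]
          have e : weight η n x * F (u + v) x - weight η n z * F u z
              = (weight η n x - weight η n z) * F (u + v) x
                + weight η n z * (F (u + v) x - F u z) := by ring
          rw [e]
          refine (enorm_add_le _ _).trans ?_
          rw [enorm_mul, enorm_mul]
          gcongr
          · exact hK x z
          · refine mul_le_of_le_one_left' ?_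
            rw [Real.enorm_of_nonneg (weight_mem h.cutoff n z).1]
            exact ENNReal.ofReal_le_one.2 (weight_mem h.cutoff n z).2
      _ = K * edist x z * (∫⁻ u, ‖F (u + v) x‖ₑ) + ∫⁻ u, ‖F (u + v) x - F u z‖ₑ := by
          have hm : Measurable fun u => F (u + v) x := (hFx x).comp (measurable_add_const v)
          rw [lintegral_add_left (hm.enorm.const_mul _), lintegral_const_mul _ hm.enorm]
      _ ≤ K * edist x z * C₀ + C₁ * (‖v‖ₑ + edist x z) := by
          gcongr
          · rw [hshift (fun u => ‖F u x‖ₑ) v]; exact hF0 x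
          · exact hFL v x z
      _ ≤ K * C₀ * (‖v‖ₑ + edist x z) + C₁ * (‖v‖ₑ + edist x z) := by
          gcongr ?_ + _
          rw [mul_right_comm]
          gcongr
          exact le_add_self
      _ = _ := by push_cast; ring
  · rintro j ⟨C, hC⟩
    -- Near the compact set of extendable configurations the placement is uniformly Lipschitz. Away from
    -- it the averages vanish, and distant configurations are compared trivially.
    obtain ⟨δ, hδ, K, hK⟩ := (isCompact_extendable h j).exists_uniform_lipschitz
      (p := fun y z => y ∈ Γ.regular r j ∧ z ∈ Γ.regular r j)
      (ρ := fun y z => ∫⁻ g, ‖Γ.place r j y g - Γ.place r j z g‖ₑ ∂(ballMeasure d))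
      fun x hx => exists_lintegral_place_sub_le h.pos.le (h.nonempty j) (h.card_lt j)
        (mem_regular_of_extendable h hx)
    refine ⟨C * (1 + K) + 2 * C₀ / δ.toNNReal, fun F hF hF1 hF0 hFL v x hx z hz => ?_⟩
    have hT := measurable_tailAt h hF j.2
    have hTe : ∀ x, Measurable fun p : Euc d × Euc d =>
        Γ.tailAt η r (F p.1) (j + 1) (Γ.extend r j x p.2) := fun x =>
      hT.comp (measurable_fst.prodMk
        ((measurable_extend h.pos.le j).comp (measurable_const.prodMk measurable_snd)))
    have hnear : x ∈ Γ.regular r j → z ∈ Γ.regular r j →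
        ∫⁻ g, ‖Γ.place r j x g - Γ.place r j z g‖ₑ ∂(ballMeasure d) ≤ K * edist x z →
        ∫⁻ u, ‖Γ.tailAt η r (F (u + v)) j x - Γ.tailAt η r (F u) j z‖ₑ
          ≤ C * (1 + K) * (‖v‖ₑ + edist x z) := by
      intro hxr hzr hxz
      have hm1 : Measurable fun p : Euc d × Euc d =>
          Γ.tailAt η r (F (p.1 + v)) (j + 1) (Γ.extend r j x p.2) :=
        (hTe x).comp ((measurable_fst.add_const v).prodMk measurable_snd)
      have hint : ∀ (u : Euc d) (x : Fin (n + 1) → Euc d), Integrable (fun g =>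
          Γ.tailAt η r (F u) (j + 1) (Γ.extend r j x g)) (ballMeasure d) := fun u x =>
        Integrable.of_bound (C := 1)
          ((hTe x).comp (measurable_const.prodMk measurable_id)).aestronglyMeasurable
          (Filter.Eventually.of_forall fun g => abs_tailAt_le h (hF1 u) j.2 _)
      have hpm : Measurable fun g => ‖Γ.place r j x g - Γ.place r j z g‖ₑ :=
        ((measurable_place' h.pos.le).sub (measurable_place' h.pos.le)).enorm
      calc ∫⁻ u, ‖Γ.tailAt η r (F (u + v)) j x - Γ.tailAt η r (F u) j z‖ₑ
          ≤ ∫⁻ u, ∫⁻ g, ‖Γ.tailAt η r (F (u + v)) (j + 1) (Γ.extend r j x g)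
              - Γ.tailAt η r (F u) (j + 1) (Γ.extend r j z g)‖ₑ ∂(ballMeasure d) := by
            refine lintegral_mono fun u => ?_
            rw [tailAt_of_mem _ hxr, tailAt_of_mem _ hzr, ← integral_sub (hint _ _) (hint _ _)]
            exact enorm_integral_le_lintegral_enorm _
        _ = ∫⁻ g, (∫⁻ u, ‖Γ.tailAt η r (F (u + v)) (j + 1) (Γ.extend r j x g)
              - Γ.tailAt η r (F u) (j + 1) (Γ.extend r j z g)‖ₑ) ∂(ballMeasure d) :=
            lintegral_lintegral_swap (hm1.sub (hTe z)).enorm.aemeasurable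
        _ ≤ ∫⁻ g, C * (‖v‖ₑ + (edist x z + ‖Γ.place r j x g - Γ.place r j z g‖ₑ))
              ∂(ballMeasure d) := by
            refine lintegral_mono_ae ?_
            filter_upwards [ae_extend_mem h hx hxr, ae_extend_mem h hz hzr] with g hg hg'
            refine (hC F hF hF1 hF0 hFL v _ hg _ hg').trans ?_
            gcongr
            exact edist_extend_le j x z g g
        _ = C * (‖v‖ₑ + (edist x z
              + ∫⁻ g, ‖Γ.place r j x g - Γ.place r j z g‖ₑ ∂(ballMeasure d))) := by
            rw [lintegral_const_mul _ (by fun_prop), lintegral_add_left measurable_const,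
              lintegral_add_left measurable_const]
            simp
        _ ≤ C * (‖v‖ₑ + (edist x z + K * edist x z)) := by gcongr
        _ ≤ C * ((1 + K) * (‖v‖ₑ + edist x z)) := by
            gcongr
            calc ‖v‖ₑ + (edist x z + K * edist x z) ≤ ‖v‖ₑ + (edist x z + K * edist x z) + K * ‖v‖ₑ :=
                le_self_add
              _ = _ := by ring
        _ = _ := by rw [mul_assoc]
    push_cast
    rw [add_mul]
    by_cases hne : x ∈ Γ.extendable η j ∨ z ∈ Γ.extendable η j
    · by_cases hd : dist x z < δ
      · refine le_trans ?_ le_self_add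
        rcases hne with hxe | hze
        · obtain ⟨⟨h1, h2⟩, h3⟩ := hK x hxe z hd
          exact hnear h1 h2 h3
        · obtain ⟨⟨h1, h2⟩, h3⟩ := hK z hze x (by rwa [dist_comm])
          refine hnear h2 h1 ?_
          rw [edist_comm]
          refine le_trans (le_of_eq ?_) h3
          exact lintegral_congr fun g => enorm_sub_rev _ _
      · refine le_trans ?_ le_add_self
        have hTx : ∀ x, Measurable fun u => Γ.tailAt η r (F u) j x := fun x =>
          (measurable_tailAt h hF j.2.le).comp measurable_prodMk_right
        have hδ' : (δ.toNNReal : ℝ≥0∞) ≤ edist x z := by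
          rw [edist_dist]
          exact ENNReal.ofReal_le_ofReal (not_lt.1 hd)
        have hδ0 : (δ.toNNReal : ℝ≥0∞) ≠ 0 := by simpa using hδ
        calc ∫⁻ u, ‖Γ.tailAt η r (F (u + v)) j x - Γ.tailAt η r (F u) j z‖ₑ
            ≤ ∫⁻ u, (‖Γ.tailAt η r (F (u + v)) j x‖ₑ + ‖Γ.tailAt η r (F u) j z‖ₑ) :=
              lintegral_mono fun u => enorm_sub_le
          _ = (∫⁻ u, ‖Γ.tailAt η r (F u) j x‖ₑ) + ∫⁻ u, ‖Γ.tailAt η r (F u) j z‖ₑ := by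
              rw [lintegral_add_right _ (hTx z).enorm,
                hshift (fun u => ‖Γ.tailAt η r (F u) j x‖ₑ) v]
          _ ≤ C₀ + C₀ := by
              gcongr <;> exact lintegral_enorm_tailAt_le h hF hF0 j.2.le _
          _ = 2 * C₀ / δ.toNNReal * δ.toNNReal := by
              rw [ENNReal.div_mul_cancel hδ0 ENNReal.coe_ne_top]; ring
          _ ≤ _ := by
              rw [ENNReal.coe_div (by simpa using hδ)]
              push_cast
              gcongr
              exact hδ'.trans le_add_self
    · push Not at hne
      simp [tailAt_eq_zero h _ j.2.le hx hne.1, tailAt_eq_zero h _ j.2.le hz hne.2]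

end DistanceGraph

/-! ### Pairs of random points of a random sphere -/

open scoped InnerProductSpace ENNReal

section Tangent

variable {d : ℕ}

/-- The component of `θ'` orthogonal to the unit vector `θ`. -/
noncomputable def tangent (θ θ' : Euc d) : Euc d := θ' - ⟪θ, θ'⟫_ℝ • θ

/-- The regularized inverse, at scale `s`, of the tangential component of `θ'`. -/
noncomputable def tangentInv (s : ℝ) (θ θ' : Euc d) : Euc d := regInv s (tangent θ θ')

/-- A vector whose inner product with the chord `θ - θ'` is close to `1` unless `θ` and `θ'` are
almost parallel. -/
noncomputable def chordDual (s : ℝ) (θ θ' : Euc d) : Euc d :=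
  ⟪tangentInv s θ θ', θ'⟫_ℝ • θ - ⟪θ, θ'⟫_ℝ • tangentInv s θ θ'

/-- The proportion, at scale `s`, of non-parallelism of the unit vectors `θ` and `θ'`. -/
noncomputable def transversality (s : ℝ) (θ θ' : Euc d) : ℝ :=
  ‖tangent θ θ'‖ ^ 2 / (‖tangent θ θ'‖ ^ 2 + s ^ 2)

lemma tangent_map (R : Euc d ≃ₗᵢ[ℝ] Euc d) (θ θ' : Euc d) :
    tangent (R θ) (R θ') = R (tangent θ θ') := by
  simp [tangent]

lemma tangentInv_map (R : Euc d ≃ₗᵢ[ℝ] Euc d) (s : ℝ) (θ θ' : Euc d) :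
    tangentInv s (R θ) (R θ') = R (tangentInv s θ θ') := by
  rw [tangentInv, tangent_map, regInv_map, tangentInv]

lemma chordDual_map (R : Euc d ≃ₗᵢ[ℝ] Euc d) (s : ℝ) (θ θ' : Euc d) :
    chordDual s (R θ) (R θ') = R (chordDual s θ θ') := by
  simp [chordDual, tangentInv_map]

lemma inner_tangent {θ : Euc d} (hθ : ‖θ‖ = 1) (θ' : Euc d) : ⟪θ, tangent θ θ'⟫_ℝ = 0 := by
  simp [tangent, inner_sub_right, inner_smul_right, hθ]

variable {s : ℝ} {θ θ' : Euc d}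

lemma inner_tangentInv (hθ : ‖θ‖ = 1) : ⟪θ, tangentInv s θ θ'⟫_ℝ = 0 := by
  rw [tangentInv, regInv, inner_smul_right, inner_tangent hθ, mul_zero]

lemma inner_tangentInv_right (hθ : ‖θ‖ = 1) :
    ⟪tangentInv s θ θ', θ'⟫_ℝ = transversality s θ θ' := by
  have h : θ' = tangent θ θ' + ⟪θ, θ'⟫_ℝ • θ := by rw [tangent]; abel
  nth_rewrite 2 [h]
  rw [inner_add_right, inner_smul_right, real_inner_comm θ, inner_tangentInv hθ, mul_zero, add_zero,
    tangentInv, regInv, real_inner_smul_left, real_inner_self_eq_norm_sq, transversality,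
    inv_mul_eq_div]

lemma norm_tangentInv_le (hs : 0 < s) : ‖tangentInv s θ θ'‖ ≤ s⁻¹ := norm_regInv_le hs _

lemma norm_chordDual_le (hs : 0 < s) (hθ : ‖θ‖ ≤ 1) (hθ' : ‖θ'‖ ≤ 1) :
    ‖chordDual s θ θ'‖ ≤ 2 * s⁻¹ := by
  have hq := norm_tangentInv_le (θ := θ) (θ' := θ') hs
  have h1 : |⟪tangentInv s θ θ', θ'⟫_ℝ| ≤ s⁻¹ := (abs_real_inner_le_norm _ _).trans
    ((mul_le_of_le_one_right (norm_nonneg _) hθ').trans hq)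
  have h2 : |⟪θ, θ'⟫_ℝ| ≤ 1 := (abs_real_inner_le_norm _ _).trans
    (mul_le_one₀ hθ (norm_nonneg _) hθ')
  refine (norm_sub_le _ _).trans ?_
  rw [norm_smul, norm_smul, Real.norm_eq_abs, Real.norm_eq_abs]
  have h0 : 0 ≤ s⁻¹ := by positivity
  nlinarith [norm_nonneg θ, norm_nonneg (tangentInv s θ θ'), abs_nonneg ⟪θ, θ'⟫_ℝ,
    abs_nonneg ⟪tangentInv s θ θ', θ'⟫_ℝ]

lemma norm_tangentInv_sub_le (hs : 0 < s) (hθ : ‖θ‖ ≤ 1) (θ'' : Euc d) :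
    ‖tangentInv s θ θ'' - tangentInv s θ θ'‖ ≤ 6 * (s⁻¹) ^ 2 * ‖θ'' - θ'‖ := by
  refine (norm_regInv_sub_le hs _ _).trans ?_
  have e : tangent θ θ'' - tangent θ θ' = (θ'' - θ') - ⟪θ, θ'' - θ'⟫_ℝ • θ := by
    simp only [tangent, inner_sub_right]; module
  have h1 : ‖tangent θ θ'' - tangent θ θ'‖ ≤ 2 * ‖θ'' - θ'‖ := by
    rw [e]
    refine (norm_sub_le _ _).trans ?_
    rw [norm_smul, Real.norm_eq_abs]
    have := abs_real_inner_le_norm θ (θ'' - θ')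
    have h2 : ‖θ‖ * ‖θ'' - θ'‖ ≤ ‖θ'' - θ'‖ := mul_le_of_le_one_left (norm_nonneg _) hθ
    have h3 : |⟪θ, θ'' - θ'⟫_ℝ| * ‖θ‖ ≤ |⟪θ, θ'' - θ'⟫_ℝ| :=
      mul_le_of_le_one_right (abs_nonneg _) hθ
    linarith
  have h0 : 0 ≤ (s⁻¹) ^ 2 := by positivity
  nlinarith

lemma measurable_tangentInv (s : ℝ) :
    Measurable fun p : Euc d × Euc d => tangentInv s p.1 p.2 := by
  unfold tangentInv regInv tangent; fun_prop

lemma measurable_chordDual (s : ℝ) :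
    Measurable fun p : Euc d × Euc d => chordDual s p.1 p.2 := by
  have := measurable_tangentInv (d := d) s
  unfold chordDual; fun_prop

lemma measurable_transversality (s : ℝ) :
    Measurable fun p : Euc d × Euc d => transversality s p.1 p.2 := by
  unfold transversality tangent; fun_prop

lemma transversality_mem (hs : 0 < s) :
    0 ≤ transversality s θ θ' ∧ transversality s θ θ' ≤ 1 := by
  refine ⟨by unfold transversality; positivity, ?_⟩
  rw [transversality, div_le_one (by positivity)]
  nlinarith

lemma sum_inner_smul_wedge {ι : Type*} [Fintype ι] (b : OrthonormalBasis ι ℝ (Euc d))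
    (P : Euc d →L[ℝ] Euc d) (v z w : Euc d) :
    ∑ i, ⟪b i, v⟫_ℝ • wedge (P (b i)) z w = wedge (P v) z w := by
  have h : wedge (P v) z w = ∑ i, ⟪b i, v⟫_ℝ • wedge (P (b i)) z w := by
    conv_lhs => rw [← b.sum_repr' v]
    simp only [wedge_apply, map_sum, map_smul, sum_inner, real_inner_smul_left, smul_sub, Finset.sum_sub_distrib, Finset.sum_smul, Finset.smul_sum,
      smul_smul]
    congr 1
    refine Finset.sum_congr rfl fun i _ => ?_
    rw [mul_comm]
  exact h.symm

/-- The translation by `h`, in proportion to the transversality of `θ` and `θ'`, is an infinitesimal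
combination of motions of the chord `ρ (θ - θ')`: rotations of space, and rotations of `θ'` only, in
the range of `P`. -/
lemma transversality_smul_eq {ι : Type*} [Fintype ι] (b : OrthonormalBasis ι ℝ (Euc d))
    {P : Euc d →L[ℝ] Euc d} (hθ : ‖θ‖ = 1)
    (hPθ : P θ = θ) (hPθ' : P θ' = θ') {ρ : ℝ} (hρ : 0 < ρ) (h : Euc d) :
    transversality s θ θ' • h =
      ∑ i, (⟪h, ρ • (θ - θ')⟫_ℝ * (-(ρ ^ 2)⁻¹ * ⟪b i, tangentInv s θ θ'⟫_ℝ)) •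
          (-(ρ • wedge (P (b i)) θ θ'))
        + ∑ i, (ρ⁻¹ * ⟪b i, chordDual s θ θ'⟫_ℝ) • wedge (b i) h (ρ • (θ - θ')) := by
  set q := tangentInv s θ θ' with hq
  set B := chordDual s θ θ' with hB
  have hPq : P q = q := by
    rw [hq, tangentInv, regInv, tangent, map_smul, map_sub, map_smul, hPθ, hPθ']
  have e1 : ∑ i, (⟪h, ρ • (θ - θ')⟫_ℝ * (-(ρ ^ 2)⁻¹ * ⟪b i, q⟫_ℝ)) • (-(ρ • wedge (P (b i)) θ θ'))
      = (⟪h, ρ • (θ - θ')⟫_ℝ * ρ⁻¹) • B := by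
    have : B = wedge (P q) θ θ' := by
      rw [hPq, wedge_apply, hB, chordDual]
    rw [this, ← sum_inner_smul_wedge b, Finset.smul_sum]
    refine Finset.sum_congr rfl fun i _ => ?_
    rw [smul_neg, ← neg_smul, smul_smul, smul_smul]
    congr 1
    field_simp
  have e2 : ∑ i, (ρ⁻¹ * ⟪b i, B⟫_ℝ) • wedge (b i) h (ρ • (θ - θ'))
      = ρ⁻¹ • wedge B h (ρ • (θ - θ')) := by
    have := sum_inner_smul_wedge b (ContinuousLinearMap.id ℝ _) B h (ρ • (θ - θ'))
    simp only [ContinuousLinearMap.id_apply] at this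
    rw [← this, Finset.smul_sum]
    simp only [smul_smul]
  have e3 : ⟪B, θ - θ'⟫_ℝ = transversality s θ θ' := by
    have h1 : ⟪q, θ⟫_ℝ = 0 := by rw [real_inner_comm]; exact inner_tangentInv hθ
    rw [hB, chordDual, inner_sub_left, real_inner_smul_left, real_inner_smul_left, inner_sub_right,
      inner_sub_right, ← hq, h1, real_inner_self_eq_norm_sq, hθ, ← inner_tangentInv_right hθ]
    ring
  rw [e1, e2, wedge_apply, inner_smul_right B, e3, smul_sub ρ⁻¹, smul_smul, smul_smul]
  have : ρ⁻¹ * (ρ * transversality s θ θ') = transversality s θ θ' := by field_simp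
  rw [this, mul_comm ρ⁻¹]
  abel

end Tangent

/-- A random sphere in a random linear subspace of dimension at least two, given by a projection and a
radius in `[κ, κ⁻¹]` and distributed in a rotation-invariant way. -/
structure SphereFamily (d : ℕ) (Y : Type*) [MeasurableSpace Y] (μ : Measure Y) (κ : ℝ) where
  /-- The orthogonal projection to the subspace. -/
  proj : Y → Euc d →L[ℝ] Euc d
  /-- The radius. -/
  rad : Y → ℝ
  /-- The action of rotations. -/
  act : (Euc d ≃ₗᵢ[ℝ] Euc d) → Y → Y
  measurable_proj : Measurable fun p : Y × Euc d => proj p.1 p.2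
  measurable_rad : Measurable rad
  pos : 0 < κ
  rad_ge : ∀ y, κ ≤ rad y
  rad_le : ∀ y, rad y ≤ κ⁻¹
  proj_proj : ∀ y z, proj y (proj y z) = proj y z
  inner_proj : ∀ y v z, ⟪proj y v, z⟫_ℝ = ⟪v, proj y z⟫_ℝ
  exists_unit : ∀ y v, ∃ e, ‖e‖ = 1 ∧ proj y e = e ∧ ⟪e, v⟫_ℝ = 0
  ae_proj_ne_zero : ∀ y, ∀ᵐ g ∂(ballMeasure d), proj y g ≠ 0
  proj_act : ∀ T y z, proj (act T y) (T z) = T (proj y z)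
  rad_act : ∀ T y, rad (act T y) = rad y
  measurePreserving_act : ∀ T, MeasurePreserving (act T) μ μ
  act_act : ∀ T T' : Euc d ≃ₗᵢ[ℝ] Euc d, (∀ z, T (T' z) = z) → ∀ y, act T (act T' y) = y
  act_id : ∀ T : Euc d ≃ₗᵢ[ℝ] Euc d, (∀ z, T z = z) → ∀ y, act T y = y

namespace SphereFamily

variable {d : ℕ} {Y : Type*} [MeasurableSpace Y] {μ : Measure Y} {κ : ℝ}
  (S : SphereFamily d Y μ κ)

/-- The direction of the point of the sphere determined by `g`. -/
noncomputable def direction (y : Y) (g : Euc d) : Euc d := dir (S.proj y g)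

/-- The chord between the points of the sphere determined by `g` and `g'`. -/
noncomputable def chord (z : Y × Euc d × Euc d) : Euc d :=
  S.rad z.1 • (S.direction z.1 z.2.1 - S.direction z.1 z.2.2)

/-- A rotation moving the whole sphere and both points. -/
noncomputable def rotate (T : Euc d ≃ₗᵢ[ℝ] Euc d) (z : Y × Euc d × Euc d) : Y × Euc d × Euc d :=
  (S.act T z.1, T z.2.1, T z.2.2)

/-- A rotation of the second point along the sphere, in the plane spanned by the first point and the
projection of `e`. -/
noncomputable def slide (e : Euc d) (t : ℝ) (z : Y × Euc d × Euc d) : Y × Euc d × Euc d :=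
  (z.1, z.2.1, wedgeRot t (S.proj z.1 e) (S.direction z.1 z.2.1) z.2.2)

lemma norm_proj_le (y : Y) (z : Euc d) : ‖S.proj y z‖ ≤ ‖z‖ := by
  have h : ‖S.proj y z‖ ^ 2 ≤ ‖z‖ * ‖S.proj y z‖ := by
    rw [← real_inner_self_eq_norm_sq, S.inner_proj, S.proj_proj]
    exact real_inner_le_norm _ _
  rcases (norm_nonneg (S.proj y z)).eq_or_lt with h0 | h0
  · rw [← h0]; exact norm_nonneg _
  · rw [sq] at h; exact le_of_mul_le_mul_right h h0

lemma norm_direction_le (y : Y) (g : Euc d) : ‖S.direction y g‖ ≤ 1 := norm_dir_le _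

lemma proj_direction (y : Y) (g : Euc d) : S.proj y (S.direction y g) = S.direction y g := by
  rw [direction, dir, map_smul, S.proj_proj]

lemma direction_act (T : Euc d ≃ₗᵢ[ℝ] Euc d) (y : Y) (g : Euc d) :
    S.direction (S.act T y) (T g) = T (S.direction y g) := by
  rw [direction, S.proj_act, dir_map, direction]

lemma proj_wedge (y : Y) (u v : Euc d) (z : Euc d) (hu : S.proj y u = u) (hv : S.proj y v = v) :
    S.proj y (wedge u v z) = wedge u v (S.proj y z) := by
  rw [wedge_apply, wedge_apply, map_sub, map_smul, map_smul, hu, hv, ← S.inner_proj, hu,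
    ← S.inner_proj, hv]

lemma direction_slide (y : Y) (e g g' : Euc d) (t : ℝ) :
    S.direction y (wedgeRot t (S.proj y e) (S.direction y g) g')
      = wedgeRot t (S.proj y e) (S.direction y g) (S.direction y g') := by
  rw [direction, wedgeRot_commute fun z => S.proj_wedge y _ _ z (S.proj_proj y e)
    (S.proj_direction y g), dir_map]
  rfl

lemma rad_pos (y : Y) : 0 < S.rad y := S.pos.trans_le (S.rad_ge y)

lemma measurable_direction : Measurable fun p : Y × Euc d => S.direction p.1 p.2 :=
  measurable_dir.comp S.measurable_proj

lemma measurable_direction_fst :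
    Measurable fun z : Y × Euc d × Euc d => S.direction z.1 z.2.1 :=
  have h : Measurable fun z : Y × Euc d × Euc d => (z.1, z.2.1) := by fun_prop
  have h' := S.measurable_direction.comp h
  h'

lemma measurable_direction_snd :
    Measurable fun z : Y × Euc d × Euc d => S.direction z.1 z.2.2 :=
  have h : Measurable fun z : Y × Euc d × Euc d => (z.1, z.2.2) := by fun_prop
  have h' := S.measurable_direction.comp h
  h'

lemma measurable_chord : Measurable S.chord :=
  (S.measurable_rad.comp measurable_fst).smul (S.measurable_direction_fst.sub
    S.measurable_direction_snd)

lemma norm_chord_le (z : Y × Euc d × Euc d) : ‖S.chord z‖ ≤ 2 * κ⁻¹ := by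
  rw [chord, norm_smul, Real.norm_of_nonneg (S.rad_pos _).le]
  have h1 := norm_sub_le (S.direction z.1 z.2.1) (S.direction z.1 z.2.2)
  have h2 := S.norm_direction_le z.1 z.2.1
  have h3 := S.norm_direction_le z.1 z.2.2
  calc _ ≤ κ⁻¹ * 2 := mul_le_mul (S.rad_le _) (by linarith) (norm_nonneg _)
        (inv_nonneg.2 S.pos.le)
    _ = _ := mul_comm _ _

lemma chord_rotate (T : Euc d ≃ₗᵢ[ℝ] Euc d) (z : Y × Euc d × Euc d) :
    S.chord (S.rotate T z) = T (S.chord z) := by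
  simp only [chord, rotate, S.direction_act, S.rad_act, map_smul, map_sub]

lemma chord_slide (e : Euc d) (t : ℝ) (z : Y × Euc d × Euc d) :
    S.chord (S.slide e t z) = S.rad z.1 • (S.direction z.1 z.2.1
      - wedgeRot t (S.proj z.1 e) (S.direction z.1 z.2.1) (S.direction z.1 z.2.2)) := by
  simp only [chord, slide, S.direction_slide]

/-- The joint distribution of a random sphere and two random points. -/
noncomputable def pairMeasure (_ : SphereFamily d Y μ κ) : Measure (Y × Euc d × Euc d) :=
  μ.prod ((ballMeasure d).prod (ballMeasure d))

/-- The joint distribution of a translation, a random sphere and two random points. -/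
noncomputable def fullMeasure : Measure (Euc d × Y × Euc d × Euc d) := volume.prod S.pairMeasure

variable [IsFiniteMeasure μ]

instance : IsFiniteMeasure S.pairMeasure := by unfold pairMeasure; infer_instance

instance : SFinite S.fullMeasure := by unfold fullMeasure; infer_instance

/-- A property of almost all points of each sphere holds for almost all pairs of points. -/
lemma ae_pairMeasure {p : Y × Euc d → Prop} (hp : MeasurableSet {q | p q})
    (h : ∀ y, ∀ᵐ g ∂(ballMeasure d), p (y, g)) :
    ∀ᵐ z ∂S.pairMeasure, p (z.1, z.2.1) ∧ p (z.1, z.2.2) := by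
  have h1 : ∀ᵐ q ∂(μ.prod (ballMeasure d)), p q :=
    (Measure.ae_prod_iff_ae_ae hp).2 (Filter.Eventually.of_forall h)
  have q1 : Measure.QuasiMeasurePreserving (fun z : Y × Euc d × Euc d => (z.1, z.2.1))
      S.pairMeasure (μ.prod (ballMeasure d)) :=
    ((MeasurePreserving.id μ).prod measurePreserving_fst).quasiMeasurePreserving
  have q2 : Measure.QuasiMeasurePreserving (fun z : Y × Euc d × Euc d => (z.1, z.2.2))
      S.pairMeasure (μ.prod (ballMeasure d)) :=
    ((MeasurePreserving.id μ).prod measurePreserving_snd).quasiMeasurePreserving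
  exact (q1.ae h1).and (q2.ae h1)

lemma measurePreserving_rotate (T : Euc d ≃ₗᵢ[ℝ] Euc d) :
    MeasurePreserving (S.rotate T) S.pairMeasure S.pairMeasure :=
  (S.measurePreserving_act T).prod
    ((measurePreserving_ballMeasure T).prod (measurePreserving_ballMeasure T))

omit [IsFiniteMeasure μ] in
lemma measurable_slide_aux (e : Euc d) (t : ℝ) : Measurable fun z : Y × Euc d × Euc d =>
    wedgeRot t (S.proj z.1 e) (S.direction z.1 z.2.1) z.2.2 := by
  have h1 : Measurable fun z : Y × Euc d × Euc d => S.proj z.1 e :=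
    S.measurable_proj.comp (measurable_fst.prodMk measurable_const)
  exact continuous_wedgeRot.measurable.comp ((measurable_const.prodMk
    (h1.prodMk S.measurable_direction_fst)).prodMk (measurable_snd.comp measurable_snd))

lemma measurePreserving_slide (e : Euc d) (t : ℝ) :
    MeasurePreserving (S.slide e t) S.pairMeasure S.pairMeasure := by
  refine (MeasurePreserving.id μ).skew_product
    (g := fun (y : Y) (p : Euc d × Euc d) => (p.1, wedgeRot t (S.proj y e) (S.direction y p.1) p.2)) ?_ ?_
  · exact (measurable_fst.comp measurable_snd).prodMk (S.measurable_slide_aux e t)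
  · refine Filter.Eventually.of_forall fun y => ?_
    refine ((MeasurePreserving.id (ballMeasure d)).skew_product
      (g := fun g g' => wedgeRot t (S.proj y e) (S.direction y g) g') ?_ ?_).map_eq
    · have h1 : Measurable fun p : Euc d × Euc d => (y, p) := measurable_prodMk_left
      have h2 := (S.measurable_slide_aux e t).comp h1
      exact h2
    · exact Filter.Eventually.of_forall fun g => (measurePreserving_ballMeasure _).map_eq

lemma measurePreserving_full {φ : Y × Euc d × Euc d → Y × Euc d × Euc d}
    (hφ : MeasurePreserving φ S.pairMeasure S.pairMeasure) :
    MeasurePreserving (Prod.map id φ) S.fullMeasure S.fullMeasure :=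
  (MeasurePreserving.id _).prod hφ

/-- A density on pairs of points of a random sphere (translated by a vector `u`) that is bounded and
Lipschitz, in the mean over `u`, along the motions `rotate` and `slide`. -/
structure IsWeight (H : Euc d × Y × Euc d × Euc d → ℝ) (C : ℝ) : Prop where
  measurable : Measurable H
  nonneg : 0 ≤ C
  fiber : ∀ z, ∫⁻ u, ‖H (u, z)‖ₑ ≤ ENNReal.ofReal C
  rotate : ∀ t a b, ∫⁻ p : Euc d × Y × Euc d × Euc d, ‖H (p.1, S.rotate (wedgeRot t a b) p.2) - H p‖ₑ ∂S.fullMeasure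
    ≤ ENNReal.ofReal (C * ‖a‖ * ‖b‖ * |t|)
  slide : ∀ t e, ‖e‖ ≤ 1 → ∫⁻ p : Euc d × Y × Euc d × Euc d, ‖H (p.1, S.slide e t p.2) - H p‖ₑ ∂S.fullMeasure
    ≤ ENNReal.ofReal (C * |t|)

end SphereFamily

/-! ### Decay of oscillating averages over pairs of points -/

/-- An `L¹` Lipschitz bound for a product along a map, from a pointwise bound for one factor and an
`L¹` bound for the other. -/
lemma integral_abs_mul_comp_sub_le {Ω : Type*} [MeasurableSpace Ω] {m : Measure Ω} {φ : Ω → Ω}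
    {a H : Ω → ℝ} (ha : Measurable a) (hH : Measurable H) (hφ : Measurable φ) {M M₁ C₀ C₁ : ℝ}
    (hM : ∀ z, |a z| ≤ M) (hM₁ : ∀ z, |a (φ z) - a z| ≤ M₁) (hM0 : 0 ≤ M) (hM10 : 0 ≤ M₁)
    (hC0 : 0 ≤ C₀) (hC₁0 : 0 ≤ C₁) (hC₀ : ∫⁻ z, ‖H z‖ₑ ∂m ≤ ENNReal.ofReal C₀)
    (hC₁ : ∫⁻ z, ‖H (φ z) - H z‖ₑ ∂m ≤ ENNReal.ofReal C₁) :
    ∫ z, |a (φ z) * H (φ z) - a z * H z| ∂m ≤ M * C₁ + M₁ * C₀ := by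
  have hm : Measurable fun z => |a (φ z) * H (φ z) - a z * H z| :=
    (((ha.comp hφ).mul (hH.comp hφ)).sub (ha.mul hH)).norm
  rw [integral_eq_lintegral_of_nonneg_ae (Filter.Eventually.of_forall fun _ => abs_nonneg _)
    hm.aestronglyMeasurable]
  refine ENNReal.toReal_le_of_le_ofReal (by positivity) ?_
  calc ∫⁻ z, ENNReal.ofReal |a (φ z) * H (φ z) - a z * H z| ∂m
      ≤ ∫⁻ z, (ENNReal.ofReal M * ‖H (φ z) - H z‖ₑ + ENNReal.ofReal M₁ * ‖H z‖ₑ) ∂m := by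
        refine lintegral_mono fun z => ?_
        rw [← ofReal_norm, ← ofReal_norm, ← ENNReal.ofReal_mul hM0, ← ENNReal.ofReal_mul hM10,
          ← ENNReal.ofReal_add (by positivity) (by positivity)]
        refine ENNReal.ofReal_le_ofReal ?_
        have e : a (φ z) * H (φ z) - a z * H z
            = a (φ z) * (H (φ z) - H z) + (a (φ z) - a z) * H z := by ring
        rw [e]
        refine (abs_add_le _ _).trans ?_
        rw [abs_mul, abs_mul, Real.norm_eq_abs, Real.norm_eq_abs]
        gcongr
        · exact hM _
        · exact hM₁ z
    _ = ENNReal.ofReal M * (∫⁻ z, ‖H (φ z) - H z‖ₑ ∂m) + ENNReal.ofReal M₁ * ∫⁻ z, ‖H z‖ₑ ∂m := by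
        have h1 : Measurable fun z => ‖H (φ z) - H z‖ₑ := ((hH.comp hφ).sub hH).enorm
        rw [lintegral_add_left (h1.const_mul _), lintegral_const_mul _ h1,
          lintegral_const_mul _ hH.enorm]
    _ ≤ ENNReal.ofReal M * ENNReal.ofReal C₁ + ENNReal.ofReal M₁ * ENNReal.ofReal C₀ := by gcongr
    _ = _ := by
        rw [← ENNReal.ofReal_mul hM0, ← ENNReal.ofReal_mul hM10,
          ← ENNReal.ofReal_add (by positivity) (by positivity)]

namespace SphereFamily

variable {d : ℕ} {Y : Type*} [MeasurableSpace Y] {μ : Measure Y} {κ : ℝ}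
  (S : SphereFamily d Y μ κ)

lemma rotate_rotate_neg (t : ℝ) (a b : Euc d) (z : Y × Euc d × Euc d) :
    S.rotate (wedgeRot t a b) (S.rotate (wedgeRot (-t) a b) z) = z := by
  obtain ⟨y, g, g'⟩ := z
  simp only [rotate, wedgeRot_wedgeRot_neg, S.act_act _ _ (wedgeRot_wedgeRot_neg t a b)]

lemma rotate_zero (a b : Euc d) (z : Y × Euc d × Euc d) : S.rotate (wedgeRot 0 a b) z = z := by
  obtain ⟨y, g, g'⟩ := z
  simp only [rotate, wedgeRot_zero, S.act_id _ (wedgeRot_zero a b)]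

lemma slide_slide_neg (e : Euc d) (t : ℝ) (z : Y × Euc d × Euc d) :
    S.slide e t (S.slide e (-t) z) = z := by
  obtain ⟨y, g, g'⟩ := z
  simp only [slide, wedgeRot_wedgeRot_neg]

lemma slide_zero (e : Euc d) (z : Y × Euc d × Euc d) : S.slide e 0 z = z := by
  obtain ⟨y, g, g'⟩ := z
  simp only [slide, wedgeRot_zero]

/-- The coefficient of the rotations in the direction of `e`. -/
noncomputable def rotCoeff (s : ℝ) (e : Euc d) (z : Y × Euc d × Euc d) : ℝ :=
  (S.rad z.1)⁻¹ * ⟪e, chordDual s (S.direction z.1 z.2.1) (S.direction z.1 z.2.2)⟫_ℝ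

/-- The coefficient of `slide e` in the expression of a translation by `h`. -/
noncomputable def slideCoeff (s : ℝ) (h e : Euc d) (z : Y × Euc d × Euc d) : ℝ :=
  ⟪h, S.chord z⟫_ℝ * (-((S.rad z.1) ^ 2)⁻¹ *
    ⟪e, tangentInv s (S.direction z.1 z.2.1) (S.direction z.1 z.2.2)⟫_ℝ)

lemma measurable_direction_pair : Measurable fun z : Y × Euc d × Euc d =>
    (S.direction z.1 z.2.1, S.direction z.1 z.2.2) :=
  S.measurable_direction_fst.prodMk S.measurable_direction_snd

lemma measurable_rotCoeff (s : ℝ) (e : Euc d) : Measurable (S.rotCoeff s e) := by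
  have h1 : Measurable fun z : Y × Euc d × Euc d => S.rad z.1 := S.measurable_rad.comp measurable_fst
  have h2 := (measurable_chordDual s).comp S.measurable_direction_pair
  exact h1.inv.mul (measurable_const.inner h2)

lemma measurable_slideCoeff (s : ℝ) (h e : Euc d) : Measurable (S.slideCoeff s h e) := by
  have h1 : Measurable fun z : Y × Euc d × Euc d => S.rad z.1 := S.measurable_rad.comp measurable_fst
  have h2 := (measurable_tangentInv s).comp S.measurable_direction_pair
  exact (measurable_const.inner S.measurable_chord).mul
    ((h1.pow_const 2).inv.neg.mul (measurable_const.inner h2))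

lemma inv_rad_le (y : Y) : (S.rad y)⁻¹ ≤ κ⁻¹ := inv_anti₀ S.pos (S.rad_ge y)

variable {s : ℝ} {e h : Euc d}

lemma abs_rotCoeff_le (hs : 0 < s) (he : ‖e‖ ≤ 1) (z : Y × Euc d × Euc d) :
    |S.rotCoeff s e z| ≤ κ⁻¹ * (2 * s⁻¹) := by
  rw [rotCoeff, abs_mul, abs_of_pos (inv_pos.2 (S.rad_pos _))]
  have h0 := S.pos
  refine mul_le_mul (S.inv_rad_le _) ((abs_real_inner_le_norm _ _).trans ?_) (abs_nonneg _)
    (by positivity)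
  exact (mul_le_of_le_one_left (norm_nonneg _) he).trans
    (norm_chordDual_le hs (S.norm_direction_le _ _) (S.norm_direction_le _ _))

lemma abs_rotCoeff_rotate_sub_le (hs : 0 < s) (he : ‖e‖ ≤ 1) (t : ℝ) (z : Y × Euc d × Euc d) :
    |S.rotCoeff s e (S.rotate (wedgeRot t e h) z) - S.rotCoeff s e z|
      ≤ κ⁻¹ * (2 * ‖h‖ * (2 * s⁻¹) * |t|) := by
  have h0 := S.pos
  simp only [rotCoeff, rotate, S.rad_act, S.direction_act, chordDual_map]
  rw [← mul_sub, ← inner_sub_right, abs_mul, abs_of_pos (inv_pos.2 (S.rad_pos _))]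
  refine mul_le_mul (S.inv_rad_le _) ((abs_real_inner_le_norm _ _).trans ?_) (abs_nonneg _)
    (by positivity)
  refine (mul_le_of_le_one_left (norm_nonneg _) he).trans ((norm_wedgeRot_sub_le _ _ _ _).trans ?_)
  have h1 := norm_chordDual_le hs (S.norm_direction_le z.1 z.2.1) (S.norm_direction_le z.1 z.2.2)
  calc 2 * ‖e‖ * ‖h‖ * ‖chordDual s (S.direction z.1 z.2.1) (S.direction z.1 z.2.2)‖ * |t|
      ≤ 2 * 1 * ‖h‖ * (2 * s⁻¹) * |t| := by gcongr
    _ = _ := by ring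

lemma abs_slideCoeff_aux (hs : 0 < s) (he : ‖e‖ ≤ 1) (z : Y × Euc d × Euc d) :
    |-((S.rad z.1) ^ 2)⁻¹ * ⟪e, tangentInv s (S.direction z.1 z.2.1) (S.direction z.1 z.2.2)⟫_ℝ|
      ≤ κ⁻¹ ^ 2 * s⁻¹ := by
  have h0 := S.pos
  have h1 := S.rad_pos z.1
  rw [abs_mul, abs_neg, abs_of_pos (by positivity), ← inv_pow]
  refine mul_le_mul (pow_le_pow_left₀ (by positivity) (S.inv_rad_le _) 2)
    ((abs_real_inner_le_norm _ _).trans ?_) (abs_nonneg _) (by positivity)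
  exact (mul_le_of_le_one_left (norm_nonneg _) he).trans (norm_tangentInv_le hs)

lemma abs_slideCoeff_le (hs : 0 < s) (he : ‖e‖ ≤ 1) (z : Y × Euc d × Euc d) :
    |S.slideCoeff s h e z| ≤ ‖h‖ * (2 * κ⁻¹) * (κ⁻¹ ^ 2 * s⁻¹) := by
  have h0 := S.pos
  rw [slideCoeff, abs_mul]
  refine mul_le_mul ((abs_real_inner_le_norm _ _).trans ?_) (S.abs_slideCoeff_aux hs he z)
    (abs_nonneg _) (by positivity)
  exact mul_le_mul_of_nonneg_left (S.norm_chord_le z) (norm_nonneg _)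

lemma norm_wedgeRot_direction_sub_le (he : ‖e‖ ≤ 1) (t : ℝ) (z : Y × Euc d × Euc d) :
    ‖wedgeRot t (S.proj z.1 e) (S.direction z.1 z.2.1) (S.direction z.1 z.2.2)
      - S.direction z.1 z.2.2‖ ≤ 2 * |t| := by
  refine (norm_wedgeRot_sub_le _ _ _ _).trans ?_
  have h1 := (S.norm_proj_le z.1 e).trans he
  have h2 := S.norm_direction_le z.1 z.2.1
  have h3 := S.norm_direction_le z.1 z.2.2
  calc 2 * ‖S.proj z.1 e‖ * ‖S.direction z.1 z.2.1‖ * ‖S.direction z.1 z.2.2‖ * |t|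
      ≤ 2 * 1 * 1 * 1 * |t| := by gcongr
    _ = _ := by ring

lemma norm_chord_slide_sub_le (he : ‖e‖ ≤ 1) (t : ℝ) (z : Y × Euc d × Euc d) :
    ‖S.chord (S.slide e t z) - S.chord z‖ ≤ κ⁻¹ * (2 * |t|) := by
  have h0 := S.pos
  rw [chord_slide, chord, ← smul_sub, norm_smul, Real.norm_of_nonneg (S.rad_pos _).le,
    sub_sub_sub_cancel_left, norm_sub_rev]
  exact mul_le_mul (S.rad_le _) (S.norm_wedgeRot_direction_sub_le he t z) (norm_nonneg _)
    (by positivity)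

lemma abs_slideCoeff_slide_sub_le (hs : 0 < s) (hs1 : s ≤ 1) (he : ‖e‖ ≤ 1) (t : ℝ)
    (z : Y × Euc d × Euc d) :
    |S.slideCoeff s h e (S.slide e t z) - S.slideCoeff s h e z|
      ≤ ‖h‖ * (26 * κ⁻¹ ^ 3 * s⁻¹ ^ 2) * |t| := by
  have h0 := S.pos
  have hr := S.rad_pos z.1
  have h1s : 1 ≤ s⁻¹ := (one_le_inv₀ hs).2 hs1
  set a : Y × Euc d × Euc d → ℝ := fun z => -((S.rad z.1) ^ 2)⁻¹ *
    ⟪e, tangentInv s (S.direction z.1 z.2.1) (S.direction z.1 z.2.2)⟫_ℝ with ha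
  have e1 : S.slideCoeff s h e (S.slide e t z) - S.slideCoeff s h e z
      = ⟪h, S.chord (S.slide e t z) - S.chord z⟫_ℝ * a (S.slide e t z)
        + ⟪h, S.chord z⟫_ℝ * (a (S.slide e t z) - a z) := by
    simp only [slideCoeff, inner_sub_right, ha]; ring
  have b1 : |⟪h, S.chord (S.slide e t z) - S.chord z⟫_ℝ| ≤ ‖h‖ * (κ⁻¹ * (2 * |t|)) :=
    (abs_real_inner_le_norm _ _).trans
      (mul_le_mul_of_nonneg_left (S.norm_chord_slide_sub_le he t z) (norm_nonneg _))
  have b2 : |a (S.slide e t z)| ≤ κ⁻¹ ^ 2 * s⁻¹ := S.abs_slideCoeff_aux hs he _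
  have b3 : |⟪h, S.chord z⟫_ℝ| ≤ ‖h‖ * (2 * κ⁻¹) := (abs_real_inner_le_norm _ _).trans
      (mul_le_mul_of_nonneg_left (S.norm_chord_le z) (norm_nonneg _))
  have b4 : |a (S.slide e t z) - a z| ≤ κ⁻¹ ^ 2 * (6 * s⁻¹ ^ 2 * (2 * |t|)) := by
    simp only [ha, slide, S.direction_slide]
    rw [← mul_sub, ← inner_sub_right, abs_mul, abs_neg, abs_of_pos (by positivity), ← inv_pow]
    refine mul_le_mul (pow_le_pow_left₀ (by positivity) (S.inv_rad_le _) 2)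
      ((abs_real_inner_le_norm _ _).trans ?_) (abs_nonneg _) (by positivity)
    refine (mul_le_of_le_one_left (norm_nonneg _) he).trans
      ((norm_tangentInv_sub_le hs (S.norm_direction_le _ _) _).trans ?_)
    exact mul_le_mul_of_nonneg_left (S.norm_wedgeRot_direction_sub_le he t z) (by positivity)
  rw [e1]
  calc _ ≤ _ := abs_add_le _ _
    _ ≤ ‖h‖ * (κ⁻¹ * (2 * |t|)) * (κ⁻¹ ^ 2 * s⁻¹)
        + ‖h‖ * (2 * κ⁻¹) * (κ⁻¹ ^ 2 * (6 * s⁻¹ ^ 2 * (2 * |t|))) := by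
      exact add_le_add
        ((abs_mul _ _).le.trans (mul_le_mul b1 b2 (abs_nonneg _) (by positivity)))
        ((abs_mul _ _).le.trans (mul_le_mul b3 b4 (abs_nonneg _) (by positivity)))
    _ ≤ ‖h‖ * (κ⁻¹ * (2 * |t|)) * (κ⁻¹ ^ 2 * (s⁻¹ * s⁻¹))
        + ‖h‖ * (2 * κ⁻¹) * (κ⁻¹ ^ 2 * (6 * s⁻¹ ^ 2 * (2 * |t|))) := by
      gcongr
      exact le_mul_of_one_le_left (by positivity) h1s
    _ = _ := by ring

variable [IsFiniteMeasure μ]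

lemma lintegral_enorm_weight_le {H : Euc d × Y × Euc d × Euc d → ℝ} {C : ℝ}
    (hH : S.IsWeight H C) (hμ : μ Set.univ ≤ 1) :
    ∫⁻ p, ‖H p‖ₑ ∂S.fullMeasure ≤ ENNReal.ofReal C := by
  rw [fullMeasure, lintegral_prod_symm _ hH.measurable.enorm.aemeasurable]
  calc _ ≤ ∫⁻ _, ENNReal.ofReal C ∂S.pairMeasure := lintegral_mono fun z => hH.fiber z
    _ = ENNReal.ofReal C * μ Set.univ := by
      rw [lintegral_const, pairMeasure, ← Set.univ_prod_univ, Measure.prod_prod,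
        measure_univ (μ := (ballMeasure d).prod (ballMeasure d)), mul_one]
    _ ≤ _ := mul_le_of_le_one_right' hμ

/-- The derivative of a function of the translated chord along one of the motions integrates, against
a coefficient `a` and the weight, to a quantity independent of the size of the derivative. -/
lemma abs_integral_deriv_le {H : Euc d × Y × Euc d × Euc d → ℝ} {C : ℝ} (hH : S.IsWeight H C)
    (hμ : μ Set.univ ≤ 1) {φ : ℝ → Y × Euc d × Euc d → Y × Euc d × Euc d}
    (hφ : ∀ t, MeasurePreserving (φ t) S.pairMeasure S.pairMeasure)
    (hinv : ∀ t z, φ t (φ (-t) z) = z) (hφ0 : ∀ z, φ 0 z = z)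
    {w' : Y × Euc d × Euc d → Euc d} {K₀ : ℝ}
    (hw : ∀ z, HasDerivAt (fun t => S.chord (φ t z)) (w' z) 0)
    (hwlip : ∀ t z, ‖S.chord (φ t z) - S.chord z‖ ≤ K₀ * |t|)
    {F : Euc d → ℝ} (hF : Measurable F) (hF2 : ∀ u, |F u| ≤ 2)
    {a : Y × Euc d × Euc d → ℝ} (ha : Measurable a) {M M₁ C₁ : ℝ} (hM : ∀ z, |a z| ≤ M)
    (hM0 : 0 ≤ M) (hM10 : 0 ≤ M₁) (hC₁ : 0 ≤ C₁) (hM₁ : ∀ t z, |a (φ t z) - a z| ≤ M₁ * |t|)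
    (hHφ : ∀ t, ∫⁻ p : Euc d × Y × Euc d × Euc d, ‖H (p.1, φ t p.2) - H p‖ₑ ∂S.fullMeasure
      ≤ ENNReal.ofReal (C₁ * |t|))
    {Φ : Euc d → ℝ} (hΦ : Differentiable ℝ Φ) (hΦ1 : ∀ z, |Φ z| ≤ 1) {K : NNReal}
    (hΦL : LipschitzWith K Φ) (lam : ℝ) :
    |∫ p : Euc d × Y × Euc d × Euc d, fderiv ℝ Φ (p.1 + lam • S.chord p.2) (lam • w' p.2)
      * (F p.1 * a p.2 * H p) ∂S.fullMeasure| ≤ 2 * M * C₁ + 2 * M₁ * C := by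
  have hHint : Integrable H S.fullMeasure := by
    refine ⟨hH.measurable.aestronglyMeasurable, ?_⟩
    exact (S.lintegral_enorm_weight_le hH hμ).trans_lt ENNReal.ofReal_lt_top
  have hFa : Measurable fun p : Euc d × Y × Euc d × Euc d => F p.1 * a p.2 :=
    (hF.comp measurable_fst).mul (ha.comp measurable_snd)
  have hFaM : ∀ p : Euc d × Y × Euc d × Euc d, |F p.1 * a p.2| ≤ 2 * M := fun p => by
    rw [abs_mul]; exact mul_le_mul (hF2 _) (hM _) (abs_nonneg _) (by norm_num)
  have hA : Integrable (fun p => F p.1 * a p.2 * H p) S.fullMeasure :=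
    hHint.bdd_mul hFa.aestronglyMeasurable (Filter.Eventually.of_forall hFaM)
  have hψm : Measurable fun p : Euc d × Y × Euc d × Euc d => Φ (p.1 + lam • S.chord p.2) := by
    have h1 : Measurable fun p : Euc d × Y × Euc d × Euc d => S.chord p.2 :=
      S.measurable_chord.comp measurable_snd
    exact hΦ.continuous.measurable.comp (measurable_fst.add (h1.const_smul lam))
  have key := abs_integral_mul_le_of_flow (m := S.fullMeasure) (φ := fun t => Prod.map id (φ t))
    (fun t => S.measurePreserving_full (hφ t)) (fun t z => Prod.ext rfl (hinv t z.2))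
    (ψ := fun p => Φ (p.1 + lam • S.chord p.2))
    (ψ' := fun p => fderiv ℝ Φ (p.1 + lam • S.chord p.2) (lam • w' p.2))
    (A := fun p => F p.1 * a p.2 * H p) (L := 1) (C₁ := K * (|lam| * K₀))
    (C₂ := 2 * M * C₁ + 2 * M₁ * C) zero_le_one hψm (fun p => hΦ1 _) ?_ ?_ ?_ hA ?_
  · simpa using key
  · intro t p
    have h1 := hΦL.dist_le_mul (p.1 + lam • S.chord (φ t p.2)) (p.1 + lam • S.chord p.2)
    rw [dist_eq_norm, dist_eq_norm, add_sub_add_left_eq_sub, ← smul_sub, norm_smul,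
      Real.norm_eq_abs, Real.norm_eq_abs] at h1
    refine h1.trans ?_
    calc (K : ℝ) * (|lam| * ‖S.chord (φ t p.2) - S.chord p.2‖)
        ≤ K * (|lam| * (K₀ * |t|)) := by gcongr; exact hwlip t p.2
      _ = _ := by ring
  · intro p
    have h1 : HasDerivAt (fun t => p.1 + lam • S.chord (φ t p.2)) (lam • w' p.2) 0 :=
      ((hw p.2).const_smul lam).const_add p.1
    have h2 := (hΦ (p.1 + lam • S.chord (φ 0 p.2))).hasFDerivAt.comp_hasDerivAt (0 : ℝ) h1
    rw [hφ0] at h2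
    exact h2
  · exact fun p => Prod.ext rfl (hφ0 p.2)
  · intro t
    have h1 := integral_abs_mul_comp_sub_le (m := S.fullMeasure)
      (φ := fun p : Euc d × Y × Euc d × Euc d => (p.1, φ t p.2))
      hFa hH.measurable (S.measurePreserving_full (hφ t)).measurable (M := 2 * M)
      (M₁ := 2 * (M₁ * |t|)) (C₀ := C) (C₁ := C₁ * |t|) hFaM (fun p => ?_) (by positivity)
      (by positivity) hH.nonneg (by positivity) (S.lintegral_enorm_weight_le hH hμ) (hHφ t)
    · refine h1.trans (le_of_eq (by ring))
    · simp only [← mul_sub]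
      rw [abs_mul]
      exact mul_le_mul (hF2 _) (hM₁ t _) (abs_nonneg _) (by norm_num)

end SphereFamily

namespace SphereFamily

variable {d : ℕ} {Y : Type*} [MeasurableSpace Y] {μ : Measure Y} {κ : ℝ}
  (S : SphereFamily d Y μ κ)

/-- The transversality of the directions of the two points. -/
noncomputable def transv (s : ℝ) (z : Y × Euc d × Euc d) : ℝ :=
  transversality s (S.direction z.1 z.2.1) (S.direction z.1 z.2.2)

lemma measurable_transv (s : ℝ) : Measurable (S.transv s) := by
  have := (measurable_transversality s).comp S.measurable_direction_pair
  exact this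

variable {s : ℝ} {h : Euc d}

lemma transv_mem (hs : 0 < s) (z : Y × Euc d × Euc d) : 0 ≤ S.transv s z ∧ S.transv s z ≤ 1 :=
  transversality_mem hs

/-- Two random points of the sphere are seldom almost parallel. -/
lemma lintegral_one_sub_transv_le (hs : 0 < s) (hμ : μ Set.univ ≤ 1) :
    ∫⁻ z, ENNReal.ofReal (1 - S.transv s z) ∂S.pairMeasure
      ≤ ballConst d * ENNReal.ofReal (s * Real.pi) := by
  have hm : Measurable fun z => ENNReal.ofReal (1 - S.transv s z) :=
    (measurable_const.sub (S.measurable_transv s)).ennreal_ofReal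
  have hfib : ∀ y g, ∫⁻ g', ENNReal.ofReal (1 - S.transv s (y, g, g')) ∂(ballMeasure d)
      ≤ ballConst d * ENNReal.ofReal (s * Real.pi) := by
    intro y g
    obtain ⟨e, he, hPe, heg⟩ := S.exists_unit y (S.direction y g)
    refine le_trans (lintegral_mono_ae ?_) (lintegral_ballMeasure_cauchy_le he hs)
    filter_upwards [ae_norm_le_one] with g' hg'
    refine ENNReal.ofReal_le_ofReal ?_
    set n := tangent (S.direction y g) (S.direction y g') with hn
    have h1 : ⟪e, n⟫_ℝ = ‖S.proj y g'‖⁻¹ * ⟪e, g'⟫_ℝ := by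
      rw [hn, tangent, inner_sub_right, inner_smul_right, heg, mul_zero, sub_zero, direction, dir,
        inner_smul_right, ← S.inner_proj, hPe]
    have h2 : ⟪e, g'⟫_ℝ ^ 2 ≤ ‖n‖ ^ 2 := by
      have h3 : |⟪e, n⟫_ℝ| ≤ ‖n‖ := (abs_real_inner_le_norm _ _).trans (by rw [he, one_mul])
      have h4 : |⟪e, g'⟫_ℝ| ≤ ‖n‖ := by
        rcases eq_or_ne (S.proj y g') 0 with h0 | h0
        · rw [← hPe, S.inner_proj, h0, inner_zero_right, abs_zero]; exact norm_nonneg _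
        · refine le_trans ?_ h3
          rw [h1, abs_mul, abs_inv, abs_norm]
          refine le_mul_of_one_le_left (abs_nonneg _) ?_
          exact (one_le_inv₀ (norm_pos_iff.2 h0)).2 ((S.norm_proj_le _ _).trans hg')
      rw [← sq_abs]
      gcongr
    have h5 : 1 - S.transv s (y, g, g') = s ^ 2 / (‖n‖ ^ 2 + s ^ 2) := by
      have : ‖n‖ ^ 2 + s ^ 2 ≠ 0 := by positivity
      simp only [transv, transversality, ← hn]
      field_simp
      ring
    rw [h5]
    gcongr
  have hm1 : ∀ y, Measurable fun p : Euc d × Euc d => ENNReal.ofReal (1 - S.transv s (y, p)) :=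
    fun y => by
      have h1 : Measurable fun p : Euc d × Euc d => (y, p) := measurable_prodMk_left
      have h2 := hm.comp h1
      exact h2
  rw [pairMeasure, lintegral_prod _ hm.aemeasurable]
  calc ∫⁻ y, ∫⁻ p, ENNReal.ofReal (1 - S.transv s (y, p))
        ∂((ballMeasure d).prod (ballMeasure d)) ∂μ
      ≤ ∫⁻ _, ballConst d * ENNReal.ofReal (s * Real.pi) ∂μ := by
        refine lintegral_mono fun y => ?_
        rw [lintegral_prod _ (hm1 y).aemeasurable]
        exact (lintegral_mono fun g => hfib y g).trans (by simp)
    _ = ballConst d * ENNReal.ofReal (s * Real.pi) * μ Set.univ := lintegral_const _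
    _ ≤ _ := mul_le_of_le_one_right' hμ

variable [IsFiniteMeasure μ] {H : Euc d × Y × Euc d × Euc d → ℝ} {C : ℝ}

lemma integrable_weight (hH : S.IsWeight H C) (hμ : μ Set.univ ≤ 1) :
    Integrable H S.fullMeasure :=
  ⟨hH.measurable.aestronglyMeasurable,
    (S.lintegral_enorm_weight_le hH hμ).trans_lt ENNReal.ofReal_lt_top⟩

/-- Pairs of almost parallel points contribute little. -/
lemma abs_integral_one_sub_transv_le (hs : 0 < s) (hH : S.IsWeight H C) (hμ : μ Set.univ ≤ 1)
    {G : Euc d × Y × Euc d × Euc d → ℝ} (hG : ∀ p, |G p| ≤ 4) :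
    |∫ p, G p * (1 - S.transv s p.2) * H p ∂S.fullMeasure|
      ≤ 4 * C * ((ballConst d).toReal * (s * Real.pi)) := by
  have hpi := Real.pi_pos
  have h0 := hH.nonneg
  rw [← Real.norm_eq_abs, ← toReal_enorm]
  refine ENNReal.toReal_le_of_le_ofReal (by positivity) ?_
  have hm : Measurable fun z => ENNReal.ofReal (1 - S.transv s z) :=
    (measurable_const.sub (S.measurable_transv s)).ennreal_ofReal
  calc ‖∫ p, G p * (1 - S.transv s p.2) * H p ∂S.fullMeasure‖ₑ
      ≤ ∫⁻ p, ‖G p * (1 - S.transv s p.2) * H p‖ₑ ∂S.fullMeasure :=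
        enorm_integral_le_lintegral_enorm _
    _ ≤ ∫⁻ p, 4 * (ENNReal.ofReal (1 - S.transv s p.2) * ‖H p‖ₑ) ∂S.fullMeasure := by
        refine lintegral_mono fun p => ?_
        rw [enorm_mul, enorm_mul, mul_assoc]
        gcongr
        · rw [← ofReal_norm, Real.norm_eq_abs, show (4 : ℝ≥0∞) = ENNReal.ofReal 4 by simp]
          exact ENNReal.ofReal_le_ofReal (hG p)
        · rw [Real.enorm_of_nonneg (sub_nonneg.2 (S.transv_mem hs p.2).2)]
    _ = 4 * ∫⁻ z, ∫⁻ u, ENNReal.ofReal (1 - S.transv s z) * ‖H (u, z)‖ₑ ∂volume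
          ∂S.pairMeasure := by
        have hm' : Measurable fun p : Euc d × Y × Euc d × Euc d =>
            ENNReal.ofReal (1 - S.transv s p.2) * ‖H p‖ₑ :=
          (hm.comp measurable_snd).mul hH.measurable.enorm
        rw [lintegral_const_mul _ hm', fullMeasure, lintegral_prod_symm _ hm'.aemeasurable]
    _ ≤ 4 * ∫⁻ z, ENNReal.ofReal (1 - S.transv s z) * ENNReal.ofReal C ∂S.pairMeasure := by
        gcongr with z
        have hHz : Measurable fun u => ‖H (u, z)‖ₑ :=
          (hH.measurable.comp measurable_prodMk_right).enorm
        rw [lintegral_const_mul _ hHz]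
        gcongr
        exact hH.fiber z
    _ = 4 * ((∫⁻ z, ENNReal.ofReal (1 - S.transv s z) ∂S.pairMeasure) * ENNReal.ofReal C) := by
        rw [lintegral_mul_const _ hm]
    _ ≤ 4 * (ballConst d * ENNReal.ofReal (s * Real.pi) * ENNReal.ofReal C) := by
        gcongr; exact S.lintegral_one_sub_transv_le hs hμ
    _ = _ := by
        rw [← ENNReal.ofReal_toReal (ballConst_ne_top (d := d)),
          show (4 : ℝ≥0∞) = ENNReal.ofReal 4 by simp,
          ← ENNReal.ofReal_mul (by positivity), ← ENNReal.ofReal_mul (by positivity),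
          ← ENNReal.ofReal_mul (by positivity), ENNReal.toReal_ofReal (by positivity)]
        congr 1
        ring

variable {F : Euc d → ℝ} {Φ : Euc d → ℝ} {K : NNReal} {lam : ℝ}

/-- Integration by parts along the rotations of space. -/
lemma abs_integral_rotate_le (hs : 0 < s) (hH : S.IsWeight H C) (hμ : μ Set.univ ≤ 1)
    (hF : Measurable F) (hF2 : ∀ u, |F u| ≤ 2) (hΦ : Differentiable ℝ Φ) (hΦ1 : ∀ z, |Φ z| ≤ 1)
    (hΦL : LipschitzWith K Φ) {e : Euc d} (he : ‖e‖ ≤ 1) :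
    |∫ p : Euc d × Y × Euc d × Euc d, fderiv ℝ Φ (p.1 + lam • S.chord p.2)
      (lam • wedge e h (S.chord p.2)) * (F p.1 * S.rotCoeff s e p.2 * H p) ∂S.fullMeasure|
      ≤ 12 * κ⁻¹ * s⁻¹ * ‖h‖ * C := by
  have h0 := S.pos
  have hC := hH.nonneg
  refine (S.abs_integral_deriv_le hH hμ (φ := fun t => S.rotate (wedgeRot t e h))
    (fun t => S.measurePreserving_rotate _) (fun t z => S.rotate_rotate_neg t e h z)
    (fun z => S.rotate_zero e h z) (w' := fun z => wedge e h (S.chord z))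
    (K₀ := 2 * 1 * ‖h‖ * (2 * κ⁻¹)) ?_ ?_ hF hF2 (S.measurable_rotCoeff s e)
    (M := κ⁻¹ * (2 * s⁻¹)) (M₁ := κ⁻¹ * (2 * ‖h‖ * (2 * s⁻¹))) (C₁ := C * ‖h‖)
    (fun z => S.abs_rotCoeff_le hs he z) (by positivity) (by positivity) (by positivity)
    (fun t z => ?_) (fun t => ?_) hΦ hΦ1 hΦL lam).trans (le_of_eq (by ring))
  · intro z
    simp only [chord_rotate]
    exact hasDerivAt_wedgeRot_zero e h _
  · intro t z
    rw [chord_rotate]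
    refine (norm_wedgeRot_sub_le _ _ _ _).trans ?_
    gcongr
    exact S.norm_chord_le z
  · refine (S.abs_rotCoeff_rotate_sub_le hs he t z).trans (le_of_eq (by ring))
  · refine (hH.rotate t e h).trans (ENNReal.ofReal_le_ofReal ?_)
    gcongr
    exact mul_le_of_le_one_right hC he

/-- Integration by parts along the rotations of the second point within the sphere. -/
lemma abs_integral_slide_le (hs : 0 < s) (hs1 : s ≤ 1) (hH : S.IsWeight H C)
    (hμ : μ Set.univ ≤ 1) (hF : Measurable F) (hF2 : ∀ u, |F u| ≤ 2) (hΦ : Differentiable ℝ Φ)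
    (hΦ1 : ∀ z, |Φ z| ≤ 1) (hΦL : LipschitzWith K Φ) {e : Euc d} (he : ‖e‖ ≤ 1) :
    |∫ p : Euc d × Y × Euc d × Euc d, fderiv ℝ Φ (p.1 + lam • S.chord p.2)
      (lam • -(S.rad p.2.1 • wedge (S.proj p.2.1 e) (S.direction p.2.1 p.2.2.1)
        (S.direction p.2.1 p.2.2.2))) * (F p.1 * S.slideCoeff s h e p.2 * H p) ∂S.fullMeasure|
      ≤ (4 * κ⁻¹ ^ 3 * s⁻¹ + 52 * κ⁻¹ ^ 3 * s⁻¹ ^ 2) * ‖h‖ * C := by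
  have h0 := S.pos
  have hC := hH.nonneg
  refine (S.abs_integral_deriv_le hH hμ (φ := S.slide e)
    (fun t => S.measurePreserving_slide e t) (fun t z => S.slide_slide_neg e t z)
    (fun z => S.slide_zero e z) (w' := fun z => -(S.rad z.1 • wedge (S.proj z.1 e)
      (S.direction z.1 z.2.1) (S.direction z.1 z.2.2)))
    (K₀ := κ⁻¹ * 2) ?_ ?_ hF hF2 (S.measurable_slideCoeff s h e)
    (M := ‖h‖ * (2 * κ⁻¹) * (κ⁻¹ ^ 2 * s⁻¹)) (M₁ := ‖h‖ * (26 * κ⁻¹ ^ 3 * s⁻¹ ^ 2)) (C₁ := C)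
    (fun z => S.abs_slideCoeff_le hs he z) (by positivity) (by positivity) hC
    (fun t z => S.abs_slideCoeff_slide_sub_le hs hs1 he t z) (fun t => hH.slide t e he)
    hΦ hΦ1 hΦL lam).trans (le_of_eq (by ring))
  · intro z
    simp only [chord_slide]
    have h1 := (hasDerivAt_wedgeRot_zero (S.proj z.1 e) (S.direction z.1 z.2.1)
      (S.direction z.1 z.2.2)).const_sub (S.direction z.1 z.2.1)
    have h2 := h1.const_smul (S.rad z.1)
    rwa [smul_neg] at h2
  · intro t z
    exact (S.norm_chord_slide_sub_le he t z).trans (le_of_eq (by ring))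

/-- Integration of a bounded vector field along the derivative of `Φ` against the weight. -/
lemma integrable_fderiv_mul (hH : S.IsWeight H C) (hμ : μ Set.univ ≤ 1) (hΦ : ContDiff ℝ 1 Φ)
    (hΦL : LipschitzWith K Φ) {v : Y × Euc d × Euc d → Euc d} (hv : Measurable v) {M : ℝ}
    (hM : ∀ z, ‖v z‖ ≤ M) {a : Euc d × Y × Euc d × Euc d → ℝ} (ha : Measurable a) {M' : ℝ}
    (hM' : ∀ p, |a p| ≤ M') :
    Integrable (fun p : Euc d × Y × Euc d × Euc d =>
      fderiv ℝ Φ (p.1 + lam • S.chord p.2) (v p.2) * (a p * H p)) S.fullMeasure := by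
  have hc : Continuous fun q : Euc d × Euc d => fderiv ℝ Φ q.1 q.2 :=
    (hΦ.continuous_fderiv (by simp)).fst'.clm_apply continuous_snd
  have h1 : Measurable fun p : Euc d × Y × Euc d × Euc d => S.chord p.2 :=
    S.measurable_chord.comp measurable_snd
  have h2 : Measurable fun p : Euc d × Y × Euc d × Euc d => v p.2 := hv.comp measurable_snd
  have hm : Measurable fun p : Euc d × Y × Euc d × Euc d =>
      fderiv ℝ Φ (p.1 + lam • S.chord p.2) (v p.2) :=
    hc.measurable.comp ((measurable_fst.add (h1.const_smul lam)).prodMk h2)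
  refine ((S.integrable_weight hH hμ).bdd_mul ha.aestronglyMeasurable
    (Filter.Eventually.of_forall hM')).bdd_mul (c := K * M) hm.aestronglyMeasurable
    (Filter.Eventually.of_forall fun p => ?_)
  refine (ContinuousLinearMap.le_opNorm _ _).trans ?_
  exact mul_le_mul (norm_fderiv_le_of_lipschitz ℝ hΦL) (hM _) (norm_nonneg _) K.2

variable (d κ C) in
/-- The constant in the estimate for the transversal part: the sum over a basis of the constants of
`abs_integral_rotate_le` and `abs_integral_slide_le`. -/
noncomputable def derivConst : ℝ := d * ((12 * κ⁻¹ + 56 * κ⁻¹ ^ 3) * C)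

/-- The transversal part of the average of a derivative is small. -/
lemma abs_integral_fderiv_transv_le (hs : 0 < s) (hs1 : s ≤ 1) (hH : S.IsWeight H C)
    (hμ : μ Set.univ ≤ 1) (hF : Measurable F) (hF2 : ∀ u, |F u| ≤ 2) (hΦ : ContDiff ℝ 1 Φ)
    (hΦ1 : ∀ z, |Φ z| ≤ 1) (hΦL : LipschitzWith K Φ) (hlam : 0 < lam) (h : Euc d) :
    |∫ p : Euc d × Y × Euc d × Euc d, fderiv ℝ Φ (p.1 + lam • S.chord p.2) h
      * (F p.1 * S.transv s p.2 * H p) ∂S.fullMeasure|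
      ≤ derivConst d κ C * (lam⁻¹ * ‖h‖ * s⁻¹ ^ 2) := by
  have h0 := S.pos
  have hC := hH.nonneg
  have h1s : 1 ≤ s⁻¹ := (one_le_inv₀ hs).2 hs1
  set b := EuclideanSpace.basisFun (Fin d) ℝ with hb
  have hbn : ∀ i, ‖b i‖ ≤ 1 := fun i => (b.norm_eq_one i).le
  set A : Fin d → Euc d × Y × Euc d × Euc d → ℝ := fun i p =>
    fderiv ℝ Φ (p.1 + lam • S.chord p.2)
      (lam • -(S.rad p.2.1 • wedge (S.proj p.2.1 (b i)) (S.direction p.2.1 p.2.2.1)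
        (S.direction p.2.1 p.2.2.2))) * (F p.1 * S.slideCoeff s h (b i) p.2 * H p) with hA
  set B : Fin d → Euc d × Y × Euc d × Euc d → ℝ := fun i p =>
    fderiv ℝ Φ (p.1 + lam • S.chord p.2)
      (lam • wedge (b i) h (S.chord p.2)) * (F p.1 * S.rotCoeff s (b i) p.2 * H p) with hB
  have hFm : Measurable fun p : Euc d × Y × Euc d × Euc d => F p.1 := hF.comp measurable_fst
  have hwm : ∀ (f₁ f₂ f₃ : Y × Euc d × Euc d → Euc d), Measurable f₁ → Measurable f₂ →
      Measurable f₃ → Measurable fun z => wedge (f₁ z) (f₂ z) (f₃ z) := by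
    intro f₁ f₂ f₃ m1 m2 m3
    simp only [wedge_apply]
    exact ((m1.inner (𝕜 := ℝ) m3).smul m2).sub ((m2.inner (𝕜 := ℝ) m3).smul m1)
  have hcoef : ∀ {a : Y × Euc d × Euc d → ℝ}, Measurable a →
      Measurable fun p : Euc d × Y × Euc d × Euc d => F p.1 * a p.2 := fun ha =>
    hFm.mul (ha.comp measurable_snd)
  have hAi : ∀ i, Integrable (A i) S.fullMeasure := by
    intro i
    have hp : Measurable fun z : Y × Euc d × Euc d => S.proj z.1 (b i) := by
      have h1 : Measurable fun z : Y × Euc d × Euc d => (z.1, b i) :=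
        measurable_fst.prodMk measurable_const
      have h2 := S.measurable_proj.comp h1
      exact h2
    have hr : Measurable fun z : Y × Euc d × Euc d => S.rad z.1 :=
      S.measurable_rad.comp measurable_fst
    refine S.integrable_fderiv_mul hH hμ hΦ hΦL (M := |lam| * (κ⁻¹ * 2))
      (v := fun z => lam • -(S.rad z.1 • wedge (S.proj z.1 (b i)) (S.direction z.1 z.2.1)
        (S.direction z.1 z.2.2)))
      ((hr.smul (hwm _ _ _ hp S.measurable_direction_fst
        S.measurable_direction_snd)).neg.const_smul lam) (fun z => ?_)
      (hcoef (S.measurable_slideCoeff s h (b i)))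
      (M' := 2 * (‖h‖ * (2 * κ⁻¹) * (κ⁻¹ ^ 2 * s⁻¹))) (fun p => ?_)
    · rw [norm_smul, norm_neg, norm_smul, Real.norm_eq_abs, Real.norm_of_nonneg (S.rad_pos _).le]
      refine mul_le_mul_of_nonneg_left (mul_le_mul (S.rad_le _) ?_ (norm_nonneg _)
        (by positivity)) (abs_nonneg _)
      refine (norm_wedge_apply_le _ _ _).trans ?_
      have h1 := (S.norm_proj_le z.1 (b i)).trans (hbn i)
      have h2 := S.norm_direction_le z.1 z.2.1
      have h3 := S.norm_direction_le z.1 z.2.2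
      calc _ ≤ 2 * 1 * 1 * (1 : ℝ) := by gcongr
        _ = 2 := by norm_num
    · rw [abs_mul]
      exact mul_le_mul (hF2 _) (S.abs_slideCoeff_le hs (hbn i) _) (abs_nonneg _) (by norm_num)
  have hBi : ∀ i, Integrable (B i) S.fullMeasure := by
    intro i
    refine S.integrable_fderiv_mul hH hμ hΦ hΦL (M := |lam| * (2 * 1 * ‖h‖ * (2 * κ⁻¹)))
      (v := fun z => lam • wedge (b i) h (S.chord z))
      ((hwm _ _ _ measurable_const measurable_const S.measurable_chord).const_smul lam)
      (fun z => ?_) (hcoef (S.measurable_rotCoeff s (b i)))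
      (M' := 2 * (κ⁻¹ * (2 * s⁻¹))) (fun p => ?_)
    · rw [norm_smul, Real.norm_eq_abs]
      refine mul_le_mul_of_nonneg_left ((norm_wedge_apply_le _ _ _).trans ?_) (abs_nonneg _)
      have h1 := hbn i
      have h2 := S.norm_chord_le z
      gcongr
    · rw [abs_mul]
      exact mul_le_mul (hF2 _) (S.abs_rotCoeff_le hs (hbn i) _) (abs_nonneg _) (by norm_num)
  have hne : ∀ᵐ z ∂S.pairMeasure, S.proj z.1 z.2.1 ≠ 0 ∧ S.proj z.1 z.2.2 ≠ 0 := by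
    have hms : MeasurableSet {p : Y × Euc d | S.proj p.1 p.2 ≠ 0} :=
      (S.measurable_proj (measurableSet_singleton 0)).compl
    exact S.ae_pairMeasure hms S.ae_proj_ne_zero
  have hid : ∀ᵐ p ∂S.fullMeasure, lam * (fderiv ℝ Φ (p.1 + lam • S.chord p.2) h
      * (F p.1 * S.transv s p.2 * H p)) = ∑ i, A i p + ∑ i, B i p := by
    have hq : Measure.QuasiMeasurePreserving (Prod.snd : Euc d × Y × Euc d × Euc d → _)
        S.fullMeasure S.pairMeasure := Measure.quasiMeasurePreserving_snd
    filter_upwards [hq.ae hne] with p hp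
    have key := transversality_smul_eq (s := s) b (P := S.proj p.2.1) (norm_dir hp.1)
      (S.proj_direction p.2.1 p.2.2.1) (S.proj_direction p.2.1 p.2.2.2) (S.rad_pos p.2.1) h
    have key2 := congrArg (fderiv ℝ Φ (p.1 + lam • S.chord p.2)) key
    rw [map_smul, map_add, map_sum, map_sum] at key2
    simp only [map_smul, smul_eq_mul] at key2
    have e1 : lam * (fderiv ℝ Φ (p.1 + lam • S.chord p.2) h * (F p.1 * S.transv s p.2 * H p))
        = lam * F p.1 * H p * (S.transv s p.2 * fderiv ℝ Φ (p.1 + lam • S.chord p.2) h) := by ring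
    rw [e1]
    change lam * F p.1 * H p * (transversality s (dir (S.proj p.2.1 p.2.2.1))
      (S.direction p.2.1 p.2.2.2) * _) = _
    rw [key2, mul_add, Finset.mul_sum, Finset.mul_sum]
    congr 1
    · refine Finset.sum_congr rfl fun i _ => ?_
      simp only [hA, map_smul, smul_eq_mul, slideCoeff, chord, direction]
      ring
    · refine Finset.sum_congr rfl fun i _ => ?_
      simp only [hB, map_smul, smul_eq_mul, rotCoeff, chord, direction]
      ring
  have hsum : lam * ∫ p : Euc d × Y × Euc d × Euc d, fderiv ℝ Φ (p.1 + lam • S.chord p.2) h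
      * (F p.1 * S.transv s p.2 * H p) ∂S.fullMeasure
      = ∑ i, ∫ p, A i p ∂S.fullMeasure + ∑ i, ∫ p, B i p ∂S.fullMeasure := by
    rw [← integral_const_mul, integral_congr_ae hid, integral_add
      (integrable_finsetSum _ fun i _ => hAi i) (integrable_finsetSum _ fun i _ => hBi i),
      integral_finsetSum _ fun i _ => hAi i, integral_finsetSum _ fun i _ => hBi i]
  have hΦd := hΦ.differentiable (by simp)
  have hbound : |lam * ∫ p : Euc d × Y × Euc d × Euc d, fderiv ℝ Φ (p.1 + lam • S.chord p.2) h
      * (F p.1 * S.transv s p.2 * H p) ∂S.fullMeasure|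
      ≤ ∑ _i : Fin d, (4 * κ⁻¹ ^ 3 * s⁻¹ + 52 * κ⁻¹ ^ 3 * s⁻¹ ^ 2) * ‖h‖ * C
        + ∑ _i : Fin d, 12 * κ⁻¹ * s⁻¹ * ‖h‖ * C := by
    rw [hsum]
    refine (abs_add_le _ _).trans (add_le_add ?_ ?_)
    · exact (Finset.abs_sum_le_sum_abs _ _).trans (Finset.sum_le_sum fun i _ =>
        S.abs_integral_slide_le hs hs1 hH hμ hF hF2 hΦd hΦ1 hΦL (hbn i))
    · exact (Finset.abs_sum_le_sum_abs _ _).trans (Finset.sum_le_sum fun i _ =>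
        S.abs_integral_rotate_le hs hH hμ hF hF2 hΦd hΦ1 hΦL (hbn i))
  rw [abs_mul, abs_of_pos hlam] at hbound
  rw [← mul_le_mul_iff_right₀ hlam]
  refine hbound.trans ?_
  simp only [Finset.sum_const, Finset.card_univ, Fintype.card_fin, nsmul_eq_mul]
  have e2 : lam * (derivConst d κ C * (lam⁻¹ * ‖h‖ * s⁻¹ ^ 2))
      = derivConst d κ C * (‖h‖ * s⁻¹ ^ 2) := by field_simp
  have h2s : s⁻¹ ≤ s⁻¹ ^ 2 := by nlinarith
  rw [e2, derivConst]
  calc d * ((4 * κ⁻¹ ^ 3 * s⁻¹ + 52 * κ⁻¹ ^ 3 * s⁻¹ ^ 2) * ‖h‖ * C)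
        + d * (12 * κ⁻¹ * s⁻¹ * ‖h‖ * C)
      ≤ d * ((4 * κ⁻¹ ^ 3 * s⁻¹ ^ 2 + 52 * κ⁻¹ ^ 3 * s⁻¹ ^ 2) * ‖h‖ * C)
        + d * (12 * κ⁻¹ * s⁻¹ ^ 2 * ‖h‖ * C) := by gcongr
    _ = _ := by ring

end SphereFamily

/-- Approximation of a bounded measurable function of compact support by smooth ones with the same
bound. -/
lemma exists_smooth_approx {d : ℕ} {f : Euc d → ℝ} (hf : Measurable f) (hf1 : ∀ z, |f z| ≤ 1)
    (hc : HasCompactSupport f) :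
    ∃ φ : ℕ → Euc d → ℝ, (∀ i, ContDiff ℝ 1 (φ i)) ∧ (∀ i, ∃ K, LipschitzWith K (φ i)) ∧
      (∀ i z, |φ i z| ≤ 1) ∧
      ∀ᵐ z, Filter.Tendsto (fun i => φ i z) Filter.atTop (nhds (f z)) := by
  have hli : LocallyIntegrable f volume := by
    intro x
    refine ⟨Metric.closedBall x 1, Metric.closedBall_mem_nhds x one_pos, ?_⟩
    exact Measure.integrableOn_of_bounded (M := 1)
      (isCompact_closedBall x 1).measure_lt_top.ne hf.aestronglyMeasurable
      (Filter.Eventually.of_forall hf1)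
  set ψ : ℕ → ContDiffBump (0 : Euc d) := fun i =>
    ⟨(1 / 2) * (1 / ((i : ℝ) + 1)), 1 / ((i : ℝ) + 1), by positivity, by
      have : 0 < 1 / ((i : ℝ) + 1) := by positivity
      linarith⟩ with hψ
  have hcs : ∀ i, HasCompactSupport ((ψ i).normed volume) := fun i => (ψ i).hasCompactSupport_normed
  have hsm : ∀ i, ContDiff ℝ 1 ((ψ i).normed volume ⋆[ContinuousLinearMap.lsmul ℝ ℝ, volume] f) :=
    fun i => (hcs i).contDiff_convolution_left _ (ψ i).contDiff_normed hli
  refine ⟨fun i => (ψ i).normed volume ⋆[ContinuousLinearMap.lsmul ℝ ℝ, volume] f, hsm,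
    fun i => ?_, fun i z => ?_, ?_⟩
  · exact (hsm i).lipschitzWith_of_hasCompactSupport ((hcs i).convolution _ hc) (by simp)
  · rw [← Real.norm_eq_abs]
    calc _ ≤ ∫ t, ‖(ψ i).normed volume t • f (z - t)‖ := norm_integral_le_integral_norm _
      _ ≤ ∫ t, (ψ i).normed volume t := by
          refine integral_mono_of_nonneg (Filter.Eventually.of_forall fun _ => norm_nonneg _)
            (ψ i).integrable_normed (Filter.Eventually.of_forall fun t => ?_)
          simp only
          rw [norm_smul, Real.norm_of_nonneg ((ψ i).nonneg_normed t)]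
          exact mul_le_of_le_one_right ((ψ i).nonneg_normed t) (hf1 _)
      _ = 1 := (ψ i).integral_normed
  · refine ContDiffBump.ae_convolution_tendsto_right_of_locallyIntegrable (K := 2) ?_ ?_ hli
    · exact tendsto_one_div_add_atTop_nhds_zero_nat
    · refine Filter.Eventually.of_forall fun i => le_of_eq ?_
      simp only [hψ]; ring

namespace SphereFamily

variable {d : ℕ} {Y : Type*} [MeasurableSpace Y] {μ : Measure Y} {κ : ℝ}
  (S : SphereFamily d Y μ κ) {s : ℝ} {h : Euc d}
  {H : Euc d × Y × Euc d × Euc d → ℝ} {C : ℝ} {F : Euc d → ℝ} {lam : ℝ}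

variable (d κ C) in
/-- The constant in the estimate for oscillating averages: the contributions of the parallel and of the
transversal pairs. -/
noncomputable def pairConst : ℝ := 4 * C * ((ballConst d).toReal * Real.pi) + derivConst d κ C

include S in
lemma derivConst_nonneg (hC : 0 ≤ C) : 0 ≤ derivConst d κ C := by
  have := S.pos
  unfold derivConst; positivity

lemma measurable_shift : Measurable fun p : Euc d × Y × Euc d × Euc d => p.1 + lam • S.chord p.2 := by
  have h1 : Measurable fun p : Euc d × Y × Euc d × Euc d => S.chord p.2 :=
    S.measurable_chord.comp measurable_snd
  exact measurable_fst.add (h1.const_smul lam)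

variable [IsFiniteMeasure μ]

/-- The average of a difference `φ(z) - φ(z - h)` is small, for smooth `φ`. -/
lemma abs_integral_sub_le_of_contDiff (hs : 0 < s) (hs1 : s ≤ 1) (hH : S.IsWeight H C)
    (hμ : μ Set.univ ≤ 1) (hF : Measurable F) (hF2 : ∀ u, |F u| ≤ 2) {φ : Euc d → ℝ}
    (hφ : ContDiff ℝ 1 φ) (hφ1 : ∀ z, |φ z| ≤ 1) {K : NNReal} (hφL : LipschitzWith K φ)
    (hlam : 0 < lam) (h : Euc d) :
    |∫ p : Euc d × Y × Euc d × Euc d, F p.1 *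
      (φ (p.1 + lam • S.chord p.2) - φ (p.1 + lam • S.chord p.2 - h)) * H p ∂S.fullMeasure|
      ≤ pairConst d κ C * (s + lam⁻¹ * ‖h‖ * s⁻¹ ^ 2) := by
  have hC := hH.nonneg
  have hD := S.derivConst_nonneg hC
  have hpi := Real.pi_pos
  set sh : Euc d × Y × Euc d × Euc d → Euc d := fun p => p.1 + lam • S.chord p.2 with hsh
  have hshm : Measurable sh := S.measurable_shift
  have hHint := S.integrable_weight hH hμ
  have hFm : Measurable fun p : Euc d × Y × Euc d × Euc d => F p.1 := hF.comp measurable_fst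
  have htm : Measurable fun p : Euc d × Y × Euc d × Euc d => S.transv s p.2 :=
    (S.measurable_transv s).comp measurable_snd
  have hGm : Measurable fun p => F p.1 * (φ (sh p) - φ (sh p - h)) :=
    hFm.mul ((hφ.continuous.measurable.comp hshm).sub
      (hφ.continuous.measurable.comp (hshm.sub_const h)))
  have hG4 : ∀ p, |F p.1 * (φ (sh p) - φ (sh p - h))| ≤ 4 := fun p => by
    rw [abs_mul]
    have h1 : |φ (sh p) - φ (sh p - h)| ≤ 2 := (abs_sub _ _).trans
      (by linarith [hφ1 (sh p), hφ1 (sh p - h)])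
    calc _ ≤ (2 : ℝ) * 2 := mul_le_mul (hF2 _) h1 (abs_nonneg _) (by norm_num)
      _ = 4 := by norm_num
  have hT1 : ∀ p : Euc d × Y × Euc d × Euc d, |S.transv s p.2| ≤ 1 := fun p => by
    rw [abs_of_nonneg (S.transv_mem hs p.2).1]; exact (S.transv_mem hs p.2).2
  have hI1 : Integrable (fun p => F p.1 * (φ (sh p) - φ (sh p - h)) * (1 - S.transv s p.2) * H p)
      S.fullMeasure := by
    refine hHint.bdd_mul (c := 4 * 1) (hGm.mul (measurable_const.sub htm)).aestronglyMeasurable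
      (Filter.Eventually.of_forall fun p => ?_)
    rw [norm_mul]
    refine mul_le_mul (hG4 p) ?_ (norm_nonneg _) (by norm_num)
    rw [Real.norm_of_nonneg (sub_nonneg.2 (S.transv_mem hs p.2).2)]
    linarith [(S.transv_mem hs p.2).1]
  have hI2 : Integrable (fun p => F p.1 * (φ (sh p) - φ (sh p - h)) * S.transv s p.2 * H p)
      S.fullMeasure := by
    refine hHint.bdd_mul (c := 4 * 1) (hGm.mul htm).aestronglyMeasurable
      (Filter.Eventually.of_forall fun p => ?_)
    rw [norm_mul]
    exact mul_le_mul (hG4 p) (hT1 p) (norm_nonneg _) (by norm_num)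
  have hsplit : ∫ p, F p.1 * (φ (sh p) - φ (sh p - h)) * H p ∂S.fullMeasure
      = ∫ p, F p.1 * (φ (sh p) - φ (sh p - h)) * (1 - S.transv s p.2) * H p ∂S.fullMeasure
        + ∫ p, F p.1 * (φ (sh p) - φ (sh p - h)) * S.transv s p.2 * H p ∂S.fullMeasure := by
    rw [← integral_add hI1 hI2]
    refine integral_congr_ae (Filter.Eventually.of_forall fun p => ?_)
    simp only; ring
  have hcf : Continuous fun q : Euc d × Euc d => fderiv ℝ φ q.1 q.2 :=
    (hφ.continuous_fderiv (by simp)).fst'.clm_apply continuous_snd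
  have hftc : ∀ z, φ z - φ (z - h) = ∫ τ in (0 : ℝ)..1, fderiv ℝ φ (z - τ • h) h := by
    intro z
    have hd : ∀ τ : ℝ, HasDerivAt (fun τ : ℝ => -φ (z - τ • h)) (fderiv ℝ φ (z - τ • h) h) τ := by
      intro τ
      have h1 : HasDerivAt (fun τ : ℝ => z - τ • h) (-h) τ := by
        simpa using ((hasDerivAt_id τ).smul_const h).const_sub z
      have h2 := ((hφ.differentiable (by simp) (z - τ • h)).hasFDerivAt.comp_hasDerivAt τ h1).neg
      rw [map_neg, neg_neg] at h2
      exact h2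
    have hc : Continuous fun τ : ℝ => fderiv ℝ φ (z - τ • h) h :=
      hcf.comp ((continuous_const.sub (continuous_id.smul continuous_const)).prodMk
        continuous_const)
    rw [intervalIntegral.integral_eq_sub_of_hasDerivAt (fun τ _ => hd τ)
      (hc.intervalIntegrable _ _)]
    simp; ring
  set ν : Measure ℝ := volume.restrict (Set.Ioc 0 1) with hν
  have hmain : |∫ p, F p.1 * (φ (sh p) - φ (sh p - h)) * S.transv s p.2 * H p ∂S.fullMeasure|
      ≤ derivConst d κ C * (lam⁻¹ * ‖h‖ * s⁻¹ ^ 2) := by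
    have e1 : ∫ p, F p.1 * (φ (sh p) - φ (sh p - h)) * S.transv s p.2 * H p ∂S.fullMeasure
        = ∫ p, ∫ τ, fderiv ℝ φ (sh p - τ • h) h * (F p.1 * S.transv s p.2 * H p) ∂ν
          ∂S.fullMeasure := by
      refine integral_congr_ae (Filter.Eventually.of_forall fun p => ?_)
      simp only
      rw [integral_mul_const, hftc, intervalIntegral.integral_of_le zero_le_one]
      ring
    have hint : Integrable (Function.uncurry fun (p : Euc d × Y × Euc d × Euc d) (τ : ℝ) =>
        fderiv ℝ φ (sh p - τ • h) h * (F p.1 * S.transv s p.2 * H p)) (S.fullMeasure.prod ν) := by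
      have h1 : Integrable (fun q : (Euc d × Y × Euc d × Euc d) × ℝ => H q.1)
          (S.fullMeasure.prod ν) := hHint.comp_fst ν
      have h2 : Integrable (fun q : (Euc d × Y × Euc d × Euc d) × ℝ =>
          F q.1.1 * S.transv s q.1.2 * H q.1) (S.fullMeasure.prod ν) := by
        refine h1.bdd_mul (c := 2 * 1) ((hFm.mul htm).comp measurable_fst).aestronglyMeasurable
          (Filter.Eventually.of_forall fun q => ?_)
        rw [norm_mul]
        exact mul_le_mul (hF2 _) (hT1 q.1) (norm_nonneg _) (by norm_num)
      have hm : Measurable fun q : (Euc d × Y × Euc d × Euc d) × ℝ =>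
          fderiv ℝ φ (sh q.1 - q.2 • h) h :=
        hcf.measurable.comp (((hshm.comp measurable_fst).sub (measurable_snd.smul_const h)).prodMk
          measurable_const)
      refine h2.bdd_mul (c := K * ‖h‖) hm.aestronglyMeasurable
        (Filter.Eventually.of_forall fun q => ?_)
      exact (ContinuousLinearMap.le_opNorm _ _).trans
        (mul_le_mul_of_nonneg_right (norm_fderiv_le_of_lipschitz ℝ hφL) (norm_nonneg _))
    rw [e1, integral_integral_swap hint]
    have hb : ∀ τ : ℝ, ‖∫ p, fderiv ℝ φ (sh p - τ • h) h * (F p.1 * S.transv s p.2 * H p)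
        ∂S.fullMeasure‖ ≤ derivConst d κ C * (lam⁻¹ * ‖h‖ * s⁻¹ ^ 2) := by
      intro τ
      have hL : LipschitzWith K fun z => φ (z - τ • h) := by
        refine LipschitzWith.of_dist_le_mul fun z z' => ?_
        have := hφL.dist_le_mul (z - τ • h) (z' - τ • h)
        rwa [dist_sub_right] at this
      have key := S.abs_integral_fderiv_transv_le hs hs1 hH hμ hF hF2
        (Φ := fun z => φ (z - τ • h)) (hφ.comp (contDiff_id.sub contDiff_const))
        (fun z => hφ1 _) hL hlam h
      simp only [fderiv_comp_sub] at key
      exact key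
    refine (norm_integral_le_of_norm_le_const (Filter.Eventually.of_forall hb)).trans ?_
    simp [hν]
  have h1 := S.abs_integral_one_sub_transv_le hs hH hμ hG4
  rw [hsplit]
  refine (abs_add_le _ _).trans ((add_le_add h1 hmain).trans ?_)
  have hb0 : 0 ≤ (ballConst d).toReal := ENNReal.toReal_nonneg
  rw [pairConst]
  have hx : 0 ≤ lam⁻¹ * ‖h‖ * s⁻¹ ^ 2 := by positivity
  have hy : 0 ≤ 4 * C * ((ballConst d).toReal * Real.pi) := by positivity
  nlinarith

/-- The average of a difference `f(z) - f(z - h)` is small. -/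
lemma abs_integral_sub_le (hs : 0 < s) (hs1 : s ≤ 1) (hH : S.IsWeight H C)
    (hμ : μ Set.univ ≤ 1) (hF : Measurable F) (hF2 : ∀ u, |F u| ≤ 2) {f : Euc d → ℝ}
    (hf : Measurable f) (hf1 : ∀ z, |f z| ≤ 1) (hc : HasCompactSupport f)
    (hlam : 0 < lam) (h : Euc d) :
    |∫ p : Euc d × Y × Euc d × Euc d, F p.1 *
      (f (p.1 + lam • S.chord p.2) - f (p.1 + lam • S.chord p.2 - h)) * H p ∂S.fullMeasure|
      ≤ pairConst d κ C * (s + lam⁻¹ * ‖h‖ * s⁻¹ ^ 2) := by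
  obtain ⟨φ, hφ, hφL, hφ1, hlim⟩ := exists_smooth_approx hf hf1 hc
  have hshm : Measurable fun p : Euc d × Y × Euc d × Euc d => p.1 + lam • S.chord p.2 :=
    S.measurable_shift
  have hFm : Measurable fun p : Euc d × Y × Euc d × Euc d => F p.1 := hF.comp measurable_fst
  -- The translated chord has an absolutely continuous distribution, so almost everywhere convergence
  -- can be evaluated along it.
  have hae : ∀ v : Euc d, ∀ᵐ p ∂S.fullMeasure, Filter.Tendsto
      (fun i => φ i (p.1 + lam • S.chord p.2 - v)) Filter.atTop
      (nhds (f (p.1 + lam • S.chord p.2 - v))) := by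
    intro v
    have hmp : MeasurePreserving (fun q : (Y × Euc d × Euc d) × Euc d =>
        (id q.1, q.2 + (lam • S.chord q.1 - v))) (S.pairMeasure.prod volume)
        (S.pairMeasure.prod volume) := by
      refine (MeasurePreserving.id _).skew_product
        (g := fun (z : Y × Euc d × Euc d) u => u + (lam • S.chord z - v)) ?_ ?_
      · exact measurable_snd.add
          (((S.measurable_chord.comp measurable_fst).const_smul lam).sub_const v)
      · exact Filter.Eventually.of_forall fun z =>
          (measurePreserving_add_right volume (lam • S.chord z - v)).map_eq
    have hq : Measure.QuasiMeasurePreserving (fun p : Euc d × Y × Euc d × Euc d =>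
        p.1 + lam • S.chord p.2 - v) S.fullMeasure volume := by
      have h1 : Measure.QuasiMeasurePreserving (Prod.snd : (Y × Euc d × Euc d) × Euc d → Euc d)
          (S.pairMeasure.prod volume) volume := Measure.quasiMeasurePreserving_snd
      have h2 := (h1.comp hmp.quasiMeasurePreserving).comp
        (Measure.measurePreserving_swap (μ := (volume : Measure (Euc d)))
          (ν := S.pairMeasure)).quasiMeasurePreserving
      convert! h2 using 1
      funext p
      simp [add_sub_assoc]
    exact hq.ae hlim
  have ht : Filter.Tendsto (fun i => ∫ p : Euc d × Y × Euc d × Euc d, F p.1 *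
      (φ i (p.1 + lam • S.chord p.2) - φ i (p.1 + lam • S.chord p.2 - h)) * H p ∂S.fullMeasure)
      Filter.atTop (nhds (∫ p : Euc d × Y × Euc d × Euc d, F p.1 *
      (f (p.1 + lam • S.chord p.2) - f (p.1 + lam • S.chord p.2 - h)) * H p ∂S.fullMeasure)) := by
    refine tendsto_integral_of_dominated_convergence (fun p => 4 * ‖H p‖) (fun i => ?_)
      ((S.integrable_weight hH hμ).norm.const_mul 4) (fun i => Filter.Eventually.of_forall fun p => ?_)
      ?_
    · have hm := (hφ i).continuous.measurable
      exact ((hFm.mul ((hm.comp hshm).sub (hm.comp (hshm.sub_const h)))).mul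
        hH.measurable).aestronglyMeasurable
    · rw [norm_mul, norm_mul]
      gcongr
      have h1 : ‖φ i (p.1 + lam • S.chord p.2) - φ i (p.1 + lam • S.chord p.2 - h)‖ ≤ 2 :=
        (norm_sub_le _ _).trans (by
          rw [Real.norm_eq_abs, Real.norm_eq_abs]
          linarith [hφ1 i (p.1 + lam • S.chord p.2), hφ1 i (p.1 + lam • S.chord p.2 - h)])
      calc _ ≤ (2 : ℝ) * 2 := mul_le_mul (hF2 _) h1 (norm_nonneg _) (by norm_num)
        _ = 4 := by norm_num
    · filter_upwards [hae 0, hae h] with p h1 h2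
      simp only [sub_zero] at h1
      exact ((h1.sub h2).const_mul _).mul_const _
  refine le_of_tendsto ht.abs (Filter.Eventually.of_forall fun i => ?_)
  obtain ⟨K, hK⟩ := hφL i
  exact S.abs_integral_sub_le_of_contDiff hs hs1 hH hμ hF hF2 (hφ i) (hφ1 i) hK hlam h

/-- The correlation over pairs of points of a function with its part oscillating at scale `L`. -/
lemma abs_integral_mul_le (hs : 0 < s) (hs1 : s ≤ 1) (hH : S.IsWeight H C)
    (hμ : μ Set.univ ≤ 1) (hF : Measurable F) (hF2 : ∀ u, |F u| ≤ 2) {f : Euc d → ℝ}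
    (hf : Measurable f) (hf1 : ∀ z, |f z| ≤ 1) (hc : HasCompactSupport f)
    (hlam : 0 < lam) {π : Measure (Euc d)} [IsProbabilityMeasure π] {L : ℝ}
    (hπ : ∀ᵐ h ∂π, ‖h‖ ≤ L) :
    |∫ p : Euc d × Y × Euc d × Euc d, F p.1 *
      (f (p.1 + lam • S.chord p.2) - ∫ h, f (p.1 + lam • S.chord p.2 - h) ∂π) * H p
        ∂S.fullMeasure|
      ≤ pairConst d κ C * (s + lam⁻¹ * L * s⁻¹ ^ 2) := by
  have hC := hH.nonneg
  have hP : 0 ≤ pairConst d κ C := by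
    have := S.derivConst_nonneg hC
    have := Real.pi_pos
    unfold pairConst; positivity
  set sh : Euc d × Y × Euc d × Euc d → Euc d := fun p => p.1 + lam • S.chord p.2 with hsh
  have hshm : Measurable sh := S.measurable_shift
  have hFm : Measurable fun p : Euc d × Y × Euc d × Euc d => F p.1 := hF.comp measurable_fst
  have hfi : ∀ z, Integrable (fun h => f (z - h)) π := fun z =>
    Integrable.of_bound (C := 1) (hf.comp (measurable_const.sub measurable_id)).aestronglyMeasurable
      (Filter.Eventually.of_forall fun h => hf1 _)
  have e1 : ∀ p, F p.1 * (f (sh p) - ∫ h, f (sh p - h) ∂π) * H p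
      = ∫ h, F p.1 * (f (sh p) - f (sh p - h)) * H p ∂π := by
    intro p
    rw [integral_mul_const, integral_const_mul, integral_sub (integrable_const _) (hfi _)]
    simp
  have hint : Integrable (Function.uncurry fun (p : Euc d × Y × Euc d × Euc d) (h : Euc d) =>
      F p.1 * (f (sh p) - f (sh p - h)) * H p) (S.fullMeasure.prod π) := by
    have h1 : Integrable (fun q : (Euc d × Y × Euc d × Euc d) × Euc d => H q.1)
        (S.fullMeasure.prod π) := (S.integrable_weight hH hμ).comp_fst π
    have hm : Measurable fun q : (Euc d × Y × Euc d × Euc d) × Euc d =>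
        F q.1.1 * (f (sh q.1) - f (sh q.1 - q.2)) :=
      (hFm.comp measurable_fst).mul ((hf.comp (hshm.comp measurable_fst)).sub
        (hf.comp ((hshm.comp measurable_fst).sub measurable_snd)))
    refine h1.bdd_mul (c := 4) hm.aestronglyMeasurable (Filter.Eventually.of_forall fun q => ?_)
    rw [norm_mul]
    have h1 : ‖f (sh q.1) - f (sh q.1 - q.2)‖ ≤ 2 := (norm_sub_le _ _).trans (by
      rw [Real.norm_eq_abs, Real.norm_eq_abs]
      linarith [hf1 (sh q.1), hf1 (sh q.1 - q.2)])
    calc _ ≤ (2 : ℝ) * 2 := mul_le_mul (hF2 _) h1 (norm_nonneg _) (by norm_num)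
      _ = 4 := by norm_num
  refine le_of_eq_of_le (congrArg abs (integral_congr_ae (ae_of_all _ e1))) ?_
  rw [integral_integral_swap hint, ← Real.norm_eq_abs]
  refine (norm_integral_le_of_norm_le_const (C := pairConst d κ C * (s + lam⁻¹ * L * s⁻¹ ^ 2))
    ?_).trans (by simp)
  filter_upwards [hπ] with h hh
  refine (S.abs_integral_sub_le hs hs1 hH hμ hF hF2 hf hf1 hc hlam h).trans ?_
  gcongr

end SphereFamily

/-! ### The random spheres of the distance graph -/

namespace DistanceGraph

open scoped InnerProductSpace ENNReal

variable {d n : ℕ}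

/-- The product over `i ≥ m` of the indicators of the cube, at the points `u - lam x_i`. -/
noncomputable def cubeProd (m : Fin (n + 1)) (lam : ℝ) (u : Euc d) (x : Fin (n + 1) → Euc d) : ℝ :=
  ∏ i, if i < m then 1 else (unitCube d).indicator (fun _ => (1 : ℝ)) (u - lam • x i)

lemma measurableSet_unitCube : MeasurableSet (unitCube d) := measurableSet_box

lemma measurable_indicator_unitCube :
    Measurable ((unitCube d).indicator fun _ => (1 : ℝ)) :=
  measurable_const.indicator measurableSet_unitCube

lemma abs_indicator_unitCube_le (z : Euc d) :
    |(unitCube d).indicator (fun _ => (1 : ℝ)) z| ≤ 1 := by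
  by_cases hz : z ∈ unitCube d <;> simp [hz]

lemma volume_unitCube : volume (unitCube d) = 1 := by
  rw [unitCube_eq_box, volume_box]; simp

lemma measurable_coord_shift (lam : ℝ) (i : Fin (n + 1)) :
    Measurable fun p : Euc d × (Fin (n + 1) → Euc d) => p.1 - lam • p.2 i := by
  have h1 : Measurable fun p : Euc d × (Fin (n + 1) → Euc d) => p.2 i :=
    (measurable_pi_apply i).comp measurable_snd
  exact measurable_fst.sub (h1.const_smul lam)

lemma measurable_cubeProd (m : Fin (n + 1)) (lam : ℝ) :
    Measurable (Function.uncurry (cubeProd (d := d) m lam)) := by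
  have h : ∀ i ∈ (Finset.univ : Finset (Fin (n + 1))),
      Measurable fun p : Euc d × (Fin (n + 1) → Euc d) =>
        if i < m then 1 else (unitCube d).indicator (fun _ => (1 : ℝ)) (p.1 - lam • p.2 i) := by
    intro i _
    split_ifs
    · exact measurable_const
    · exact measurable_indicator_unitCube.comp (measurable_coord_shift lam i)
  exact Finset.measurable_fun_prod _ h

lemma abs_cubeProd_factor_le (m : Fin (n + 1)) (lam : ℝ) (u : Euc d) (x : Fin (n + 1) → Euc d)
    (i : Fin (n + 1)) :
    |if i < m then 1 else (unitCube d).indicator (fun _ => (1 : ℝ)) (u - lam • x i)| ≤ 1 := by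
  split_ifs
  · simp
  · exact abs_indicator_unitCube_le _

lemma abs_cubeProd_le (m : Fin (n + 1)) (lam : ℝ) (u : Euc d) (x : Fin (n + 1) → Euc d) :
    |cubeProd m lam u x| ≤ 1 := by
  rw [cubeProd, Finset.abs_prod]
  exact Finset.prod_le_one (fun _ _ => abs_nonneg _) fun i _ => abs_cubeProd_factor_le m lam u x i

lemma lintegral_cubeProd_le (m : Fin (n + 1)) (lam : ℝ) (x : Fin (n + 1) → Euc d) :
    ∫⁻ u, ‖cubeProd m lam u x‖ₑ ≤ 1 := by
  calc ∫⁻ u, ‖cubeProd m lam u x‖ₑ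
      ≤ ∫⁻ u, (unitCube d).indicator (fun _ => (1 : ℝ≥0∞)) (u - lam • x m) := by
        refine lintegral_mono fun u => ?_
        rw [cubeProd, ← Finset.mul_prod_erase _ _ (Finset.mem_univ m), enorm_mul]
        simp only [lt_irrefl, if_false]
        have h1 : ‖∏ i ∈ Finset.univ.erase m, if i < m then (1 : ℝ) else
            (unitCube d).indicator (fun _ => (1 : ℝ)) (u - lam • x i)‖ₑ ≤ 1 := by
          rw [← ofReal_norm, Real.norm_eq_abs, Finset.abs_prod]
          exact ENNReal.ofReal_le_one.2 (Finset.prod_le_one (fun _ _ => abs_nonneg _)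
            fun i _ => abs_cubeProd_factor_le m lam u x i)
        refine (mul_le_of_le_one_right' h1).trans ?_
        by_cases hz : u - lam • x m ∈ unitCube d <;> simp [hz]
    _ = ∫⁻ u, (unitCube d).indicator (fun _ => (1 : ℝ≥0∞)) u :=
        lintegral_sub_right_eq_self _ _
    _ = 1 := by rw [lintegral_indicator_const measurableSet_unitCube, volume_unitCube, one_mul]

variable (d n) in
/-- The Lipschitz constant of `cubeProd` in the mean over translations. -/
noncomputable def cubeProdConst : NNReal := (n + 1) * (2 * boxConst d 0 1).toNNReal

lemma lintegral_cubeProd_sub_le (m : Fin (n + 1)) {lam : ℝ} (hlam : |lam| ≤ 1) (v : Euc d)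
    (x z : Fin (n + 1) → Euc d) :
    ∫⁻ u, ‖cubeProd m lam (u + v) x - cubeProd m lam u z‖ₑ
      ≤ cubeProdConst d n * (‖v‖ₑ + edist x z) := by
  set q : Euc d → ℝ := (unitCube d).indicator (fun _ => (1 : ℝ)) with hq
  have hqm : Measurable q := measurable_indicator_unitCube
  have hfac : ∀ i, ∫⁻ u, ‖q (u + v - lam • x i) - q (u - lam • z i)‖ₑ
      ≤ 2 * boxConst d 0 1 * (‖v‖ₑ + edist x z) := by
    intro i
    have e1 : ∀ u, ‖q (u + v - lam • x i) - q (u - lam • z i)‖ₑ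
        = (fun u => ‖q (u + (v - lam • (x i - z i))) - q u‖ₑ) (u - lam • z i) := by
      intro u
      simp only
      congr 3
      module
    simp only [e1]
    rw [lintegral_sub_right_eq_self (fun u => ‖q (u + (v - lam • (x i - z i))) - q u‖ₑ)]
    refine (lintegral_box_translate_sub_le (d := d) (a := 0) (b := 1) _).trans ?_
    gcongr
    refine enorm_sub_le.trans ?_
    gcongr
    rw [enorm_smul]
    refine (mul_le_of_le_one_left' ?_).trans ?_
    · rw [← ofReal_norm]; exact ENNReal.ofReal_le_one.2 hlam
    · rw [← edist_eq_enorm_sub]; exact edist_le_pi_edist x z i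
  calc ∫⁻ u, ‖cubeProd m lam (u + v) x - cubeProd m lam u z‖ₑ
      ≤ ∫⁻ u, ∑ i, ‖q (u + v - lam • x i) - q (u - lam • z i)‖ₑ := by
        refine lintegral_mono fun u => ?_
        refine (enorm_prod_sub_prod_le _ _ _ (fun i _ => abs_cubeProd_factor_le m lam _ x i)
          (fun i _ => abs_cubeProd_factor_le m lam u z i)).trans ?_
        refine Finset.sum_le_sum fun i _ => ?_
        split_ifs
        · simp
        · exact le_rfl
    _ = ∑ i, ∫⁻ u, ‖q (u + v - lam • x i) - q (u - lam • z i)‖ₑ := by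
        refine lintegral_finsetSum _ fun i _ => ?_
        exact ((hqm.comp ((measurable_id.add_const v).sub_const _)).sub
          (hqm.comp (measurable_id.sub_const _))).enorm
    _ ≤ ∑ _i : Fin (n + 1), 2 * boxConst d 0 1 * (‖v‖ₑ + edist x z) :=
        Finset.sum_le_sum fun i _ => hfac i
    _ = _ := by
        rw [cubeProdConst]
        push_cast
        rw [ENNReal.coe_toNNReal (ENNReal.mul_ne_top (by simp) boxConst_ne_top)]
        simp [mul_assoc]

variable (Γ : DistanceGraph d n) {η : Fin n → Euc d → ℝ} {r : ℝ}

/-- The regular partial configurations at which the vertex `j.succ` is to be placed. -/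
abbrev Stage (r : ℝ) (j : Fin n) : Type := ↥(Γ.regular r j ∩ Γ.partialConfig j)

/-- The distribution of the regular partial configurations. -/
noncomputable def stageLaw (r : ℝ) (j : Fin n) : Measure (Γ.Stage r j) :=
  (Γ.law r j).comap Subtype.val

variable {Γ}

lemma measurableSet_stage (j : Fin n) : MeasurableSet (Γ.regular r j ∩ Γ.partialConfig j) :=
  isOpen_regular.measurableSet.inter (isClosed_partialConfig _).measurableSet

lemma map_val_stageLaw (j : Fin n) :
    (Γ.stageLaw r j).map Subtype.val
      = (Γ.law r j).restrict (Γ.regular r j ∩ Γ.partialConfig j) :=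
  map_comap_subtype_coe (measurableSet_stage j) _

instance isFiniteMeasure_stageLaw (j : Fin n) : IsFiniteMeasure (Γ.stageLaw r j) := by
  refine ⟨?_⟩
  rw [← Set.preimage_univ (f := (Subtype.val : Γ.Stage r j → _)),
    ← Measure.map_apply measurable_subtype_coe MeasurableSet.univ, map_val_stageLaw]
  exact measure_lt_top _ _

lemma restrict_stage (h : Γ.Admissible η r) (j : Fin n) :
    (Γ.law r j).restrict (Γ.regular r j ∩ Γ.partialConfig j)
      = (Γ.law r j).restrict (Γ.regular r j) := by
  refine Measure.restrict_congr_set ?_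
  filter_upwards [ae_law_mem_partialConfig h j.2.le] with x hx
  exact propext ⟨fun hh => hh.1, fun hh => ⟨hh, hx⟩⟩

lemma stageLaw_univ_le (hr : 0 ≤ r) (j : Fin n) : Γ.stageLaw r j Set.univ ≤ 1 := by
  have h1 : Γ.stageLaw r j Set.univ = (Γ.stageLaw r j).map Subtype.val Set.univ := by
    rw [Measure.map_apply measurable_subtype_coe MeasurableSet.univ, Set.preimage_univ]
  rw [h1, map_val_stageLaw]
  exact (Measure.restrict_apply_le _ _).trans (law_univ_le hr j.2.le)

lemma map_mem_partialConfig (T : Euc d ≃ₗᵢ[ℝ] Euc d) {j : ℕ} {x : Fin (n + 1) → Euc d}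
    (hx : x ∈ Γ.partialConfig j) : (fun i => T (x i)) ∈ Γ.partialConfig j := by
  refine ⟨by simp [hx.1], fun i hi => by simp [hx.2.1 i hi], fun i i' hi hi' hadj => ?_⟩
  rw [← map_sub, LinearIsometryEquiv.norm_map]
  exact hx.2.2 i i' hi hi' hadj

/-- The action of rotations on regular partial configurations. -/
noncomputable def stageAct (j : Fin n) (T : Euc d ≃ₗᵢ[ℝ] Euc d) (y : Γ.Stage r j) : Γ.Stage r j :=
  ⟨fun i => T (y.1 i), (map_mem_regular T).2 y.2.1, map_mem_partialConfig T y.2.2⟩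

lemma measurePreserving_stageAct (h : Γ.Admissible η r) (j : Fin n) (T : Euc d ≃ₗᵢ[ℝ] Euc d) :
    MeasurePreserving (stageAct (Γ := Γ) (r := r) j T) (Γ.stageLaw r j) (Γ.stageLaw r j) := by
  have hm : Measurable (stageAct (Γ := Γ) (r := r) j T) :=
    ((measurable_map_config T).comp measurable_subtype_coe).subtype_mk
  refine ⟨hm, ?_⟩
  have hemb := MeasurableEmbedding.subtype_coe (measurableSet_stage (Γ := Γ) (r := r) j)
  rw [← hemb.comap_map ((Γ.stageLaw r j).map _), ← hemb.comap_map (Γ.stageLaw r j)]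
  congr 1
  have h1 := (measurePreserving_restrict_regular T
    (measurePreserving_law (Γ := Γ) h.pos.le T j.2.le)).map_eq
  rw [← restrict_stage h j, ← map_val_stageLaw, Measure.map_map (measurable_map_config T)
    measurable_subtype_coe] at h1
  rw [hemb.comap_map, Measure.map_map measurable_subtype_coe hm]
  exact h1

variable (Γ r) in
/-- A bound for the radii and their inverses. -/
noncomputable def radiusBound (j : Fin n) : ℝ :=
  min (Real.sqrt r) (1 + Γ.len j (Γ.base j))⁻¹

/-- The sphere on which the vertex `j.succ` is to be placed. -/
noncomputable def stageSphere (h : Γ.Admissible η r) (j : Fin n) :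
    SphereFamily d (Γ.Stage r j) (Γ.stageLaw r j) (Γ.radiusBound r j) where
  proj y := normalProj (Γ.diffs j y.1)
  rad y := Real.sqrt (Γ.radSq j y.1)
  act := stageAct j
  measurable_proj := by
    have h1 : Continuous fun y : Γ.Stage r j => normalProj (Γ.diffs j y.1) := by
      refine continuous_iff_continuousAt.2 fun y => ?_
      have h2 : ContinuousAt (fun x => normalProj (Γ.diffs j x)) y.1 :=
        (contDiffAt_normalProj_diffs y.2.1.1).continuousAt
      exact h2.comp continuousAt_subtype_val
    exact ((h1.comp continuous_fst).clm_apply continuous_snd).measurable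
  measurable_rad := by
    refine Continuous.measurable (continuous_iff_continuousAt.2 fun y => ?_)
    have h2 := (contDiffAt_sqrt_radSq h.pos.le y.2.1).continuousAt
    exact h2.comp continuousAt_subtype_val
  pos := lt_min (Real.sqrt_pos.2 h.pos) (inv_pos.2 (by
    have : 0 ≤ Γ.len j (Γ.base j) := norm_nonneg _
    linarith))
  rad_ge y := (min_le_left _ _).trans (Real.sqrt_le_sqrt y.2.1.2.le)
  rad_le y := by
    have h0 : 0 ≤ Γ.len j (Γ.base j) := norm_nonneg _
    have h1 : Real.sqrt (Γ.radSq j y.1) ≤ Γ.len j (Γ.base j) := by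
      refine Real.sqrt_le_iff.2 ⟨h0, ?_⟩
      rw [radSq]
      linarith [sq_nonneg ‖Γ.relCenter j y.1‖]
    have h2 : 1 + Γ.len j (Γ.base j) ≤ (Γ.radiusBound r j)⁻¹ := by
      rw [radiusBound, le_inv_comm₀ (by linarith) (lt_min (Real.sqrt_pos.2 h.pos)
        (inv_pos.2 (by linarith)))]
      exact min_le_right _ _
    linarith
  proj_proj y := normalProj_normalProj y.2.1.1
  inner_proj y := inner_normalProj_left y.2.1.1
  exists_unit y v := by
    have hc := Γ.card_others (h.nonempty j)
    have hd := h.card_lt j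
    obtain ⟨e, he, hea, hev⟩ := exists_unit_innerMap_eq_zero (Γ.diffs j y.1) v
      (by rw [finrank_euclideanSpace_fin]; omega)
    exact ⟨e, he, normalProj_of_innerMap hea, hev⟩
  ae_proj_ne_zero y := ae_normalProj_diffs_ne_zero (h.nonempty j) (h.card_lt j)
  proj_act T y z := by
    change normalProj (Γ.diffs j fun i => T (y.1 i)) (T z) = _
    rw [diffs_map, normalProj_map]
  rad_act T y := by
    change Real.sqrt (Γ.radSq j fun i => T (y.1 i)) = _
    rw [radSq_map]
  measurePreserving_act := measurePreserving_stageAct h j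
  act_act T T' hT y := Subtype.ext (funext fun i => hT _)
  act_id T hT y := Subtype.ext (funext fun i => hT _)

lemma place_stage (h : Γ.Admissible η r) (j : Fin n) (y : Γ.Stage r j) (g : Euc d) :
    Γ.place r j y.1 g = Γ.center j y.1
      + (stageSphere h j).rad y • (stageSphere h j).direction y g :=
  place_of_mem y.2.1 g

lemma chord_stage (h : Γ.Admissible η r) (j : Fin n) (z : Γ.Stage r j × Euc d × Euc d) :
    (stageSphere h j).chord z = Γ.place r j z.1.1 z.2.1 - Γ.place r j z.1.1 z.2.2 := by
  rw [place_stage h, place_stage h, SphereFamily.chord, smul_sub, add_sub_add_left_eq_sub]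

/-- The density of the pairs of positions of the vertex `j.succ`: a product of two averages over the
later vertices, translated so that the first position is at the origin. -/
noncomputable def pairWeight (Γ : DistanceGraph d n) (η : Fin n → Euc d → ℝ) (r : ℝ) (j : Fin n)
    (lam : ℝ) (p : Euc d × Γ.Stage r j × Euc d × Euc d) : ℝ :=
  Γ.tailAt η r (cubeProd j.succ lam (p.1 + lam • Γ.place r j p.2.1.1 p.2.2.1)) (j + 1)
      (Γ.extend r j p.2.1.1 p.2.2.1) *
    Γ.tailAt η r (cubeProd j.succ lam (p.1 + lam • Γ.place r j p.2.1.1 p.2.2.1)) (j + 1)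
      (Γ.extend r j p.2.1.1 p.2.2.2)

lemma measurable_stage_extend (hr : 0 ≤ r) (j : Fin n) :
    Measurable fun p : Γ.Stage r j × Euc d => Γ.extend r j p.1.1 p.2 := by
  have h1 : Measurable fun p : Γ.Stage r j × Euc d => (p.1.1, p.2) :=
    (measurable_subtype_coe.comp measurable_fst).prodMk measurable_snd
  have h2 := (measurable_extend (Γ := Γ) hr j).comp h1
  exact h2

lemma measurable_stage_place (hr : 0 ≤ r) (j : Fin n) :
    Measurable fun p : Γ.Stage r j × Euc d => Γ.place r j p.1.1 p.2 := by
  have h1 : Measurable fun p : Γ.Stage r j × Euc d => (p.1.1, p.2) :=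
    (measurable_subtype_coe.comp measurable_fst).prodMk measurable_snd
  have h2 := (measurable_place (Γ := Γ) (j := j) hr).comp h1
  exact h2

lemma measurable_pairWeight (h : Γ.Admissible η r) (j : Fin n) (lam : ℝ) :
    Measurable (Γ.pairWeight η r j lam) := by
  have hT := measurable_tailAt h (measurable_cubeProd (d := d) j.succ lam) j.2
  have m1 : Measurable fun p : Euc d × Γ.Stage r j × Euc d × Euc d => (p.2.1, p.2.2.1) := by
    fun_prop
  have m2 : Measurable fun p : Euc d × Γ.Stage r j × Euc d × Euc d => (p.2.1, p.2.2.2) := by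
    fun_prop
  have mp := (measurable_stage_place (Γ := Γ) h.pos.le j).comp m1
  have me1 := (measurable_stage_extend (Γ := Γ) h.pos.le j).comp m1
  have me2 := (measurable_stage_extend (Γ := Γ) h.pos.le j).comp m2
  have ms := measurable_fst.add (mp.const_smul lam)
  have h1 := hT.comp (ms.prodMk me1)
  have h2 := hT.comp (ms.prodMk me2)
  exact h1.mul h2

lemma ae_stage_extend_mem (h : Γ.Admissible η r) (j : Fin n) :
    ∀ᵐ z ∂(stageSphere h j).pairMeasure, Γ.extend r j z.1.1 z.2.1 ∈ Γ.partialConfig (j + 1) ∧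
      Γ.extend r j z.1.1 z.2.2 ∈ Γ.partialConfig (j + 1) := by
  have hm := measurable_stage_extend (Γ := Γ) h.pos.le j
  have hms : MeasurableSet {q : Γ.Stage r j × Euc d |
      Γ.extend r j q.1.1 q.2 ∈ Γ.partialConfig (j + 1)} :=
    hm (isClosed_partialConfig _).measurableSet
  have hae : ∀ y : Γ.Stage r j, ∀ᵐ g ∂(ballMeasure d),
      Γ.extend r j y.1 g ∈ Γ.partialConfig (j + 1) := fun y => ae_extend_mem h y.2.2 y.2.1
  have key := SphereFamily.ae_pairMeasure (S := stageSphere h j)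
    (p := fun q : Γ.Stage r j × Euc d => Γ.extend r j q.1.1 q.2 ∈ Γ.partialConfig (j + 1)) hms hae
  exact key

variable (Γ η r) in
/-- A constant for the estimate of `exists_lintegral_tailAt_sub_le`, for the test functions
`cubeProd`. -/
def IsTailConst (j : ℕ) (C : NNReal) : Prop :=
  ∀ (m : Fin (n + 1)) (lam : ℝ), |lam| ≤ 1 → ∀ v, ∀ x ∈ Γ.partialConfig j,
    ∀ z ∈ Γ.partialConfig j,
    ∫⁻ u, ‖Γ.tailAt η r (cubeProd m lam (u + v)) j x - Γ.tailAt η r (cubeProd m lam u) j z‖ₑ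
      ≤ C * (‖v‖ₑ + edist x z)

lemma exists_isTailConst (h : Γ.Admissible η r) {j : ℕ} (hj : j ≤ n) :
    ∃ C, Γ.IsTailConst η r j C := by
  obtain ⟨C, hC⟩ := exists_lintegral_tailAt_sub_le h 1 (cubeProdConst d n) hj
  exact ⟨C, fun m lam hlam => hC (cubeProd m lam) (measurable_cubeProd m lam)
    (abs_cubeProd_le m lam) (lintegral_cubeProd_le m lam)
    fun v x z => lintegral_cubeProd_sub_le m hlam v x z⟩

lemma lintegral_tailAt_cubeProd_le (h : Γ.Admissible η r) (m : Fin (n + 1)) (lam : ℝ) {j : ℕ}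
    (hj : j ≤ n) (x : Fin (n + 1) → Euc d) :
    ∫⁻ u, ‖Γ.tailAt η r (cubeProd m lam u) j x‖ₑ ≤ 1 :=
  lintegral_enorm_tailAt_le h (measurable_cubeProd m lam) (lintegral_cubeProd_le m lam) hj x

/-- The variation of `pairWeight` in the mean over translations. -/
lemma lintegral_pairWeight_sub_le (h : Γ.Admissible η r) {j : Fin n} {C : NNReal}
    (hC : Γ.IsTailConst η r (j + 1) C) {lam : ℝ} (hlam : |lam| ≤ 1)
    {z z' : Γ.Stage r j × Euc d × Euc d}
    (hz : Γ.extend r j z.1.1 z.2.1 ∈ Γ.partialConfig (j + 1) ∧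
      Γ.extend r j z.1.1 z.2.2 ∈ Γ.partialConfig (j + 1))
    (hz' : Γ.extend r j z'.1.1 z'.2.1 ∈ Γ.partialConfig (j + 1) ∧
      Γ.extend r j z'.1.1 z'.2.2 ∈ Γ.partialConfig (j + 1)) :
    ∫⁻ u, ‖Γ.pairWeight η r j lam (u, z') - Γ.pairWeight η r j lam (u, z)‖ₑ
      ≤ C * (2 * edist (Γ.extend r j z'.1.1 z'.2.1) (Γ.extend r j z.1.1 z.2.1))
        + C * (edist (Γ.extend r j z'.1.1 z'.2.1) (Γ.extend r j z.1.1 z.2.1)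
          + edist (Γ.extend r j z'.1.1 z'.2.2) (Γ.extend r j z.1.1 z.2.2)) := by
  set x := Γ.extend r j z.1.1 z.2.1
  set x₂ := Γ.extend r j z.1.1 z.2.2
  set x' := Γ.extend r j z'.1.1 z'.2.1
  set x₂' := Γ.extend r j z'.1.1 z'.2.2
  set p := Γ.place r j z.1.1 z.2.1 with hp
  set p' := Γ.place r j z'.1.1 z'.2.1 with hp'
  set G : Euc d → (Fin (n + 1) → Euc d) → ℝ := fun u =>
    Γ.tailAt η r (cubeProd j.succ lam u) (j + 1) with hG
  have hGm : Measurable fun q : Euc d × (Fin (n + 1) → Euc d) => G q.1 q.2 :=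
    measurable_tailAt h (measurable_cubeProd (d := d) j.succ lam) j.2
  have hG1 : ∀ u x, ‖G u x‖ₑ ≤ 1 := fun u x => by
    rw [← ofReal_norm]
    exact ENNReal.ofReal_le_one.2 (abs_tailAt_le h (abs_cubeProd_le _ _ u) j.2 x)
  have hpx : p = x j.succ := by simp [x, extend, hp]
  have hpx' : p' = x' j.succ := by simp [x', extend, hp']
  have hlampp : ‖lam • p' - lam • p‖ₑ ≤ edist x' x := by
    rw [← smul_sub, enorm_smul]
    refine (mul_le_of_le_one_left' ?_).trans ?_
    · rw [← ofReal_norm]; exact ENNReal.ofReal_le_one.2 hlam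
    · rw [← edist_eq_enorm_sub, hpx, hpx']; exact edist_le_pi_edist x' x _
  have hone : ∀ a ∈ Γ.partialConfig (j + 1), ∀ b ∈ Γ.partialConfig (j + 1),
      ∫⁻ u, ‖G (u + lam • p') a - G (u + lam • p) b‖ₑ ≤ C * (edist x' x + edist a b) := by
    intro a ha b hb
    have e1 : ∀ u, ‖G (u + lam • p') a - G (u + lam • p) b‖ₑ
        = (fun u => ‖G (u + (lam • p' - lam • p)) a - G u b‖ₑ) (u + lam • p) := by
      intro u
      have e2 : u + lam • p + (lam • p' - lam • p) = u + lam • p' := by abel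
      simp only [e2]
    simp only [e1]
    rw [lintegral_add_right_eq_self (fun u => ‖G (u + (lam • p' - lam • p)) a - G u b‖ₑ)]
    refine (hC j.succ lam hlam _ a ha b hb).trans ?_
    gcongr
  have hGa : ∀ (a : Fin (n + 1) → Euc d) (v : Euc d), Measurable fun u => G (u + v) a :=
    fun a v => by
      have h1 : Measurable fun u : Euc d => (u + v, a) :=
        (measurable_id.add_const v).prodMk measurable_const
      have h2 := hGm.comp h1
      exact h2
  calc ∫⁻ u, ‖Γ.pairWeight η r j lam (u, z') - Γ.pairWeight η r j lam (u, z)‖ₑ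
      ≤ ∫⁻ u, (‖G (u + lam • p') x' - G (u + lam • p) x‖ₑ
          + ‖G (u + lam • p') x₂' - G (u + lam • p) x₂‖ₑ) := by
        refine lintegral_mono fun u => ?_
        have e1 : Γ.pairWeight η r j lam (u, z') - Γ.pairWeight η r j lam (u, z)
            = (G (u + lam • p') x' - G (u + lam • p) x) * G (u + lam • p') x₂'
              + G (u + lam • p) x * (G (u + lam • p') x₂' - G (u + lam • p) x₂) := by
          simp only [pairWeight, hG, x, x', x₂, x₂', p, p']; ring
        rw [e1]
        refine (enorm_add_le _ _).trans ?_
        rw [enorm_mul, enorm_mul]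
        gcongr
        · exact mul_le_of_le_one_right' (hG1 _ _)
        · exact mul_le_of_le_one_left' (hG1 _ _)
    _ = (∫⁻ u, ‖G (u + lam • p') x' - G (u + lam • p) x‖ₑ)
          + ∫⁻ u, ‖G (u + lam • p') x₂' - G (u + lam • p) x₂‖ₑ :=
        lintegral_add_left ((hGa _ _).sub (hGa _ _)).enorm _
    _ ≤ C * (edist x' x + edist x' x) + C * (edist x' x + edist x₂' x₂) :=
        add_le_add (hone _ hz'.1 _ hz.1) (hone _ hz'.2 _ hz.2)
    _ = _ := by rw [two_mul]

end DistanceGraph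

/-! ### The densities of pairs of positions are weights -/

namespace DistanceGraph

open scoped InnerProductSpace ENNReal

variable {d n : ℕ} {Γ : DistanceGraph d n} {η : Fin n → Euc d → ℝ} {r : ℝ}

/-- A motion that moves both positions, and the earlier vertices, by at most `δ` changes the density by
`O(δ)` in the mean. -/
lemma lintegral_pairWeight_motion_le (h : Γ.Admissible η r) {j : Fin n} {C : NNReal}
    (hC : Γ.IsTailConst η r (j + 1) C) {lam : ℝ} (hlam : |lam| ≤ 1)
    {φ : Γ.Stage r j × Euc d × Euc d → Γ.Stage r j × Euc d × Euc d}
    (hφ : MeasurePreserving φ (stageSphere h j).pairMeasure (stageSphere h j).pairMeasure)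
    {δ : ℝ≥0∞}
    (hδ : ∀ᵐ z ∂(stageSphere h j).pairMeasure,
      edist (Γ.extend r j (φ z).1.1 (φ z).2.1) (Γ.extend r j z.1.1 z.2.1) ≤ δ ∧
      edist (Γ.extend r j (φ z).1.1 (φ z).2.2) (Γ.extend r j z.1.1 z.2.2) ≤ δ) :
    ∫⁻ p : Euc d × Γ.Stage r j × Euc d × Euc d,
      ‖Γ.pairWeight η r j lam (p.1, φ p.2) - Γ.pairWeight η r j lam p‖ₑ
        ∂(stageSphere h j).fullMeasure ≤ C * (4 * δ) := by
  have hm := measurable_pairWeight h j lam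
  have hm1 : Measurable fun p : Euc d × Γ.Stage r j × Euc d × Euc d => (p.1, φ p.2) :=
    measurable_fst.prodMk (hφ.measurable.comp measurable_snd)
  have hm2 := hm.comp hm1
  have hm3 : Measurable fun p : Euc d × Γ.Stage r j × Euc d × Euc d =>
      ‖Γ.pairWeight η r j lam (p.1, φ p.2) - Γ.pairWeight η r j lam p‖ₑ := (hm2.sub hm).enorm
  have hmass : (stageSphere h j).pairMeasure Set.univ ≤ 1 := by
    rw [SphereFamily.pairMeasure, ← Set.univ_prod_univ, ← Set.univ_prod_univ, Measure.prod_prod,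
      Measure.prod_prod]
    simp only [measure_univ, mul_one]
    exact stageLaw_univ_le h.pos.le j
  have hmem := ae_stage_extend_mem h j
  have hmem' := hφ.quasiMeasurePreserving.ae hmem
  rw [SphereFamily.fullMeasure, lintegral_prod_symm _ hm3.aemeasurable]
  calc _ ≤ ∫⁻ _, C * (4 * δ) ∂(stageSphere h j).pairMeasure := by
        refine lintegral_mono_ae ?_
        filter_upwards [hmem, hmem', hδ] with z h1 h2 h3
        refine (lintegral_pairWeight_sub_le h hC hlam h1 h2).trans ?_
        calc _ ≤ C * (2 * δ) + C * (δ + δ) := by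
              gcongr
              exacts [h3.1, h3.1, h3.2]
          _ = C * (4 * δ) := by ring
    _ ≤ C * (4 * δ) := by
        rw [lintegral_const]
        exact mul_le_of_le_one_right' hmass

lemma fiber_pairWeight_le (h : Γ.Admissible η r) (j : Fin n) (lam : ℝ)
    (z : Γ.Stage r j × Euc d × Euc d) : ∫⁻ u, ‖Γ.pairWeight η r j lam (u, z)‖ₑ ≤ 1 := by
  calc ∫⁻ u, ‖Γ.pairWeight η r j lam (u, z)‖ₑ
      ≤ ∫⁻ u, (fun u => ‖Γ.tailAt η r (cubeProd j.succ lam u) (j + 1)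
          (Γ.extend r j z.1.1 z.2.1)‖ₑ) (u + lam • Γ.place r j z.1.1 z.2.1) := by
        refine lintegral_mono fun u => ?_
        rw [pairWeight, enorm_mul]
        refine mul_le_of_le_one_right' ?_
        rw [← ofReal_norm]
        exact ENNReal.ofReal_le_one.2 (abs_tailAt_le h (abs_cubeProd_le _ _ _) j.2 _)
    _ = ∫⁻ u, ‖Γ.tailAt η r (cubeProd j.succ lam u) (j + 1) (Γ.extend r j z.1.1 z.2.1)‖ₑ :=
        lintegral_add_right_eq_self (fun u => ‖Γ.tailAt η r (cubeProd j.succ lam u) (j + 1)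
          (Γ.extend r j z.1.1 z.2.1)‖ₑ) _
    _ ≤ 1 := lintegral_tailAt_cubeProd_le h _ lam j.2 _

lemma edist_stage_rotate_le (j : Fin n) {B : ℝ}
    (hB : ∀ x ∈ Γ.partialConfig (j + 1), ‖x‖ ≤ B) (t : ℝ) (a b : Euc d) {y : Γ.Stage r j}
    {g : Euc d} (hy : Γ.extend r j y.1 g ∈ Γ.partialConfig (j + 1)) :
    edist (Γ.extend r j (stageAct j (wedgeRot t a b) y).1 (wedgeRot t a b g))
      (Γ.extend r j y.1 g) ≤ ENNReal.ofReal (2 * ‖a‖ * ‖b‖ * B * |t|) := by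
  have h1 : Γ.extend r j (stageAct j (wedgeRot t a b) y).1 (wedgeRot t a b g)
      = fun i => wedgeRot t a b (Γ.extend r j y.1 g i) := extend_map _ _ _
  rw [h1, edist_pi_le_iff]
  intro i
  rw [edist_eq_enorm_sub, ← ofReal_norm]
  refine ENNReal.ofReal_le_ofReal ((norm_wedgeRot_sub_le _ _ _ _).trans ?_)
  have h2 : ‖Γ.extend r j y.1 g i‖ ≤ B := (norm_le_pi_norm _ i).trans (hB _ hy)
  gcongr

lemma edist_stage_slide_le (h : Γ.Admissible η r) (j : Fin n) (t : ℝ) {e : Euc d} (he : ‖e‖ ≤ 1)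
    (z : Γ.Stage r j × Euc d × Euc d) :
    edist (Γ.extend r j ((stageSphere h j).slide e t z).1.1 ((stageSphere h j).slide e t z).2.2)
      (Γ.extend r j z.1.1 z.2.2) ≤ ENNReal.ofReal ((Γ.radiusBound r j)⁻¹ * (2 * |t|)) := by
  have h1 := edist_extend_le (Γ := Γ) (r := r) j z.1.1 z.1.1
    ((stageSphere h j).slide e t z).2.2 z.2.2
  have h2 := (stageSphere h j).norm_wedgeRot_direction_sub_le he t z
  refine h1.trans ?_
  rw [edist_self, zero_add, place_stage h, place_stage h, add_sub_add_left_eq_sub, ← smul_sub,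
    ← ofReal_norm]
  refine ENNReal.ofReal_le_ofReal ?_
  rw [norm_smul, Real.norm_of_nonneg ((stageSphere h j).rad_pos _).le]
  have h3 := (stageSphere h j).direction_slide z.1 e z.2.1 z.2.2 t
  refine mul_le_mul ((stageSphere h j).rad_le _) ?_ (norm_nonneg _)
    (inv_nonneg.2 (stageSphere h j).pos.le)
  rw [← h3] at h2
  exact h2

/-- The densities `pairWeight` are weights, uniformly in the dilation `lam`. -/
lemma exists_isWeight_pairWeight (h : Γ.Admissible η r) (hpred : ∀ j : Fin n, (Γ.pred j).Nonempty)
    (j : Fin n) : ∃ C, ∀ lam : ℝ, |lam| ≤ 1 →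
      (stageSphere h j).IsWeight (Γ.pairWeight η r j lam) C := by
  obtain ⟨B, hB0, hB⟩ := exists_norm_le (Γ := Γ) hpred
  obtain ⟨C, hC⟩ := exists_isTailConst h (j := j + 1) j.2
  have hκ : 0 ≤ (Γ.radiusBound r j)⁻¹ := inv_nonneg.2 (stageSphere h j).pos.le
  refine ⟨1 + 8 * C * B + 8 * C * (Γ.radiusBound r j)⁻¹, fun lam hlam => ?_⟩
  have hCn : (0 : ℝ) ≤ C := C.2
  have hCB : 0 ≤ C * B := by positivity
  have hCκ : 0 ≤ C * (Γ.radiusBound r j)⁻¹ := by positivity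
  refine ⟨measurable_pairWeight h j lam, by positivity, fun z => ?_, fun t a b => ?_,
    fun t e he => ?_⟩
  · refine (fiber_pairWeight_le h j lam z).trans ?_
    rw [← ENNReal.ofReal_one]
    exact ENNReal.ofReal_le_ofReal (by linarith)
  · refine (lintegral_pairWeight_motion_le h hC hlam
      ((stageSphere h j).measurePreserving_rotate (wedgeRot t a b))
      (δ := ENNReal.ofReal (2 * ‖a‖ * ‖b‖ * B * |t|)) ?_).trans ?_
    · filter_upwards [ae_stage_extend_mem h j] with z hz
      exact ⟨edist_stage_rotate_le j (hB _) t a b hz.1,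
        edist_stage_rotate_le j (hB _) t a b hz.2⟩
    · rw [← ENNReal.ofReal_coe_nnreal, ← ENNReal.ofReal_ofNat 4,
        ← ENNReal.ofReal_mul (by norm_num), ← ENNReal.ofReal_mul hCn]
      refine ENNReal.ofReal_le_ofReal ?_
      have h0 : 0 ≤ ‖a‖ * ‖b‖ * |t| := by positivity
      nlinarith [mul_nonneg hCκ h0]
  · refine (lintegral_pairWeight_motion_le h hC hlam
      ((stageSphere h j).measurePreserving_slide e t)
      (δ := ENNReal.ofReal ((Γ.radiusBound r j)⁻¹ * (2 * |t|))) ?_).trans ?_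
    · refine Filter.Eventually.of_forall fun z => ⟨?_, edist_stage_slide_le h j t he z⟩
      have h1 : edist (Γ.extend r j ((stageSphere h j).slide e t z).1.1
          ((stageSphere h j).slide e t z).2.1) (Γ.extend r j z.1.1 z.2.1) = 0 := edist_self _
      rw [h1]
      exact bot_le
    · rw [← ENNReal.ofReal_coe_nnreal, ← ENNReal.ofReal_ofNat 4,
        ← ENNReal.ofReal_mul (by norm_num), ← ENNReal.ofReal_mul hCn]
      refine ENNReal.ofReal_le_ofReal ?_
      have h0 : 0 ≤ |t| := abs_nonneg t
      nlinarith [mul_nonneg hCB h0]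

end DistanceGraph

/-! ### Averages over small cubes -/

section CubeAverage

open scoped ENNReal

variable {d : ℕ} {L : ℝ} {f : Euc d → ℝ}

/-- The uniform distribution on the cube of side `L` centred at the origin. -/
noncomputable def cubeLaw (d : ℕ) (L : ℝ) : Measure (Euc d) :=
  ProbabilityTheory.cond volume (box d (-(L / 2)) (L / 2))

/-- The average of `f` over the cube of side `L` centred at `z`. -/
noncomputable def cubeAverage (L : ℝ) (f : Euc d → ℝ) (z : Euc d) : ℝ :=
  ∫ h, f (z - h) ∂(cubeLaw d L)

lemma volume_centred_box : volume (box d (-(L / 2)) (L / 2)) = ENNReal.ofReal L ^ d := by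
  rw [volume_box]; congr 2; ring

lemma isProbabilityMeasure_cubeLaw (hL : 0 < L) : IsProbabilityMeasure (cubeLaw d L) := by
  refine ProbabilityTheory.cond_isProbabilityMeasure_of_finite ?_ ?_
  · rw [volume_centred_box]
    exact pow_ne_zero _ (ENNReal.ofReal_pos.2 hL).ne'
  · rw [volume_centred_box]
    exact ENNReal.pow_ne_top ENNReal.ofReal_ne_top

lemma ae_norm_le_cubeLaw (hL : 0 < L) : ∀ᵐ h ∂(cubeLaw d L), ‖h‖ ≤ d * L := by
  refine Measure.ae_smul_measure ?_ _
  filter_upwards [ae_restrict_mem measurableSet_box] with h hh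
  rw [EuclideanSpace.norm_eq]
  refine Real.sqrt_le_iff.2 ⟨by positivity, ?_⟩
  calc ∑ i, ‖h i‖ ^ 2 ≤ ∑ _i : Fin d, L ^ 2 := by
        refine Finset.sum_le_sum fun i _ => ?_
        rw [Real.norm_eq_abs, sq_abs]
        nlinarith [hh i]
    _ = d * L ^ 2 := by simp
    _ ≤ (d * L) ^ 2 := by
        rw [mul_pow]
        refine mul_le_mul_of_nonneg_right ?_ (by positivity)
        rcases Nat.eq_zero_or_pos d with h0 | h0
        · simp [h0]
        · have : (1 : ℝ) ≤ d := by exact_mod_cast h0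
          nlinarith

lemma cubeKernel_eq (hL : 0 < L) (z : Euc d) :
    cubeKernel d L z = (L ^ d)⁻¹ * (box d (-(L / 2)) (L / 2)).indicator (fun _ => 1) z := by
  have h : L⁻¹ • z ∈ {y : Euc d | ∀ i, |y i| ≤ 1 / 2} ↔ z ∈ box d (-(L / 2)) (L / 2) := by
    refine forall_congr' fun i => ?_
    rw [PiLp.smul_apply, smul_eq_mul, abs_mul, abs_of_pos (inv_pos.2 hL), inv_mul_le_iff₀ hL,
      abs_le]
    have : L * (1 / 2) = L / 2 := by ring
    rw [this]
  rw [cubeKernel]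
  by_cases hz : z ∈ box d (-(L / 2)) (L / 2)
  · rw [Set.indicator_of_mem hz, Set.indicator_of_mem (h.2 hz)]
  · rw [Set.indicator_of_notMem hz, Set.indicator_of_notMem (fun hh => hz (h.1 hh))]

lemma convolution_cubeKernel (hL : 0 < L) {f' : Euc d → ℝ} (hf : f =ᵐ[volume] f') :
    f ⋆[ContinuousLinearMap.mul ℝ ℝ, volume] cubeKernel d L = cubeAverage L f' := by
  funext z
  have h1 : (f ⋆[ContinuousLinearMap.mul ℝ ℝ, volume] cubeKernel d L) z
      = ∫ t, (fun s => f' (z - s) * cubeKernel d L s) (z - t) := by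
    rw [convolution_def]
    refine integral_congr_ae ?_
    filter_upwards [hf] with t ht
    simp [ht]
  rw [h1, integral_sub_left_eq_self (fun s => f' (z - s) * cubeKernel d L s), cubeAverage, cubeLaw,
    ProbabilityTheory.cond, integral_smul_measure, volume_centred_box,
    ← integral_indicator measurableSet_box, smul_eq_mul, ← integral_const_mul]
  refine integral_congr_ae (Filter.Eventually.of_forall fun s => ?_)
  simp only [cubeKernel_eq hL]
  rw [ENNReal.toReal_inv, ENNReal.toReal_pow, ENNReal.toReal_ofReal hL.le]
  by_cases hs : s ∈ box d (-(L / 2)) (L / 2)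
  · simp [hs, mul_comm]
  · simp [hs]

lemma measurable_cubeAverage (hL : 0 < L) (hf : Measurable f) : Measurable (cubeAverage L f) := by
  have := isProbabilityMeasure_cubeLaw (d := d) hL
  have h1 : Measurable fun p : Euc d × Euc d => f (p.1 - p.2) :=
    hf.comp (measurable_fst.sub measurable_snd)
  exact (h1.stronglyMeasurable.integral_prod_right (ν := cubeLaw d L)).measurable

lemma abs_cubeAverage_le (hL : 0 < L) (hf1 : ∀ z, |f z| ≤ 1) (z : Euc d) :
    |cubeAverage L f z| ≤ 1 := by
  have := isProbabilityMeasure_cubeLaw (d := d) hL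
  have := norm_integral_le_of_norm_le_const (μ := cubeLaw d L) (f := fun h => f (z - h))
    (Filter.Eventually.of_forall fun h => hf1 _)
  rw [cubeAverage]
  simpa using this

lemma eLpNorm_cubeAverage_ne_top (hL : 0 < L) (hf : Measurable f) (hf1 : ∀ z, |f z| ≤ 1)
    (hf0 : ∀ z ∉ unitCube d, f z = 0) : eLpNorm (cubeAverage L f) 2 volume ≠ ⊤ := by
  have := isProbabilityMeasure_cubeLaw (d := d) hL
  have h2 : ∀ z, ‖cubeAverage L f z‖ₑ ≤ 1 := fun z => by
    rw [← ofReal_norm]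
    exact ENNReal.ofReal_le_one.2 (abs_cubeAverage_le hL hf1 z)
  have hfi : ∫⁻ z, ‖f z‖ₑ ≤ 1 := by
    calc ∫⁻ z, ‖f z‖ₑ ≤ ∫⁻ z, (unitCube d).indicator (fun _ => 1) z := by
          refine lintegral_mono fun z => ?_
          by_cases hz : z ∈ unitCube d
          · rw [Set.indicator_of_mem hz, ← ofReal_norm]
            exact ENNReal.ofReal_le_one.2 (hf1 z)
          · simp [hf0 z hz]
      _ = 1 := by
          rw [lintegral_indicator_const DistanceGraph.measurableSet_unitCube,
            DistanceGraph.volume_unitCube, one_mul]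
  have hm : Measurable fun p : Euc d × Euc d => ‖f (p.1 - p.2)‖ₑ :=
    (hf.comp (measurable_fst.sub measurable_snd)).enorm
  refine ((eLpNorm_lt_top_iff_lintegral_rpow_enorm_lt_top two_ne_zero ENNReal.ofNat_ne_top).2
    ?_).ne
  calc ∫⁻ z, ‖cubeAverage L f z‖ₑ ^ (2 : ℝ≥0∞).toReal
      ≤ ∫⁻ z, ‖cubeAverage L f z‖ₑ := by
        refine lintegral_mono fun z => ?_
        rw [ENNReal.toReal_ofNat, ENNReal.rpow_ofNat, sq]
        exact mul_le_of_le_one_left' (h2 z)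
    _ ≤ ∫⁻ z, ∫⁻ h, ‖f (z - h)‖ₑ ∂(cubeLaw d L) :=
        lintegral_mono fun z => enorm_integral_le_lintegral_enorm _
    _ = ∫⁻ h, ∫⁻ z, ‖f (z - h)‖ₑ ∂(volume : Measure (Euc d)) ∂(cubeLaw d L) :=
        lintegral_lintegral_swap hm.aemeasurable
    _ = ∫⁻ _h, ∫⁻ z, ‖f z‖ₑ ∂(volume : Measure (Euc d)) ∂(cubeLaw d L) := by
        refine lintegral_congr fun h => ?_
        exact lintegral_sub_right_eq_self (fun z => ‖f z‖ₑ) h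
    _ ≤ ∫⁻ _h, 1 ∂(cubeLaw d L) := lintegral_mono fun _ => hfi
    _ < ⊤ := by simp

lemma setLIntegral_enorm_translate_le {k : Euc d → ℝ} (hk : Measurable k) (v : Euc d) :
    ∫⁻ u in unitCube d, ‖k (u + v)‖ₑ ≤ eLpNorm k 2 volume := by
  have : IsProbabilityMeasure ((volume : Measure (Euc d)).restrict (unitCube d)) :=
    ⟨by rw [Measure.restrict_apply_univ, DistanceGraph.volume_unitCube]⟩
  have hm : Measurable fun u => k (u + v) := hk.comp (measurable_id.add_const v)
  calc ∫⁻ u in unitCube d, ‖k (u + v)‖ₑ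
      = eLpNorm (fun u => k (u + v)) 1 (volume.restrict (unitCube d)) :=
        eLpNorm_one_eq_lintegral_enorm.symm
    _ ≤ eLpNorm (fun u => k (u + v)) 2 (volume.restrict (unitCube d)) :=
        eLpNorm_le_eLpNorm_of_exponent_le one_le_two hm.aestronglyMeasurable
    _ ≤ eLpNorm (fun u => k (u + v)) 2 volume := eLpNorm_mono_measure _ Measure.restrict_le_self
    _ = eLpNorm k 2 volume :=
        eLpNorm_comp_measurePreserving hk.aestronglyMeasurable (measurePreserving_add_right _ v)

lemma IsCubeFunction.exists_measurable (hf : IsCubeFunction f) : ∃ f' : Euc d → ℝ,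
    Measurable f' ∧ (∀ z, |f' z| ≤ 1) ∧ (∀ z ∉ unitCube d, f' z = 0) ∧ f =ᵐ[volume] f' := by
  refine ⟨(unitCube d).indicator fun z => max (-1) (min 1 (hf.aemeasurable.mk f z)), ?_, ?_, ?_, ?_⟩
  · exact (measurable_const.max (measurable_const.min hf.aemeasurable.measurable_mk)).indicator
      DistanceGraph.measurableSet_unitCube
  · intro z
    by_cases hz : z ∈ unitCube d
    · rw [Set.indicator_of_mem hz, abs_le]
      exact ⟨le_max_left _ _, max_le (by norm_num) (min_le_left _ _)⟩
    · simp [hz]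
  · intro z hz
    exact Set.indicator_of_notMem hz _
  · filter_upwards [hf.aemeasurable.ae_eq_mk] with z hz
    by_cases hzQ : z ∈ unitCube d
    · obtain ⟨h1, h2⟩ := hf.mem_Icc z hzQ
      rw [Set.indicator_of_mem hzQ, ← hz, min_eq_right h2, max_eq_right h1]
    · rw [Set.indicator_of_notMem hzQ, hf.eq_zero z hzQ]

end CubeAverage

/-! ### The counting function as an average -/

namespace DistanceGraph

open scoped ENNReal

variable {d n : ℕ} {Γ : DistanceGraph d n} {η : Fin n → Euc d → ℝ} {r lam : ℝ}

lemma weight_zero (x : Fin (n + 1) → Euc d) : weight η 0 x = 1 := by simp [weight]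

lemma measurable_prod_shift {f : Fin (n + 1) → Euc d → ℝ} (hf : ∀ i, Measurable (f i)) (lam : ℝ) :
    Measurable fun p : Euc d × (Fin (n + 1) → Euc d) => ∏ i, f i (p.1 - lam • p.2 i) :=
  Finset.measurable_fun_prod _ fun i _ => (hf i).comp (measurable_coord_shift lam i)

/-- The counting function does not change if the functions are modified on null sets, although it
involves integrals over spheres: for almost every `u` these spheres do not see the exceptional set. -/
lemma countingFunction_eq (h : Γ.Admissible η r) {f f' : Fin (n + 1) → Euc d → ℝ}
    (hf' : ∀ i, Measurable (f' i)) (hff' : ∀ i, f i =ᵐ[volume] f' i) (lam : ℝ) :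
    Γ.countingFunction η f lam
      = ∫ u, Γ.tailAt η r (fun x => ∏ i, f' i (u - lam • x i)) 0 0 := by
  set Z : Set (Euc d) := toMeasurable volume {z | ∃ i, f i z ≠ f' i z} with hZ
  have hZm : MeasurableSet Z := measurableSet_toMeasurable _ _
  have hZ0 : volume Z = 0 := by
    rw [hZ, measure_toMeasurable]
    have h1 : ∀ᵐ z ∂(volume : Measure (Euc d)), ∀ i, f i z = f' i z := ae_all_iff.2 hff'
    have h2 := ae_iff.1 h1
    simpa only [not_forall] using h2
  set N : Set (Euc d × (Fin (n + 1) → Euc d)) := ⋃ i, {p | p.1 - lam • p.2 i ∈ Z} with hN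
  have hNm : MeasurableSet N := MeasurableSet.iUnion fun i => measurable_coord_shift lam i hZm
  have hNu : ∀ u, MeasurableSet {x | (u, x) ∈ N} := fun u => measurable_prodMk_left hNm
  have hfib : ∀ x, ∫⁻ u, ‖{x | (u, x) ∈ N}.indicator (fun _ => (1 : ℝ)) x‖ₑ
      ∂(volume : Measure (Euc d)) ≤ 0 := by
    intro x
    have h1 : volume {u : Euc d | (u, x) ∈ N} = 0 := by
      have h2 : {u : Euc d | (u, x) ∈ N} = ⋃ i, (fun u => u - lam • x i) ⁻¹' Z := by
        ext u; simp [hN]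
      rw [h2, measure_iUnion_null_iff]
      intro i
      rw [(measurePreserving_sub_right volume (lam • x i)).measure_preimage hZm.nullMeasurableSet,
        hZ0]
    have h3 : MeasurableSet {u : Euc d | (u, x) ∈ N} := measurable_prodMk_right hNm
    calc _ = ∫⁻ u, {u : Euc d | (u, x) ∈ N}.indicator (fun _ => 1) u := by
          refine lintegral_congr fun u => ?_
          by_cases hu : (u, x) ∈ N <;> simp [hu]
      _ ≤ 0 := by rw [lintegral_indicator_const h3, h1, mul_zero]
  have hNI : Measurable (Function.uncurry fun (u : Euc d) (x : Fin (n + 1) → Euc d) =>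
      {x | (u, x) ∈ N}.indicator (fun _ => (1 : ℝ)) x) := by
    have h1 : Measurable (N.indicator fun _ => (1 : ℝ)) := measurable_const.indicator hNm
    exact h1
  have hzero := lintegral_enorm_tailAt_le h hNI hfib (Nat.zero_le n) 0
  have hmz := measurable_tailAt h hNI (Nat.zero_le n)
  have hmz0 : Measurable fun u => Γ.tailAt η r
      (fun x => {x | (u, x) ∈ N}.indicator (fun _ => (1 : ℝ)) x) 0 0 := by
    have h1 : Measurable fun u : Euc d => (u, (0 : Fin (n + 1) → Euc d)) := measurable_prodMk_right
    have h2 := hmz.comp h1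
    exact h2
  have hae := (lintegral_eq_zero_iff hmz0.enorm).1 (le_antisymm hzero bot_le)
  rw [countingFunction]
  refine integral_congr_ae ?_
  filter_upwards [hae] with u hu
  have hu0 : Γ.tailAt η r ({x | (u, x) ∈ N}.indicator fun _ => (1 : ℝ)) 0 0 = 0 := by
    simpa using hu
  have hFm : Measurable fun x : Fin (n + 1) → Euc d => ∏ i, f' i (u - lam • x i) := by
    have h1 : Measurable fun x : Fin (n + 1) → Euc d => (u, x) := measurable_prodMk_left
    have h2 := (measurable_prod_shift hf' lam).comp h1
    exact h2
  have key := weight_mul_iteratedIntegral h (F := fun x => ∏ i, f i (u - lam • x i)) hFm (hNu u)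
    (fun x hx => ?_) (Nat.zero_le n) zero_mem_partialConfig hu0
  · rw [weight_zero, one_mul, List.drop_zero] at key
    exact key
  · refine Finset.prod_congr rfl fun i _ => ?_
    by_contra hne
    exact hx (Set.mem_iUnion.2 ⟨i, subset_toMeasurable _ _ ⟨i, hne⟩⟩)

/-- The product of the functions at the vertices before `m`. -/
noncomputable def lowProd (m : Fin (n + 1)) (lam : ℝ) (f : Fin (n + 1) → Euc d → ℝ) (u : Euc d)
    (x : Fin (n + 1) → Euc d) : ℝ :=
  ∏ i, if i < m then f i (u - lam • x i) else 1

lemma abs_lowProd_le (m : Fin (n + 1)) (lam : ℝ) {f : Fin (n + 1) → Euc d → ℝ}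
    (hf1 : ∀ i z, |f i z| ≤ 1) (u : Euc d) (x : Fin (n + 1) → Euc d) : |lowProd m lam f u x| ≤ 1 := by
  rw [lowProd, Finset.abs_prod]
  refine Finset.prod_le_one (fun _ _ => abs_nonneg _) fun i _ => ?_
  split_ifs
  · exact hf1 _ _
  · simp

lemma lowProd_eq_zero {m : Fin (n + 1)} (hm : 0 < m) {f : Fin (n + 1) → Euc d → ℝ}
    (hf0 : ∀ i, ∀ z ∉ unitCube d, f i z = 0) {u : Euc d} (hu : u ∉ unitCube d)
    {x : Fin (n + 1) → Euc d} (hx : x 0 = 0) : lowProd m lam f u x = 0 := by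
  refine Finset.prod_eq_zero (Finset.mem_univ 0) ?_
  rw [if_pos hm, hx, smul_zero, sub_zero, hf0 0 u hu]

lemma lowProd_update {m : Fin (n + 1)} {l : Fin (n + 1)} (hl : m ≤ l) (f : Fin (n + 1) → Euc d → ℝ)
    (u : Euc d) (x : Fin (n + 1) → Euc d) (y : Euc d) :
    lowProd m lam f u (Function.update x l y) = lowProd m lam f u x := by
  refine Finset.prod_congr rfl fun i _ => ?_
  split_ifs with hi
  · rw [Function.update_of_ne (hi.trans_le hl).ne]
  · rfl

lemma prod_eq_lowProd_mul {m : Fin (n + 1)} {f : Fin (n + 1) → Euc d → ℝ}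
    (hf0 : ∀ z ∉ unitCube d, f m z = 0)
    (hfm : ∀ i, m < i → f i = (unitCube d).indicator fun _ => (1 : ℝ)) (lam : ℝ) (u : Euc d)
    (x : Fin (n + 1) → Euc d) :
    ∏ i, f i (u - lam • x i)
      = lowProd m lam f u x * f m (u - lam • x m) * cubeProd m lam u x := by
  have h1 : f m (u - lam • x m) = ∏ i, if i = m then f i (u - lam • x i) else 1 := by
    rw [Finset.prod_ite_eq' Finset.univ m]; simp
  rw [lowProd, h1, cubeProd, ← Finset.prod_mul_distrib, ← Finset.prod_mul_distrib]
  refine Finset.prod_congr rfl fun i _ => ?_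
  rcases lt_trichotomy i m with hi | hi | hi
  · simp [hi, hi.ne]
  · subst hi
    by_cases hz : u - lam • x i ∈ unitCube d
    · simp [hz]
    · simp [hf0 _ hz]
  · simp [hi.not_gt, hi.ne', hfm i hi]

/-- The functions at the vertices up to `m` factor out of the average over the later vertices. -/
lemma tailAt_prod {m : Fin (n + 1)} {f : Fin (n + 1) → Euc d → ℝ}
    (hf0 : ∀ z ∉ unitCube d, f m z = 0)
    (hfm : ∀ i, m < i → f i = (unitCube d).indicator fun _ => (1 : ℝ)) (lam : ℝ) (u : Euc d)
    (x : Fin (n + 1) → Euc d) :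
    Γ.tailAt η r (fun x => ∏ i, f i (u - lam • x i)) m x
      = lowProd m lam f u x * f m (u - lam • x m) * Γ.tailAt η r (cubeProd m lam u) m x := by
  simp only [prod_eq_lowProd_mul hf0 hfm]
  refine tailAt_mul (a := fun x => lowProd m lam f u x * f m (u - lam • x m)) (m := m)
    (fun l hl x y => ?_) le_rfl (Nat.lt_succ_iff.1 m.2) x
  have h1 : m < l.succ := Fin.lt_def.2 (by simp; omega)
  rw [lowProd_update h1.le, Function.update_of_ne h1.ne]

end DistanceGraph

/-! ### Averages over the sphere of one vertex -/

lemma measurePreserving_shear {d : ℕ} {X : Type*} [MeasurableSpace X] {ν : Measure X} [SFinite ν]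
    {v : X → Euc d} (hv : Measurable v) :
    MeasurePreserving (fun p : Euc d × X => (p.1 + v p.2, p.2)) (volume.prod ν)
      (volume.prod ν) := by
  have h1 : MeasurePreserving (fun p : X × Euc d => (p.1, p.2 + v p.1)) (ν.prod volume)
      (ν.prod volume) := by
    refine (MeasurePreserving.id ν).skew_product (g := fun x u => u + v x) ?_
      (Filter.Eventually.of_forall fun x => map_add_right_eq_self _ _)
    exact measurable_snd.add (hv.comp measurable_fst)
  have h2 := (Measure.measurePreserving_swap (μ := ν) (ν := (volume : Measure (Euc d)))).comp
    (h1.comp (Measure.measurePreserving_swap (μ := (volume : Measure (Euc d))) (ν := ν)))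
  exact h2

namespace DistanceGraph

open scoped ENNReal

variable {d n : ℕ} {Γ : DistanceGraph d n} {η : Fin n → Euc d → ℝ} {r lam : ℝ}

variable (Γ η r) in
/-- The contribution of the point placed according to `g`, and of the later vertices, to the average
of `q` over the sphere of the vertex `j.succ`. -/
noncomputable def sphereTerm (j : Fin n) (lam : ℝ) (q : Euc d → ℝ) (u : Euc d) (y : Γ.Stage r j)
    (g : Euc d) : ℝ :=
  q (u - lam • Γ.place r j y.1 g) *
    Γ.tailAt η r (cubeProd j.succ lam u) (j + 1) (Γ.extend r j y.1 g)

variable (Γ η r) in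
/-- The average of `q` over the sphere of the vertex `j.succ`, weighted by the later vertices. -/
noncomputable def sphereAverage (j : Fin n) (lam : ℝ) (q : Euc d → ℝ) (u : Euc d)
    (y : Γ.Stage r j) : ℝ :=
  ∫ g, Γ.sphereTerm η r j lam q u y g ∂(ballMeasure d)

lemma measurable_sphereTerm (h : Γ.Admissible η r) (j : Fin n) (lam : ℝ) {q : Euc d → ℝ}
    (hq : Measurable q) :
    Measurable fun p : (Euc d × Γ.Stage r j) × Euc d =>
      Γ.sphereTerm η r j lam q p.1.1 p.1.2 p.2 := by
  have hT := measurable_tailAt h (measurable_cubeProd (d := d) j.succ lam) j.2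
  have m1 : Measurable fun p : (Euc d × Γ.Stage r j) × Euc d => (p.1.2, p.2) := by fun_prop
  have mu : Measurable fun p : (Euc d × Γ.Stage r j) × Euc d => p.1.1 := by fun_prop
  have mp := (measurable_stage_place (Γ := Γ) h.pos.le j).comp m1
  have me := (measurable_stage_extend (Γ := Γ) h.pos.le j).comp m1
  have h1 := hq.comp (mu.sub (mp.const_smul lam))
  have h2 := hT.comp (mu.prodMk me)
  exact h1.mul h2

lemma measurable_sphereAverage (h : Γ.Admissible η r) (j : Fin n) (lam : ℝ) {q : Euc d → ℝ}
    (hq : Measurable q) :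
    Measurable fun p : Euc d × Γ.Stage r j => Γ.sphereAverage η r j lam q p.1 p.2 := by
  have h1 := (measurable_sphereTerm h j lam hq).stronglyMeasurable.integral_prod_right'
    (ν := ballMeasure d)
  exact h1.measurable

lemma abs_sphereTerm_le (h : Γ.Admissible η r) (j : Fin n) (lam : ℝ) (q : Euc d → ℝ) (u : Euc d)
    (y : Γ.Stage r j) (g : Euc d) :
    |Γ.sphereTerm η r j lam q u y g| ≤ |q (u - lam • Γ.place r j y.1 g)| := by
  rw [sphereTerm, abs_mul]
  exact mul_le_of_le_one_right (abs_nonneg _) (abs_tailAt_le h (abs_cubeProd_le _ _ _) j.2 _)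

lemma integrable_sphereTerm (h : Γ.Admissible η r) (j : Fin n) (lam : ℝ) {q : Euc d → ℝ}
    (hq : Measurable q) {M : ℝ} (hM : ∀ z, |q z| ≤ M) (u : Euc d) (y : Γ.Stage r j) :
    Integrable (Γ.sphereTerm η r j lam q u y) (ballMeasure d) := by
  have h1 : Measurable fun g : Euc d => ((u, y), g) := measurable_prodMk_left
  have h2 := (measurable_sphereTerm h j lam hq).comp h1
  exact Integrable.of_bound (C := M) h2.aestronglyMeasurable
    (Filter.Eventually.of_forall fun g => (abs_sphereTerm_le h j lam q u y g).trans (hM _))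

lemma sphereAverage_sub (h : Γ.Admissible η r) (j : Fin n) (lam : ℝ) {f k : Euc d → ℝ}
    (hf : Measurable f) (hf1 : ∀ z, |f z| ≤ 1) (hk : Measurable k) (hk1 : ∀ z, |k z| ≤ 1)
    (u : Euc d) (y : Γ.Stage r j) :
    Γ.sphereAverage η r j lam (fun z => f z - k z) u y
      = Γ.sphereAverage η r j lam f u y - Γ.sphereAverage η r j lam k u y := by
  simp only [sphereAverage]
  rw [← integral_sub (integrable_sphereTerm h j lam hf hf1 u y)
    (integrable_sphereTerm h j lam hk hk1 u y)]
  refine integral_congr_ae (Filter.Eventually.of_forall fun g => ?_)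
  simp only [sphereTerm]
  ring

lemma integral_law_succ (h : Γ.Admissible η r) (j : Fin n) {φ : (Fin (n + 1) → Euc d) → ℝ}
    (hφ : Measurable φ) {M : ℝ} (hM : ∀ x, |φ x| ≤ M) :
    ∫ x, φ x ∂(Γ.law r (j + 1))
      = ∫ y : Γ.Stage r j, ∫ g, φ (Γ.extend r j y.1 g) ∂(ballMeasure d) ∂(Γ.stageLaw r j) := by
  have hm := measurable_extend (Γ := Γ) h.pos.le j
  rw [law_succ, integral_map hm.aemeasurable hφ.aestronglyMeasurable, integral_prod,
    ← restrict_stage h, ← map_val_stageLaw,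
    (MeasurableEmbedding.subtype_coe (measurableSet_stage j)).integral_map]
  have h1 := hφ.comp hm
  exact Integrable.of_bound (C := M) h1.aestronglyMeasurable
    (Filter.Eventually.of_forall fun p => hM _)

/-- The counting function as an average over the vertices before `j.succ` and over its sphere. -/
lemma countingFunction_eq_sphereAverage (h : Γ.Admissible η r) (j : Fin n)
    {f f' : Fin (n + 1) → Euc d → ℝ} (hf' : ∀ i, Measurable (f' i)) (hf1 : ∀ i z, |f' i z| ≤ 1)
    (hf0 : ∀ z ∉ unitCube d, f' j.succ z = 0)
    (hfm : ∀ i, j.succ < i → f' i = (unitCube d).indicator fun _ => (1 : ℝ))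
    (hff' : ∀ i, f i =ᵐ[volume] f' i) (lam : ℝ) :
    Γ.countingFunction η f lam = ∫ u, ∫ y : Γ.Stage r j, lowProd j.succ lam f' u y.1 *
      Γ.sphereAverage η r j lam (f' j.succ) u y ∂(Γ.stageLaw r j) := by
  rw [countingFunction_eq h hf' hff']
  refine integral_congr_ae (Filter.Eventually.of_forall fun u => ?_)
  have hFm : Measurable fun x : Fin (n + 1) → Euc d => ∏ i, f' i (u - lam • x i) := by
    have h1 : Measurable fun x : Fin (n + 1) → Euc d => (u, x) := measurable_prodMk_left
    have h2 := (measurable_prod_shift hf' lam).comp h1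
    exact h2
  have hF1 : ∀ x : Fin (n + 1) → Euc d, |∏ i, f' i (u - lam • x i)| ≤ 1 := fun x => by
    rw [Finset.abs_prod]
    exact Finset.prod_le_one (fun _ _ => abs_nonneg _) fun i _ => hf1 _ _
  simp only
  rw [← integral_tailAt_law h hFm hF1 (j := j + 1) j.2,
    integral_law_succ h j (measurable_tailAt' h hFm j.2) (abs_tailAt_le h hF1 j.2)]
  refine integral_congr_ae (Filter.Eventually.of_forall fun y => ?_)
  simp only [sphereAverage]
  rw [← integral_const_mul]
  refine integral_congr_ae (Filter.Eventually.of_forall fun g => ?_)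
  have h1 := tailAt_prod (Γ := Γ) (η := η) (r := r) hf0 hfm lam u (Γ.extend r j y.1 g)
  simp only [Fin.val_succ] at h1
  simp only [sphereTerm]
  rw [h1, mul_assoc]
  simp only [extend, lowProd_update le_rfl, Function.update_self]

/-- Only base points in the cube contribute, since the first vertex is at the origin. -/
lemma enorm_countingFunction_le (h : Γ.Admissible η r) (j : Fin n)
    {f f' : Fin (n + 1) → Euc d → ℝ} (hf' : ∀ i, Measurable (f' i)) (hf1 : ∀ i z, |f' i z| ≤ 1)
    (hf0 : ∀ i, ∀ z ∉ unitCube d, f' i z = 0)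
    (hfm : ∀ i, j.succ < i → f' i = (unitCube d).indicator fun _ => (1 : ℝ))
    (hff' : ∀ i, f i =ᵐ[volume] f' i) (lam : ℝ) :
    ‖Γ.countingFunction η f lam‖ₑ ≤ ∫⁻ u in unitCube d,
      ∫⁻ y, ‖Γ.sphereAverage η r j lam (f' j.succ) u y‖ₑ ∂(Γ.stageLaw r j) := by
  rw [countingFunction_eq_sphereAverage h j hf' hf1 (hf0 _) hfm hff',
    ← lintegral_indicator measurableSet_unitCube]
  refine (enorm_integral_le_lintegral_enorm _).trans (lintegral_mono fun u => ?_)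
  refine (enorm_integral_le_lintegral_enorm _).trans ?_
  by_cases hu : u ∈ unitCube d
  · rw [Set.indicator_of_mem hu]
    refine lintegral_mono fun y => ?_
    simp only
    rw [enorm_mul]
    refine mul_le_of_le_one_left' ?_
    rw [← ofReal_norm]
    exact ENNReal.ofReal_le_one.2 (abs_lowProd_le _ _ hf1 _ _)
  · rw [Set.indicator_of_notMem hu]
    have h1 : ∀ y : Γ.Stage r j, lowProd j.succ lam f' u y.1 = 0 := fun y =>
      lowProd_eq_zero (Fin.succ_pos j) hf0 hu y.2.2.1
    simp [h1]

/-- The contribution of `k` is bounded by its `L²` norm, as the cube has volume one. -/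
lemma setLIntegral_sphereAverage_le (h : Γ.Admissible η r) (j : Fin n) (lam : ℝ) {k : Euc d → ℝ}
    (hk : Measurable k) :
    ∫⁻ u in unitCube d, ∫⁻ y, ‖Γ.sphereAverage η r j lam k u y‖ₑ ∂(Γ.stageLaw r j)
      ≤ eLpNorm k 2 volume := by
  have mp := measurable_stage_place (Γ := Γ) h.pos.le j
  have hm : Measurable fun q : Euc d × Γ.Stage r j × Euc d =>
      ‖k (q.1 - lam • Γ.place r j q.2.1.1 q.2.2)‖ₑ := by
    have m1 : Measurable fun q : Euc d × Γ.Stage r j × Euc d => q.2 := measurable_snd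
    have h1 := mp.comp m1
    have h2 := hk.comp (measurable_fst.sub (h1.const_smul lam))
    exact h2.enorm
  have hmu : ∀ u : Euc d, Measurable fun q : Γ.Stage r j × Euc d =>
      ‖k (u - lam • Γ.place r j q.1.1 q.2)‖ₑ := fun u => by
    have h1 : Measurable fun q : Γ.Stage r j × Euc d => (u, q) := measurable_prodMk_left
    have h2 := hm.comp h1
    exact h2
  calc ∫⁻ u in unitCube d, ∫⁻ y, ‖Γ.sphereAverage η r j lam k u y‖ₑ ∂(Γ.stageLaw r j)
      ≤ ∫⁻ u in unitCube d, ∫⁻ q, ‖k (u - lam • Γ.place r j q.1.1 q.2)‖ₑ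
          ∂((Γ.stageLaw r j).prod (ballMeasure d)) := by
        refine lintegral_mono fun u => ?_
        rw [lintegral_prod _ (hmu u).aemeasurable]
        refine lintegral_mono fun y => ?_
        refine (enorm_integral_le_lintegral_enorm _).trans (lintegral_mono fun g => ?_)
        simp only [← ofReal_norm]
        exact ENNReal.ofReal_le_ofReal (abs_sphereTerm_le h j lam k u y g)
    _ = ∫⁻ q, (∫⁻ u in unitCube d, ‖k (u - lam • Γ.place r j q.1.1 q.2)‖ₑ)
          ∂((Γ.stageLaw r j).prod (ballMeasure d)) := lintegral_lintegral_swap hm.aemeasurable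
    _ ≤ ∫⁻ _q, eLpNorm k 2 volume ∂((Γ.stageLaw r j).prod (ballMeasure d)) := by
        refine lintegral_mono fun q => ?_
        simp only [sub_eq_add_neg]
        exact setLIntegral_enorm_translate_le hk _
    _ ≤ eLpNorm k 2 volume := by
        rw [lintegral_const]
        refine mul_le_of_le_one_right' ?_
        rw [← Set.univ_prod_univ, Measure.prod_prod, measure_univ (μ := ballMeasure d), mul_one]
        exact stageLaw_univ_le h.pos.le j

/-- The product of the contributions of two points of the sphere. -/
noncomputable def pairTerm (Γ : DistanceGraph d n) (η : Fin n → Euc d → ℝ) (r : ℝ) (j : Fin n)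
    (lam : ℝ) (q : Euc d → ℝ) (p : Euc d × Γ.Stage r j × Euc d × Euc d) : ℝ :=
  Γ.sphereTerm η r j lam q p.1 p.2.1 p.2.2.1 * Γ.sphereTerm η r j lam q p.1 p.2.1 p.2.2.2

lemma pairTerm_shear (h : Γ.Admissible η r) (j : Fin n) (lam : ℝ) (q : Euc d → ℝ)
    (p : Euc d × Γ.Stage r j × Euc d × Euc d) :
    Γ.pairTerm η r j lam q (p.1 + lam • Γ.place r j p.2.1.1 p.2.2.1, p.2)
      = q p.1 * q (p.1 + lam • (stageSphere h j).chord p.2) * Γ.pairWeight η r j lam p := by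
  have h1 : p.1 + lam • Γ.place r j p.2.1.1 p.2.2.1 - lam • Γ.place r j p.2.1.1 p.2.2.2
      = p.1 + lam • (stageSphere h j).chord p.2 := by
    rw [chord_stage, smul_sub]; abel
  simp only [pairTerm, sphereTerm, pairWeight]
  rw [add_sub_cancel_right, h1]
  ring

lemma measurable_pairTerm (h : Γ.Admissible η r) (j : Fin n) (lam : ℝ) {q : Euc d → ℝ}
    (hq : Measurable q) : Measurable (Γ.pairTerm η r j lam q) := by
  have hm := measurable_sphereTerm h j lam hq
  have m1 : Measurable fun p : Euc d × Γ.Stage r j × Euc d × Euc d => ((p.1, p.2.1), p.2.2.1) := by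
    fun_prop
  have m2 : Measurable fun p : Euc d × Γ.Stage r j × Euc d × Euc d => ((p.1, p.2.1), p.2.2.2) := by
    fun_prop
  have h1 := hm.comp m1
  have h2 := hm.comp m2
  exact h1.mul h2

lemma measurable_pairShift (h : Γ.Admissible η r) (j : Fin n) (lam : ℝ) :
    Measurable fun z : Γ.Stage r j × Euc d × Euc d => lam • Γ.place r j z.1.1 z.2.1 := by
  have m1 : Measurable fun z : Γ.Stage r j × Euc d × Euc d => (z.1, z.2.1) := by fun_prop
  have h1 := (measurable_stage_place (Γ := Γ) h.pos.le j).comp m1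
  exact h1.const_smul lam

lemma integrable_pairTerm (h : Γ.Admissible η r) (j : Fin n) {lam C : ℝ}
    (hH : (stageSphere h j).IsWeight (Γ.pairWeight η r j lam) C) {q : Euc d → ℝ}
    (hq : Measurable q) {M : ℝ} (hM : ∀ z, |q z| ≤ M) :
    Integrable (Γ.pairTerm η r j lam q) (stageSphere h j).fullMeasure := by
  have hs := measurePreserving_shear (ν := (stageSphere h j).pairMeasure)
    (measurable_pairShift h j lam)
  refine (hs.integrable_comp (measurable_pairTerm h j lam hq).aestronglyMeasurable).1 ?_
  have h1 := (stageSphere h j).integrable_weight hH (stageLaw_univ_le h.pos.le j)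
  have m1 : Measurable fun p : Euc d × Γ.Stage r j × Euc d × Euc d =>
      q p.1 * q (p.1 + lam • (stageSphere h j).chord p.2) :=
    (hq.comp measurable_fst).mul (hq.comp (stageSphere h j).measurable_shift)
  have h2 := h1.bdd_mul (c := M * M) m1.aestronglyMeasurable
    (Filter.Eventually.of_forall fun p => ?_)
  · refine h2.congr (Filter.Eventually.of_forall fun p => ?_)
    exact (pairTerm_shear h j lam q p).symm
  · rw [norm_mul]
    exact mul_le_mul (hM _) (hM _) (norm_nonneg _) ((abs_nonneg _).trans (hM 0))

/-- The mean square of the average of `q` over the sphere is a correlation of `q` with itself over the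
chords of the sphere. -/
lemma lintegral_sphereAverage_sq (h : Γ.Admissible η r) (j : Fin n) {lam C : ℝ}
    (hH : (stageSphere h j).IsWeight (Γ.pairWeight η r j lam) C) {q : Euc d → ℝ}
    (hq : Measurable q) {M : ℝ} (hM : ∀ z, |q z| ≤ M) :
    ∫⁻ u, ∫⁻ y, ENNReal.ofReal (Γ.sphereAverage η r j lam q u y ^ 2) ∂(Γ.stageLaw r j)
      = ENNReal.ofReal (∫ p, q p.1 * q (p.1 + lam • (stageSphere h j).chord p.2) *
          Γ.pairWeight η r j lam p ∂(stageSphere h j).fullMeasure) := by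
  have hJ := integrable_pairTerm h j hH hq hM
  have hJm := measurable_pairTerm h j lam hq
  have hM0 : 0 ≤ M := (abs_nonneg _).trans (hM 0)
  have hterm : ∀ u (y : Γ.Stage r j) g, |Γ.sphereTerm η r j lam q u y g| ≤ M := fun u y g =>
    (abs_sphereTerm_le h j lam q u y g).trans (hM _)
  have hpair : ∀ u, ∫ z, Γ.pairTerm η r j lam q (u, z) ∂(stageSphere h j).pairMeasure
      = ∫ y, Γ.sphereAverage η r j lam q u y ^ 2 ∂(Γ.stageLaw r j) := by
    intro u
    have h1 : Measurable fun z : Γ.Stage r j × Euc d × Euc d => (u, z) := measurable_prodMk_left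
    have h2 := hJm.comp h1
    have h3 : Integrable (fun z => Γ.pairTerm η r j lam q (u, z))
        (stageSphere h j).pairMeasure := by
      refine Integrable.of_bound (C := M * M) h2.aestronglyMeasurable
        (Filter.Eventually.of_forall fun z => ?_)
      rw [pairTerm, norm_mul]
      exact mul_le_mul (hterm _ _ _) (hterm _ _ _) (norm_nonneg _) hM0
    rw [SphereFamily.pairMeasure] at h3 ⊢
    rw [integral_prod _ h3]
    refine integral_congr_ae (Filter.Eventually.of_forall fun y => ?_)
    simp only [pairTerm]
    rw [integral_prod_mul (Γ.sphereTerm η r j lam q u y) (Γ.sphereTerm η r j lam q u y), sq,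
      sphereAverage]
  have hinner : ∀ u, ∫⁻ y, ENNReal.ofReal (Γ.sphereAverage η r j lam q u y ^ 2) ∂(Γ.stageLaw r j)
      = ENNReal.ofReal (∫ z, Γ.pairTerm η r j lam q (u, z) ∂(stageSphere h j).pairMeasure) := by
    intro u
    have h1 : Measurable fun y : Γ.Stage r j => (u, y) := measurable_prodMk_left
    have h2 := (measurable_sphereAverage h j lam hq).comp h1
    rw [hpair u, ofReal_integral_eq_lintegral_ofReal]
    · refine Integrable.of_bound (C := M ^ 2) (h2.pow_const 2).aestronglyMeasurable
        (Filter.Eventually.of_forall fun y => ?_)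
      rw [norm_pow]
      refine pow_le_pow_left₀ (norm_nonneg _) ?_ 2
      have := norm_integral_le_of_norm_le_const (μ := ballMeasure d) (C := M)
        (f := Γ.sphereTerm η r j lam q u y)
        (Filter.Eventually.of_forall (hterm u y))
      simpa [sphereAverage] using this
    · exact Filter.Eventually.of_forall fun y => sq_nonneg _
  simp only [hinner]
  rw [← ofReal_integral_eq_lintegral_ofReal]
  · congr 1
    have hs := measurePreserving_shear (ν := (stageSphere h j).pairMeasure)
      (measurable_pairShift h j lam)
    rw [SphereFamily.fullMeasure] at hJ ⊢
    rw [← integral_prod _ hJ]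
    conv_lhs => rw [← hs.map_eq]
    rw [integral_map hs.measurable.aemeasurable hJm.aestronglyMeasurable]
    exact integral_congr_ae (Filter.Eventually.of_forall fun p => pairTerm_shear h j lam q p)
  · rw [SphereFamily.fullMeasure] at hJ
    exact hJ.integral_prod_left
  · refine Filter.Eventually.of_forall fun u => ?_
    change 0 ≤ ∫ z, Γ.pairTerm η r j lam q (u, z) ∂(stageSphere h j).pairMeasure
    rw [hpair]
    exact integral_nonneg fun y => sq_nonneg _

end DistanceGraph

/-! ### The estimates for the counting function -/

namespace DistanceGraph

open scoped ENNReal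

variable {d n : ℕ} {Γ : DistanceGraph d n} {η : Fin n → Euc d → ℝ} {r : ℝ}

lemma hasCompactSupport_of_unitCube {f : Euc d → ℝ} (hf0 : ∀ z ∉ unitCube d, f z = 0) :
    HasCompactSupport f := by
  refine HasCompactSupport.intro (K := Metric.closedBall 0 (Real.sqrt d))
    (isCompact_closedBall _ _) fun z hz => hf0 z fun hzQ => hz ?_
  rw [mem_closedBall_zero_iff, EuclideanSpace.norm_eq]
  refine Real.sqrt_le_sqrt ?_
  calc ∑ i, ‖z i‖ ^ 2 ≤ ∑ _i : Fin d, (1 : ℝ) := by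
        refine Finset.sum_le_sum fun i _ => ?_
        rw [Real.norm_eq_abs, sq_abs]
        nlinarith [hzQ i]
    _ = d := by simp

/-- The Cauchy-Schwarz inequality over the base point and the earlier vertices, in additive form. -/
lemma setLIntegral_sphereAverage_le_sq (h : Γ.Admissible η r) (j : Fin n) (lam : ℝ)
    {q : Euc d → ℝ} (hq : Measurable q) {ε : ℝ} (hε : 0 < ε) :
    ∫⁻ u in unitCube d, ∫⁻ y, ‖Γ.sphereAverage η r j lam q u y‖ₑ ∂(Γ.stageLaw r j)
      ≤ ENNReal.ofReal (ε / 2) + ENNReal.ofReal (ε⁻¹ / 2) *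
        ∫⁻ u, ∫⁻ y, ENNReal.ofReal (Γ.sphereAverage η r j lam q u y ^ 2) ∂(Γ.stageLaw r j) := by
  have hm : Measurable fun p : Euc d × Γ.Stage r j =>
      ENNReal.ofReal (Γ.sphereAverage η r j lam q p.1 p.2 ^ 2) :=
    ((measurable_sphereAverage h j lam hq).pow_const 2).ennreal_ofReal
  have hmu : ∀ u, Measurable fun y : Γ.Stage r j =>
      ENNReal.ofReal (Γ.sphereAverage η r j lam q u y ^ 2) := fun u => by
    have h1 : Measurable fun y : Γ.Stage r j => (u, y) := measurable_prodMk_left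
    have h2 := hm.comp h1
    exact h2
  have hmi : Measurable fun u => ∫⁻ y, ENNReal.ofReal (Γ.sphereAverage η r j lam q u y ^ 2)
      ∂(Γ.stageLaw r j) := hm.lintegral_prod_right'
  have hpt : ∀ a : ℝ, ‖a‖ₑ ≤ ENNReal.ofReal (ε / 2) + ENNReal.ofReal (ε⁻¹ / 2) *
      ENNReal.ofReal (a ^ 2) := fun a => by
    rw [← ENNReal.ofReal_mul (by positivity), ← ENNReal.ofReal_add (by positivity) (by positivity),
      ← ofReal_norm]
    refine ENNReal.ofReal_le_ofReal ?_
    rw [Real.norm_eq_abs, ← sq_abs a]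
    have h1 : ε * ε⁻¹ = 1 := mul_inv_cancel₀ hε.ne'
    have h2 : 0 ≤ ε⁻¹ * (|a| - ε) ^ 2 := by positivity
    have h3 : ε⁻¹ * (|a| - ε) ^ 2 = ε⁻¹ * |a| ^ 2 - 2 * (ε * ε⁻¹) * |a| + ε * (ε * ε⁻¹) := by ring
    rw [h3, h1] at h2
    linarith
  calc ∫⁻ u in unitCube d, ∫⁻ y, ‖Γ.sphereAverage η r j lam q u y‖ₑ ∂(Γ.stageLaw r j)
      ≤ ∫⁻ u in unitCube d, (ENNReal.ofReal (ε / 2) + ENNReal.ofReal (ε⁻¹ / 2) *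
          ∫⁻ y, ENNReal.ofReal (Γ.sphereAverage η r j lam q u y ^ 2) ∂(Γ.stageLaw r j)) := by
        refine lintegral_mono fun u => ?_
        refine (lintegral_mono fun y => hpt _).trans ?_
        rw [lintegral_add_left measurable_const, lintegral_const,
          lintegral_const_mul _ (hmu u)]
        gcongr
        exact mul_le_of_le_one_right' (stageLaw_univ_le h.pos.le j)
    _ = ENNReal.ofReal (ε / 2) + ENNReal.ofReal (ε⁻¹ / 2) * ∫⁻ u in unitCube d,
          ∫⁻ y, ENNReal.ofReal (Γ.sphereAverage η r j lam q u y ^ 2) ∂(Γ.stageLaw r j) := by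
        rw [lintegral_add_left measurable_const, setLIntegral_const, volume_unitCube,
          mul_one, lintegral_const_mul _ hmi]
    _ ≤ _ := by
        gcongr
        exact Measure.restrict_le_self

lemma le_toReal_add {t c : ℝ} (hc : 0 ≤ c) {E : ℝ≥0∞} (hE : E ≠ ⊤)
    (h : ‖t‖ₑ ≤ E + ENNReal.ofReal c) : |t| ≤ E.toReal + c := by
  rw [← ofReal_norm, Real.norm_eq_abs] at h
  have h1 := ENNReal.toReal_mono (ENNReal.add_ne_top.2 ⟨hE, ENNReal.ofReal_ne_top⟩) h
  rwa [ENNReal.toReal_ofReal (abs_nonneg _), ENNReal.toReal_add hE ENNReal.ofReal_ne_top,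
    ENNReal.toReal_ofReal hc] at h1

/-- The estimate when the last nontrivial function belongs to a vertex other than the first. -/
lemma exists_abs_countingFunction_succ_le (h : Γ.Admissible η r)
    (hpred : ∀ j : Fin n, (Γ.pred j).Nonempty) (j : Fin n) :
    ∃ C : ℝ, 0 ≤ C ∧ ∀ ε lam L : ℝ, 0 < ε → ε ≤ 1 → 0 < lam → lam ≤ 1 → 0 < L → L ≤ ε ^ 6 * lam →
      ∀ f f' : Fin (n + 1) → Euc d → ℝ, (∀ i, Measurable (f' i)) → (∀ i z, |f' i z| ≤ 1) →
        (∀ i, ∀ z ∉ unitCube d, f' i z = 0) →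
        (∀ i, j.succ < i → f' i = (unitCube d).indicator fun _ => (1 : ℝ)) →
        (∀ i, f i =ᵐ[volume] f' i) →
        |Γ.countingFunction η f lam|
          ≤ (eLpNorm (cubeAverage L (f' j.succ)) 2 volume).toReal + C * ε := by
  obtain ⟨C₁, hC₁⟩ := exists_isWeight_pairWeight h hpred j
  set P := SphereFamily.pairConst d (Γ.radiusBound r j) C₁ with hPdef
  have hP : 0 ≤ P := by
    have h0 := (hC₁ 0 (by simp)).nonneg
    have h1 := (stageSphere h j).derivConst_nonneg h0
    have h2 := Real.pi_pos
    rw [hPdef, SphereFamily.pairConst]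
    positivity
  refine ⟨1 / 2 + P * (1 + d) / 2, by positivity, ?_⟩
  intro ε lam L hε hε1 hlam hlam1 hL hLε f f' hf' hf1 hf0 hfm hff'
  have hπ1 := isProbabilityMeasure_cubeLaw (d := d) hL
  set k := cubeAverage L (f' j.succ) with hk
  have hkm : Measurable k := measurable_cubeAverage hL (hf' _)
  have hk1 : ∀ z, |k z| ≤ 1 := abs_cubeAverage_le hL (hf1 _)
  set q : Euc d → ℝ := fun z => f' j.succ z - k z with hqdef
  have hqm : Measurable q := (hf' _).sub hkm
  have hq2 : ∀ z, |q z| ≤ 2 := fun z => by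
    have h1 := abs_sub (f' j.succ z) (k z)
    linarith [hf1 j.succ z, hk1 z]
  have hH := hC₁ lam (by rw [abs_of_pos hlam]; exact hlam1)
  -- The scale `ε ^ 2` of the smoothing balances the two terms of the bilinear estimate.
  have hcorr := (stageSphere h j).abs_integral_mul_le (s := ε ^ 2) (by positivity)
    (pow_le_one₀ hε.le hε1) hH (stageLaw_univ_le h.pos.le j) hqm hq2 (hf' j.succ) (hf1 j.succ)
    (hasCompactSupport_of_unitCube (hf0 _)) hlam (ae_norm_le_cubeLaw hL)
  have hscale : ε ^ 2 + lam⁻¹ * (d * L) * (ε ^ 2)⁻¹ ^ 2 ≤ (1 + d) * ε ^ 2 := by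
    have h1 : lam⁻¹ * (d * L) * (ε ^ 2)⁻¹ ^ 2 ≤ lam⁻¹ * (d * (ε ^ 6 * lam)) * (ε ^ 2)⁻¹ ^ 2 := by
      gcongr
    have h2 : lam⁻¹ * (d * (ε ^ 6 * lam)) * (ε ^ 2)⁻¹ ^ 2 = d * ε ^ 2 := by
      field_simp
    linarith
  have hsq := lintegral_sphereAverage_sq h j hH hqm hq2
  have hq : ∫⁻ u in unitCube d, ∫⁻ y, ‖Γ.sphereAverage η r j lam q u y‖ₑ ∂(Γ.stageLaw r j)
      ≤ ENNReal.ofReal ((1 / 2 + P * (1 + d) / 2) * ε) := by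
    refine (setLIntegral_sphereAverage_le_sq h j lam hqm hε).trans ?_
    rw [hsq, ← ENNReal.ofReal_mul (by positivity)]
    have hD : (∫ p, q p.1 * q (p.1 + lam • (stageSphere h j).chord p.2) *
        Γ.pairWeight η r j lam p ∂(stageSphere h j).fullMeasure) ≤ P * ((1 + d) * ε ^ 2) :=
      ((le_abs_self _).trans hcorr).trans (mul_le_mul_of_nonneg_left hscale hP)
    calc _ ≤ ENNReal.ofReal (ε / 2) + ENNReal.ofReal (ε⁻¹ / 2 * (P * ((1 + d) * ε ^ 2))) := by
          gcongr
      _ = ENNReal.ofReal ((1 / 2 + P * (1 + d) / 2) * ε) := by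
          rw [← ENNReal.ofReal_add (by positivity) (by positivity)]
          congr 1
          field_simp
  refine le_toReal_add (by positivity)
    (eLpNorm_cubeAverage_ne_top hL (hf' _) (hf1 _) (hf0 _)) ?_
  calc ‖Γ.countingFunction η f lam‖ₑ
      ≤ ∫⁻ u in unitCube d, ∫⁻ y, ‖Γ.sphereAverage η r j lam (f' j.succ) u y‖ₑ
          ∂(Γ.stageLaw r j) := enorm_countingFunction_le h j hf' hf1 hf0 hfm hff' lam
    _ ≤ ∫⁻ u in unitCube d, ((∫⁻ y, ‖Γ.sphereAverage η r j lam k u y‖ₑ ∂(Γ.stageLaw r j))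
          + ∫⁻ y, ‖Γ.sphereAverage η r j lam q u y‖ₑ ∂(Γ.stageLaw r j)) := by
        refine lintegral_mono fun u => ?_
        have h1 : Measurable fun y : Γ.Stage r j => (u, y) := measurable_prodMk_left
        have h2 : Measurable fun y => Γ.sphereAverage η r j lam k u y :=
          (measurable_sphereAverage h j lam hkm).comp h1
        simp only
        rw [← lintegral_add_left h2.enorm]
        refine lintegral_mono fun y => ?_
        have h3 := sphereAverage_sub h j lam (hf' j.succ) (hf1 j.succ) hkm hk1 u y
        have h4 : Γ.sphereAverage η r j lam (f' j.succ) u y = Γ.sphereAverage η r j lam k u y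
            + Γ.sphereAverage η r j lam q u y := by rw [hqdef, h3]; ring
        rw [h4]
        exact enorm_add_le _ _
    _ = (∫⁻ u in unitCube d, ∫⁻ y, ‖Γ.sphereAverage η r j lam k u y‖ₑ ∂(Γ.stageLaw r j))
          + ∫⁻ u in unitCube d, ∫⁻ y, ‖Γ.sphereAverage η r j lam q u y‖ₑ ∂(Γ.stageLaw r j) :=
        lintegral_add_left (measurable_sphereAverage h j lam hkm).enorm.lintegral_prod_right' _
    _ ≤ _ := add_le_add (setLIntegral_sphereAverage_le h j lam hkm) hq

lemma tailAt_cubeProd_zero_eq_zero (lam : ℝ) {u : Euc d} (hu : u ∉ unitCube d) :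
    Γ.tailAt η r (cubeProd 0 lam u) 0 0 = 0 := by
  set a : (Fin (n + 1) → Euc d) → ℝ := fun x =>
    (unitCube d).indicator (fun _ => (1 : ℝ)) (u - lam • x 0) with ha
  have h1 : cubeProd (n := n) 0 lam u = fun x => a x * cubeProd 0 lam u x := by
    funext x
    by_cases hx : u - lam • x 0 ∈ unitCube d
    · simp [ha, hx]
    · have h2 : cubeProd 0 lam u x = 0 := by
        refine Finset.prod_eq_zero (Finset.mem_univ 0) ?_
        simp [hx]
      rw [h2, mul_zero]
  rw [h1, tailAt_mul (m := 0) (fun l _ x y => ?_) le_rfl (Nat.zero_le n)]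
  · simp [ha, hu]
  · simp [ha, Function.update_of_ne (Fin.succ_ne_zero l).symm]

/-- The estimate when only the function of the first vertex is nontrivial. -/
lemma exists_abs_countingFunction_zero_le (h : Γ.Admissible η r) :
    ∃ C : ℝ, 0 ≤ C ∧ ∀ ε lam L : ℝ, 0 < ε → ε ≤ 1 → 0 < lam → lam ≤ 1 → 0 < L → L ≤ ε ^ 6 * lam →
      ∀ f f' : Fin (n + 1) → Euc d → ℝ, (∀ i, Measurable (f' i)) → (∀ i z, |f' i z| ≤ 1) →
        (∀ i, ∀ z ∉ unitCube d, f' i z = 0) →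
        (∀ i, 0 < i → f' i = (unitCube d).indicator fun _ => (1 : ℝ)) →
        (∀ i, f i =ᵐ[volume] f' i) →
        |Γ.countingFunction η f lam|
          ≤ (eLpNorm (cubeAverage L (f' 0)) 2 volume).toReal + C * ε := by
  obtain ⟨C, hC⟩ := exists_isTailConst h (j := 0) (Nat.zero_le n)
  refine ⟨C * d, by positivity, ?_⟩
  intro ε lam L hε hε1 hlam hlam1 hL hLε f f' hf' hf1 hf0 hfm hff'
  have hπ1 := isProbabilityMeasure_cubeLaw (d := d) hL
  set k := cubeAverage L (f' 0) with hk
  have hkm : Measurable k := measurable_cubeAverage hL (hf' _)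
  set G : Euc d → ℝ := fun u => Γ.tailAt η r (cubeProd 0 lam u) 0 0 with hG
  have hGm : Measurable G := by
    have h1 : Measurable fun u : Euc d => (u, (0 : Fin (n + 1) → Euc d)) := measurable_prodMk_right
    have h2 := (measurable_tailAt h (measurable_cubeProd (d := d) (n := n) 0 lam)
      (Nat.zero_le n)).comp h1
    exact h2
  have hG1 : ∀ u, |G u| ≤ 1 := fun u => abs_tailAt_le h (abs_cubeProd_le _ _ _) (Nat.zero_le n) _
  have hGi : Integrable G := ⟨hGm.aestronglyMeasurable,
    (lintegral_tailAt_cubeProd_le h 0 lam (Nat.zero_le n) 0).trans_lt ENNReal.one_lt_top⟩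
  have hT : Γ.countingFunction η f lam = ∫ u, f' 0 u * G u := by
    rw [countingFunction_eq h hf' hff']
    refine integral_congr_ae (Filter.Eventually.of_forall fun u => ?_)
    have h1 := tailAt_prod (Γ := Γ) (η := η) (r := r) (m := 0) (hf0 0) hfm lam u 0
    have h2 : lowProd 0 lam f' u (0 : Fin (n + 1) → Euc d) = 1 := by simp [lowProd]
    rw [h2] at h1
    simpa using h1
  have hint : Integrable (fun p : Euc d × Euc d => f' 0 (p.1 - p.2) * G p.1)
      (volume.prod (cubeLaw d L)) := by
    refine (hGi.comp_fst (cubeLaw d L)).bdd_mul (c := 1) ?_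
      (Filter.Eventually.of_forall fun p => hf1 _ _)
    exact ((hf' 0).comp (measurable_fst.sub measurable_snd)).aestronglyMeasurable
  have hkG : ∫ u, k u * G u = ∫ h, ∫ u, f' 0 (u - h) * G u ∂volume ∂(cubeLaw d L) := by
    rw [← integral_integral_swap (f := fun u h => f' 0 (u - h) * G u) hint]
    refine integral_congr_ae (Filter.Eventually.of_forall fun u => ?_)
    simp only
    rw [integral_mul_const, hk, cubeAverage]
  have hfGi : Integrable fun u => f' 0 u * G u :=
    hGi.bdd_mul (c := 1) (hf' 0).aestronglyMeasurable (Filter.Eventually.of_forall fun u => hf1 _ _)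
  have hdiff : |(∫ u, f' 0 u * G u) - ∫ u, k u * G u| ≤ C * d * ε := by
    have h1 : (∫ u, f' 0 u * G u) - ∫ u, k u * G u = ∫ h, ((∫ u, f' 0 u * G u)
        - ∫ u, f' 0 (u - h) * G u) ∂(cubeLaw d L) := by
      rw [integral_sub (integrable_const _) hint.integral_prod_right, integral_const, hkG]
      simp
    rw [h1, ← Real.norm_eq_abs]
    have h2 : ∀ᵐ h ∂(cubeLaw d L), ‖(∫ u, f' 0 u * G u) - ∫ u, f' 0 (u - h) * G u‖
        ≤ C * (d * L) := by
      filter_upwards [ae_norm_le_cubeLaw (d := d) hL] with v hv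
      have e1 : ∫ u, f' 0 (u - v) * G u = ∫ u, f' 0 u * G (u + v) := by
        rw [← integral_add_right_eq_self (fun u => f' 0 (u - v) * G u) v]
        simp only [add_sub_cancel_right]
      have e2 : Integrable fun u => f' 0 u * G (u + v) :=
        (hGi.comp_add_right v).bdd_mul (c := 1) (hf' 0).aestronglyMeasurable
          (Filter.Eventually.of_forall fun u => hf1 _ _)
      have e3 : ‖(∫ u, f' 0 u * G u) - ∫ u, f' 0 (u - v) * G u‖ₑ ≤ C * ‖v‖ₑ := by
        rw [e1, ← integral_sub hfGi e2]
        refine (enorm_integral_le_lintegral_enorm _).trans ?_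
        have e4 := hC 0 lam (by rw [abs_of_pos hlam]; exact hlam1) v 0 zero_mem_partialConfig 0
          zero_mem_partialConfig
        rw [edist_self, add_zero] at e4
        refine (lintegral_mono fun u => ?_).trans e4
        rw [← mul_sub, enorm_mul, enorm_sub_rev]
        refine mul_le_of_le_one_left' ?_
        rw [← ofReal_norm]
        exact ENNReal.ofReal_le_one.2 (hf1 0 u)
      rw [← ofReal_norm, ← ofReal_norm v, ← ENNReal.ofReal_coe_nnreal,
        ← ENNReal.ofReal_mul C.coe_nonneg, ENNReal.ofReal_le_ofReal_iff
          (mul_nonneg C.coe_nonneg (norm_nonneg _))] at e3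
      exact e3.trans (mul_le_mul_of_nonneg_left hv C.coe_nonneg)
    refine (norm_integral_le_of_norm_le_const h2).trans ?_
    rw [probReal_univ, mul_one, mul_assoc]
    have h3 : L ≤ ε := hLε.trans (by
      have : ε ^ 6 ≤ ε := pow_le_of_le_one hε.le hε1 (by norm_num)
      nlinarith)
    gcongr
  have hkbound : ‖∫ u, k u * G u‖ₑ ≤ eLpNorm k 2 volume := by
    refine (enorm_integral_le_lintegral_enorm _).trans ?_
    have h1 := setLIntegral_enorm_translate_le hkm 0
    simp only [add_zero] at h1
    refine le_trans ?_ h1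
    rw [← lintegral_indicator measurableSet_unitCube]
    refine lintegral_mono fun u => ?_
    by_cases hu : u ∈ unitCube d
    · rw [Set.indicator_of_mem hu, enorm_mul]
      refine mul_le_of_le_one_right' ?_
      rw [← ofReal_norm]
      exact ENNReal.ofReal_le_one.2 (hG1 u)
    · have h2 : G u = 0 := tailAt_cubeProd_zero_eq_zero lam hu
      simp [h2]
  refine le_toReal_add (by positivity)
    (eLpNorm_cubeAverage_ne_top hL (hf' _) (hf1 _) (hf0 _)) ?_
  rw [hT]
  have h1 : ∫ u, f' 0 u * G u
      = (∫ u, k u * G u) + ((∫ u, f' 0 u * G u) - ∫ u, k u * G u) := by ring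
  rw [h1]
  refine (enorm_add_le _ _).trans (add_le_add hkbound ?_)
  rw [← ofReal_norm]
  exact ENNReal.ofReal_le_ofReal hdiff

end DistanceGraph

theorem proposition2 {d n k : ℕ} (hd : k + 1 ≤ d)
    (Γ : DistanceGraph d n) (hdeg : Γ.IsDegenerate k) (hproper : Γ.IsProper)
    (hpred : ∀ j : Fin n, (Γ.pred j).Nonempty)
    (η : Fin n → Euc d → ℝ) (hη : Γ.IsCutoff η) :
    ∃ C : ℝ, 0 < C ∧
      ∀ ε lam L : ℝ, 0 < ε → ε ≤ 1 → 0 < lam → lam ≤ 1 → 0 < L → L ≤ ε ^ 6 * lam →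
      ∀ (m : Fin (n + 1)) (f : Fin (n + 1) → Euc d → ℝ),
        (∀ i, i ≤ m → IsCubeFunction (f i)) →
        (∀ i, m < i → f i = Set.indicator (unitCube d) (fun _ => (1 : ℝ))) →
        |Γ.countingFunction η f lam| ≤ uOneNorm L (f m) + C * ε := by
  obtain ⟨r, h⟩ := Γ.exists_admissible hd hdeg hpred hη
  obtain ⟨C₀, hC₀, hbound₀⟩ := DistanceGraph.exists_abs_countingFunction_zero_le h
  choose C hC hbound using DistanceGraph.exists_abs_countingFunction_succ_le h hpred
  have hsum : 0 ≤ ∑ j, C j := Finset.sum_nonneg fun j _ => hC j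
  refine ⟨1 + C₀ + ∑ j, C j, by positivity, ?_⟩
  intro ε lam L hε hε1 hlam hlam1 hL hLε m f hf hfm
  have hex : ∀ i, ∃ g : Euc d → ℝ, Measurable g ∧ (∀ z, |g z| ≤ 1) ∧
      (∀ z ∉ unitCube d, g z = 0) ∧ f i =ᵐ[volume] g ∧
      (m < i → g = (unitCube d).indicator fun _ => (1 : ℝ)) := by
    intro i
    rcases le_or_gt i m with hi | hi
    · obtain ⟨g, h1, h2, h3, h4⟩ := (hf i hi).exists_measurable
      exact ⟨g, h1, h2, h3, h4, fun hh => absurd hi hh.not_ge⟩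
    · exact ⟨_, DistanceGraph.measurable_indicator_unitCube,
        DistanceGraph.abs_indicator_unitCube_le, fun z hz => Set.indicator_of_notMem hz _,
        by rw [hfm i hi], fun _ => rfl⟩
  choose f' hf' hf1 hf0 hff' hfm' using hex
  have hnorm : uOneNorm L (f m) = (eLpNorm (cubeAverage L (f' m)) 2 volume).toReal := by
    rw [uOneNorm, convolution_cubeKernel hL (hff' m)]
  rw [hnorm]
  obtain rfl | ⟨j, rfl⟩ := Fin.eq_zero_or_eq_succ m
  · refine (hbound₀ ε lam L hε hε1 hlam hlam1 hL hLε f f' hf' hf1 hf0 hfm' hff').trans ?_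
    gcongr
    linarith
  · refine (hbound j ε lam L hε hε1 hlam hlam1 hL hLε f f' hf' hf1 hf0 hfm' hff').trans ?_
    have := Finset.single_le_sum (fun i _ => hC i) (Finset.mem_univ j)
    gcongr
    linarith
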